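/- Setting. Fix $d\ge 1$ and let $N_0=\{\pm e_i\}_{i=1}^d\cup\{0\}\subset\mathbb Z^d$. Let $\mathcal S$ be a Polish space, each state $s\in\mathcal S$ carrying a probability measure $s(\cdot)$ on $N_0$ that depends measurably on $s$ (in particular, $\mathcal S$ may be a collection of probability measures on $N_0$). Let $K$ be a Markov kernel on $\mathcal S$ with a unique stationary distribution $\pi$. Let $\mathbf P^\pi$ be the law of an environment $\omega=(\omega_t(x))_{t\ge 0,\,x\in\mathbb Z^d}$ for which the processes $(\omega_t(x))_{t\ge0}$, $x\in\mathbb Z^d$, are i.i.d. stationary $K$-chains; write $\omega_t(x,y)=\omega_t(x)(y-x)$. Assume: (A1) there is $0<\kappa<1$ with $K(w,A)\ge\kappa\,\pi(A)$ for all $w\in\mathcal S$ and all Borel $A\subset\mathcal S$; (A2) there are $0<\varepsilon<1$ and a translation invariant Markov kernel $q(x,y)=q(y-x)$ with $q(0,\cdot)$ supported on $N_0$, $\big|\sum_{|y|=1}q(0,y)e^{i\ell\cdot y}\big|<1$ for all $\ell\in\mathbb Z^d\setminus\{0\}$, and $\mathbf P^\pi(\omega_t(x,y)\ge\varepsilon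 q(x,y))=1$ for all $x,y\in\mathbb Z^d$, $t\ge0$; (A3) $\kappa+\varepsilon^2>1$. Let $\overline{\mathbb P}^0$ be the following joint law of $(\omega,\alpha,\epsilon,X)$. The pairs $((\omega_t(x))_{t\ge0},(\alpha_t(x))_{t\ge1})$, $x\in\mathbb Z^d$, are i.i.d.; at each site, $\omega_0(x)\sim\pi$ and, for each $t\ge0$, given the past of the pair at that site up to time $t$, the coin $\alpha_{t+1}(x)$ equals $1$ with probability $\kappa$ and $0$ otherwise, and then $\omega_{t+1}(x)$ is drawn from $\pi$ if $\alpha_{t+1}(x)=1$ and from $\tilde K(\omega_t(x),\cdot)$, $\tilde K=(K-\kappa\pi)/(1-\kappa)$, if $\alpha_{t+1}(x)=0$. Independently, $(\epsilon_t)_{t\ge1}$ are i.i.d. with $\overline{\mathbb P}^0(\epsilon_t=1)=\varepsilon=1-\overline{\mathbb P}^0(\epsilon_t=0)$. Given $(\omega,\alpha,\epsilon)$, $X$ is a Markov chain on $\mathbb Z^d$ with $X_0=0$ and probability of a step from $X_t=x$ to $X_{t+1}=y$ equal to $q(x,y)$ if $\epsilon_{t+1}=1$ and to $(\omega_t(x,y)-\varepsilon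 q(x,y))/(1-\varepsilon)$ if $\epsilon_{t+1}=0$. Regeneration times. A time $s\ge 0$ is a proper visit to $x$ if $X_s=x$ and $\epsilon_{s+1}=0$. For $t\ge0$ and $x\in\mathbb Z^d$, if there is a proper visit to $x$ at some time $s<t$, let $\gamma_t(x)$ be the last such time $s<t$ and $\eta_t(x)=\inf\{s\ge1:\alpha_{\gamma_t(x)+s}(x)=1\}$; otherwise let $\gamma_t(x)=\eta_t(x)=0$. Put $$\tau_1=\inf\{t>0:\ \gamma_t(x)+\eta_t(x)<t\ \text{ for all }x\in\mathbb Z^d\}\in\mathbb N\cup\{\infty\}.$$ Let $\tau_0=0$ and, for $n\ge0$, let $\tau_{n+1}-\tau_n$ be the value of $\tau_1$ for the time-shifted data $(X_{\tau_n+t},\omega_{\tau_n+t},\alpha_{\tau_n+t},\epsilon_{\tau_n+t})_t$, with $\tau_{n+1}=\infty$ if $\tau_n=\infty$. Let $$\mathcal H_1=\sigma\big(\tau_1;\ (X_t)_{0\le t\le\tau_1};\ (\alpha_t(\cdot))_{1\le t\le\tau_1}\big)$$ be the $\sigma$-algebra generated by $\tau_1$ and by the walk and the $\alpha$-coins stopped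 at time $\tau_1$. Lemma. (i) For all measurable sets $A,B,C$ (in the path spaces of the walk, of the environment and of the $\alpha$-coins, respectively), $\overline{\mathbb P}^0$-a.s., $$\overline{\mathbb P}^0\Big((X_{\tau_1+t}-X_{\tau_1})_{t\ge0}\in A,\ (\omega_{\tau_1+t}(X_{\tau_1}+x))_{t\ge0,\,x\in\mathbb Z^d}\in B,\ (\alpha_{\tau_1+t}(X_{\tau_1}+x))_{t\ge1,\,x\in\mathbb Z^d}\in C\ \Big|\ \mathcal H_1\Big)$$ $$=\overline{\mathbb P}^0\Big((X_t)_{t\ge0}\in A,\ (\omega_t(x))_{t\ge0,\,x\in\mathbb Z^d}\in B,\ (\alpha_t(x))_{t\ge1,\,x\in\mathbb Z^d}\in C\Big).$$ (ii) $\overline{\mathbb P}^0(\tau_n<\infty)=1$ for all $n\ge1$, and the random vectors $(\tau_{n+1}-\tau_n,\ X_{\tau_{n+1}}-X_{\tau_n})$, $n\ge0$, are i.i.d. under $\overline{\mathbb P}^0$. -/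

import Mathlib

open MeasureTheory ProbabilityTheory
open scoped ENNReal

noncomputable section

namespace DynRWRE

/-- The sites of the lattice `ℤ^d`. -/
abbrev Site (d : ℕ) : Type := Fin d → ℤ

/-- The neighbours `{±e_i} ∪ {0}` of the origin, the origin included. -/
def nbrs (d : ℕ) : Finset (Site d) :=
  insert 0 (Finset.univ.image (fun i : Fin d => (Pi.single i 1 : Site d)) ∪
    Finset.univ.image (fun i : Fin d => (Pi.single i (-1) : Site d)))

/-- `f` is (the mass function of) a probability measure on `nbrs d`. -/
structure IsStepLaw {d : ℕ} (f : Site d → ℝ) : Prop where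
  nonneg : ∀ e, 0 ≤ f e
  eq_zero : ∀ e, e ∉ nbrs d → f e = 0
  sum_eq_one : ∑ e ∈ nbrs d, f e = 1

/-- The law, as a function of the starting point, of the Markov chain `(Z_n)_{n ≥ 0}` whose step
from time `n` to time `n + 1` is made with the transition kernel `P n`. -/
def markovChain {E : Type*} [MeasurableSpace E] (P : ℕ → Kernel E E)
    [∀ n, IsMarkovKernel (P n)] : Kernel E (ℕ → E) :=
  (Kernel.traj (X := fun _ : ℕ => E)
    (fun n => (P n).comap (fun h : (Finset.Iic n → E) => h ⟨n, by simp⟩) (by fun_prop)) 0).comap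
      (fun x _ => x) (by fun_prop)

instance {E : Type*} [MeasurableSpace E] (P : ℕ → Kernel E E) [∀ n, IsMarkovKernel (P n)] :
    IsMarkovKernel (markovChain P) := by
  unfold markovChain; infer_instance

/-- The environment chain at one site. A state `s : S` stands for the probability measure `p s` on
`nbrs d` (the probability of the jump `e` is `p s e`); the states evolve by the Markov kernel `K`,
whose unique stationary distribution is `π`. -/
structure EnvChain (d : ℕ) (S : Type*) [MeasurableSpace S] where
  p : S → Site d → ℝ
  isStepLaw : ∀ s, IsStepLaw (p s)
  measurable_p : ∀ e, Measurable (fun s => p s e)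
  K : Kernel S S
  isMarkov : IsMarkovKernel K
  π : Measure S
  isProb : IsProbabilityMeasure π
  stationary : K.Invariant π
  unique_stationary : ∀ ν : Measure S, IsProbabilityMeasure ν → K.Invariant ν → ν = π

attribute [instance] EnvChain.isMarkov EnvChain.isProb

/-- The law `𝐏^π` of the environment: independent stationary `K`-chains at the sites. The state at
time `t` and site `x` is `ω x t`, and the jump probability `ω_t(x, y)` is `p (ω x t) (y - x)`. -/
def EnvChain.envLaw {d : ℕ} {S : Type*} [MeasurableSpace S] (M : EnvChain d S) :
    Measure (Site d → ℕ → S) :=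
  Measure.infinitePi fun _ : Site d => M.π.bind (markovChain fun _ => M.K)

/-- A random walk in a dynamical Markovian environment satisfying the standing assumptions. -/
structure RWDRE (d : ℕ) (S : Type*) [MeasurableSpace S] extends EnvChain d S where
  κ : ℝ
  κ_pos : 0 < κ
  κ_lt_one : κ < 1
  /-- Uniform mixing of the environment chain. -/
  mixing : ∀ (w : S) (A : Set S), MeasurableSet A → ENNReal.ofReal κ * π A ≤ K w A
  ε : ℝ
  ε_pos : 0 < ε
  ε_lt_one : ε < 1
  /-- The translation invariant kernel of the ellipticity condition is `q(x, y) = q (y - x)`. -/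
  q : Site d → ℝ
  q_isStepLaw : IsStepLaw q
  q_nondegenerate : ∀ l : Site d, l ≠ 0 →
    ‖∑ y ∈ (nbrs d).erase 0, (q y : ℂ) * Complex.exp (Complex.I * ((∑ i, l i * y i : ℤ) : ℂ))‖ < 1
  elliptic : ∀ (x y : Site d) (t : ℕ),
    toEnvChain.envLaw {ω | ε * q (y - x) ≤ p (ω x t) (y - x)} = 1
  /-- The trade-off between mixing and ellipticity. -/
  tradeoff : 1 < κ + ε ^ 2

/-- The Bernoulli law: `true` with probability `r`, `false` with probability `1 - r`. -/
def coin (r : ℝ) : Measure Bool :=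
  ENNReal.ofReal r • Measure.dirac true + ENNReal.ofReal (1 - r) • Measure.dirac false

theorem coin_isProb {r : ℝ} (h0 : 0 < r) (h1 : r < 1) : IsProbabilityMeasure (coin r) := by
  constructor
  simp only [coin, Measure.add_apply, Measure.smul_apply, measure_univ, smul_eq_mul, mul_one]
  rw [← ENNReal.ofReal_add h0.le (by linarith)]
  simp

/-- A sample point `((η, ε), X)`: `η x t = (ω_t(x), α_t(x))` is the environment state at site `x` and
time `t`, with the `κ`-coin of that site and time; `ε t` is the `ε`-coin of time `t`; `X t` is the
position of the walk. The coins exist for `t ≥ 1` only: the entries `α_0` and `ε 0` are dummies,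
and nothing below uses them. -/
abbrev Sample (d : ℕ) (S : Type*) : Type _ :=
  ((Site d → ℕ → S × Bool) × (ℕ → Bool)) × (ℕ → Site d)

namespace RWDRE

variable {d : ℕ} {S : Type*} [MeasurableSpace S] (M : RWDRE d S)

instance : IsProbabilityMeasure (coin M.κ) := coin_isProb M.κ_pos M.κ_lt_one

instance : IsProbabilityMeasure (coin M.ε) := coin_isProb M.ε_pos M.ε_lt_one

theorem smul_π_le (w : S) : ENNReal.ofReal M.κ • M.π ≤ M.K w :=
  Measure.le_iff.2 fun A hA => by simpa using M.mixing w A hA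

instance : IsFiniteMeasure (ENNReal.ofReal M.κ • M.π) :=
  Measure.smul_finite _ ENNReal.ofReal_ne_top

/-- The kernel `K̃ = (K - κ π) / (1 - κ)`. -/
def tailKernel : Kernel S S where
  toFun w := (ENNReal.ofReal (1 - M.κ))⁻¹ • (M.K w - ENNReal.ofReal M.κ • M.π)
  measurable' := by
    refine Measure.measurable_of_measurable_coe _ fun A hA => ?_
    simp only [Measure.smul_apply, smul_eq_mul, Measure.sub_apply hA (M.smul_π_le _)]
    exact ((M.K.measurable_coe hA).sub_const _).const_mul _

instance : IsMarkovKernel M.tailKernel := by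
  refine ⟨fun w => ⟨?_⟩⟩
  have h1 := M.κ_lt_one
  change ((ENNReal.ofReal (1 - M.κ))⁻¹ • (M.K w - ENNReal.ofReal M.κ • M.π)) Set.univ = 1
  simp only [Measure.smul_apply, smul_eq_mul, Measure.sub_apply MeasurableSet.univ (M.smul_π_le _),
    measure_univ, mul_one]
  have h2 : (1 : ℝ≥0∞) - ENNReal.ofReal M.κ = ENNReal.ofReal (1 - M.κ) := by
    rw [ENNReal.ofReal_sub _ M.κ_pos.le, ENNReal.ofReal_one]
  rw [h2]
  exact ENNReal.inv_mul_cancel (ENNReal.ofReal_pos.2 (by linarith)).ne' ENNReal.ofReal_ne_top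

/-- A step of the environment once its coin `b` is tossed: from the state `w`, draw the new state
from `π` if the coin shows `true`, and from `K̃(w, ·)` otherwise. -/
def refresh : Kernel (S × Bool) S where
  toFun z := if z.2 = true then M.π else M.tailKernel z.1
  measurable' := Measurable.ite (measurable_snd (measurableSet_singleton true)) measurable_const
    (M.tailKernel.measurable.comp measurable_fst)

instance : IsMarkovKernel M.refresh := by
  refine ⟨fun z => ?_⟩
  change IsProbabilityMeasure (if z.2 = true then M.π else M.tailKernel z.1)
  split_ifs <;> infer_instance

/-- A step of the pair (environment state, coin) at one site: toss a fresh `κ`-coin, then make the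
step of the environment that it prescribes. -/
def siteStep : Kernel (S × Bool) (S × Bool) :=
  ((Kernel.const (S × Bool) (coin M.κ)) ⊗ₖ
    (M.refresh.comap (fun z : (S × Bool) × Bool => (z.1.1, z.2)) (by fun_prop))).map Prod.swap

instance : IsMarkovKernel M.siteStep := by
  unfold siteStep; exact Kernel.IsMarkovKernel.map _ measurable_swap

/-- The law of `(ω_t(x), α_t(x))_{t ≥ 0}` at one site, with `ω_0(x) ∼ π` (and a dummy `α_0(x)`). -/
def siteLaw : Measure (ℕ → S × Bool) :=
  (M.π.prod (Measure.dirac false)).bind (markovChain fun _ => M.siteStep)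

instance : IsProbabilityMeasure M.siteLaw := by
  unfold siteLaw; infer_instance

/-- The probability of the jump `e` out of a site in the state `s`: `q e` if the `ε`-coin shows
`true`, and `(p s e - ε q e) / (1 - ε)` otherwise. (For states `s` violating the ellipticity bound,
which a.s. never occur, that is not a probability vector, and we use `q` instead.) -/
def jumpProb (s : S) (b : Bool) (e : Site d) : ℝ :=
  open Classical in
  if b = true ∨ ¬ ∀ e' ∈ nbrs d, M.ε * M.q e' ≤ M.p s e' then M.q e
  else (M.p s e - M.ε * M.q e) / (1 - M.ε)

theorem jumpProb_nonneg (s : S) (b : Bool) {e : Site d} (he : e ∈ nbrs d) :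
    0 ≤ M.jumpProb s b e := by
  have h1 := M.ε_lt_one
  unfold jumpProb
  split_ifs with h
  · exact M.q_isStepLaw.nonneg e
  · push Not at h
    exact div_nonneg (by linarith [h.2 e he]) (by linarith)

theorem sum_jumpProb (s : S) (b : Bool) : ∑ e ∈ nbrs d, M.jumpProb s b e = 1 := by
  have h1 := M.ε_lt_one
  unfold jumpProb
  split_ifs with h
  · exact M.q_isStepLaw.sum_eq_one
  · rw [← Finset.sum_div, Finset.sum_sub_distrib, ← Finset.mul_sum, M.q_isStepLaw.sum_eq_one,
      (M.isStepLaw s).sum_eq_one, mul_one, div_self (by linarith)]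

theorem measurable_jumpProb (e : Site d) :
    Measurable fun z : S × Bool => M.jumpProb z.1 z.2 e := by
  have hp : ∀ e', Measurable fun z : S × Bool => M.p z.1 e' :=
    fun e' => (M.measurable_p e').comp measurable_fst
  unfold jumpProb
  refine Measurable.ite ?_ measurable_const (((hp e).sub_const _).div_const _)
  refine (measurable_snd (measurableSet_singleton true)).union (MeasurableSet.compl ?_)
  change MeasurableSet {z : S × Bool | ∀ e' ∈ nbrs d, M.ε * M.q e' ≤ M.p z.1 e'}
  have : {z : S × Bool | ∀ e' ∈ nbrs d, M.ε * M.q e' ≤ M.p z.1 e'} =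
      ⋂ e' ∈ nbrs d, {z : S × Bool | M.ε * M.q e' ≤ M.p z.1 e'} := by ext; simp
  rw [this]
  exact Finset.measurableSet_biInter _ fun e' _ => measurableSet_le measurable_const (hp e')

/-- The law of the jump of the walk, given the state of the environment where it stands and the
`ε`-coin. -/
def jumpKernel : Kernel (S × Bool) (Site d) where
  toFun z := ∑ e ∈ nbrs d, ENNReal.ofReal (M.jumpProb z.1 z.2 e) • Measure.dirac e
  measurable' := by
    refine Measure.measurable_of_measurable_coe _ fun A hA => ?_
    simp only [Measure.coe_finsetSum, Finset.sum_apply, Measure.smul_apply, smul_eq_mul]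
    exact Finset.measurable_sum _ fun e _ =>
      (M.measurable_jumpProb e).ennreal_ofReal.mul_const _

instance : IsMarkovKernel M.jumpKernel := by
  refine ⟨fun z => ⟨?_⟩⟩
  change (∑ e ∈ nbrs d, ENNReal.ofReal (M.jumpProb z.1 z.2 e) • Measure.dirac e :
    Measure (Site d)) Set.univ = 1
  simp only [Measure.coe_finsetSum, Finset.sum_apply, Measure.smul_apply, smul_eq_mul,
    measure_univ, mul_one]
  rw [← ENNReal.ofReal_sum_of_nonneg fun e he => M.jumpProb_nonneg z.1 z.2 he, M.sum_jumpProb]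
  simp

/-- What the walk reads at time `n`: the environment state `ω_n(X_n)` and the coin `ε_{n+1}`. -/
def look (n : ℕ) (z : ((Site d → ℕ → S × Bool) × (ℕ → Bool)) × Site d) : S × Bool :=
  ((z.1.1 z.2 n).1, z.1.2 (n + 1))

theorem measurable_look (n : ℕ) : Measurable (look (d := d) (S := S) n) :=
  measurable_from_prod_countable_left fun x => by
    have h1 : Measurable fun z : (Site d → ℕ → S × Bool) × (ℕ → Bool) => z.1 x n :=
      (measurable_pi_apply n).comp ((measurable_pi_apply x).comp measurable_fst)
    have h2 : Measurable fun z : (Site d → ℕ → S × Bool) × (ℕ → Bool) => z.2 (n + 1) :=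
      (measurable_pi_apply (n + 1)).comp measurable_snd
    exact h1.fst.prodMk h2

/-- The step of the walk from time `n` to time `n + 1`, given the environment and the coins, which
are carried along unchanged in the first component of the state. -/
def walkStep (n : ℕ) : Kernel (((Site d → ℕ → S × Bool) × (ℕ → Bool)) × Site d)
    (((Site d → ℕ → S × Bool) × (ℕ → Bool)) × Site d) :=
  (Kernel.id ×ₖ M.jumpKernel.comap (look n) (measurable_look n)).map
    fun y => (y.1.1, y.1.2 + y.2)

instance (n : ℕ) : IsMarkovKernel (M.walkStep n) := by
  unfold walkStep; exact Kernel.IsMarkovKernel.map _ (by fun_prop)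

/-- The law of the walk started at `0`, given the environment and the coins. -/
def quenched : Kernel ((Site d → ℕ → S × Bool) × (ℕ → Bool)) (ℕ → Site d) :=
  ((markovChain M.walkStep).comap (fun η => (η, 0)) (by fun_prop)).map fun z n => (z n).2

instance : IsMarkovKernel M.quenched := by
  unfold quenched; exact Kernel.IsMarkovKernel.map _ (by fun_prop)

/-- The annealed law `ℙ̄⁰` on the enlarged space: the environments with their `κ`-coins are i.i.d.
over the sites, the `ε`-coins are i.i.d. and independent of them, and the walk follows its quenched
law. -/
def annealed : Measure (Sample d S) :=
  ((Measure.infinitePi fun _ : Site d => M.siteLaw).prod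
    (Measure.infinitePi fun _ : ℕ => coin M.ε)) ⊗ₘ M.quenched

instance : IsProbabilityMeasure M.annealed := by
  unfold annealed; infer_instance

end RWDRE

section Path

variable {d : ℕ} {S : Type*}

/-- The position `X_t`. -/
def X (σ : Sample d S) (t : ℕ) : Site d := σ.2 t

/-- The environment state `ω_t(x)`. -/
def env (σ : Sample d S) (t : ℕ) (x : Site d) : S := (σ.1.1 x t).1

/-- The `κ`-coin `α_t(x)`, `t ≥ 1`. -/
def kcoin (σ : Sample d S) (t : ℕ) (x : Site d) : Bool := (σ.1.1 x t).2

/-- The `ε`-coin `ε_t`, `t ≥ 1`; it decides about the move from `X_{t-1}` to `X_t`. -/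
def ecoin (σ : Sample d S) (t : ℕ) : Bool := σ.1.2 t

/-- The shift of time by `m`. -/
def shift (m : ℕ) (σ : Sample d S) : Sample d S :=
  ((fun x t => σ.1.1 x (m + t), fun t => σ.1.2 (m + t)), fun t => σ.2 (m + t))

/-- The times `s < t` of the proper visits to `x`, those from which the walk moves on according to
the environment. -/
def properVisits (σ : Sample d S) (t : ℕ) (x : Site d) : Finset ℕ :=
  (Finset.range t).filter fun s => X σ s = x ∧ ecoin σ (s + 1) = false

/-- `γ_t(x)`: the last proper visit to `x` before time `t`, or `0` if there is none. -/
def lastVisit (σ : Sample d S) (t : ℕ) (x : Site d) : ℕ := (properVisits σ t x).sup id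

/-- `η_t(x)`: the time that passes after `γ_t(x)` until a `κ`-coin at `x` shows `true`, or `0` if
there is no proper visit to `x` before time `t`. -/
def refreshDelay (σ : Sample d S) (t : ℕ) (x : Site d) : ℕ∞ :=
  if properVisits σ t x = ∅ then 0
  else sInf ((↑) '' {s : ℕ | 1 ≤ s ∧ kcoin σ (lastVisit σ t x + s) x = true})

/-- The regeneration time `τ₁`. -/
def τ₁ (σ : Sample d S) : ℕ∞ :=
  sInf ((↑) '' {t : ℕ | 0 < t ∧ ∀ x : Site d, (lastVisit σ t x : ℕ∞) + refreshDelay σ t x < t})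

/-- The successive regeneration times: `τ_0 = 0` and `τ_{n+1} = τ_n + τ₁ ∘ θ^{τ_n}`, which is `∞`
when `τ_n` is. -/
def τ : ℕ → Sample d S → ℕ∞
  | 0, _ => 0
  | n + 1, σ => τ n σ + τ₁ (shift (τ n σ).toNat σ)

/-- The increment `(τ_{n+1} - τ_n, X_{τ_{n+1}} - X_{τ_n})` (meaningful when `τ_{n+1} < ∞`). -/
def increment (n : ℕ) (σ : Sample d S) : ℕ∞ × Site d :=
  (τ (n + 1) σ - τ n σ, X σ (τ (n + 1) σ).toNat - X σ (τ n σ).toNat)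

/-- The σ-algebra `H₁` generated by `τ₁`, by the walk stopped at time `τ₁`, and by the `κ`-coins
`α_t(x)`, `t ≥ 1`, stopped at time `τ₁`. -/
abbrev H₁ (d : ℕ) (S : Type*) : MeasurableSpace (Sample d S) :=
  MeasurableSpace.comap
    (fun σ => (τ₁ σ, (fun t : ℕ => X σ (min (t : ℕ∞) (τ₁ σ)).toNat),
      (fun (t : ℕ) (x : Site d) => kcoin σ (min ((t + 1 : ℕ) : ℕ∞) (τ₁ σ)).toNat x)))
    (inferInstance : MeasurableSpace (ℕ∞ × (ℕ → Site d) × (ℕ → Site d → Bool)))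

/-- The walk after time `m`, relative to `X_m`: `(X_{m+t} - X_m)_{t ≥ 0}`. -/
def walkAfter (m : ℕ) (σ : Sample d S) : ℕ → Site d := fun t => X σ (m + t) - X σ m

/-- The environment from time `m` on, relative to `X_m`: `(ω_{m+t}(X_m + x))_{t ≥ 0, x}`. -/
def envAfter (m : ℕ) (σ : Sample d S) : ℕ → Site d → S := fun t x => env σ (m + t) (X σ m + x)

/-- The `κ`-coins after time `m`, relative to `X_m`; the entry `t` is `α_{m+t+1}(X_m + ·)`, so that
the sequence starts with the coins of time `m + 1`. -/
def kcoinAfter (m : ℕ) (σ : Sample d S) : ℕ → Site d → Bool :=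
  fun t x => kcoin σ (m + (t + 1)) (X σ m + x)

end Path

end DynRWRE

end

/-! The whole lemma rests on one factorisation. Fix the path of the walk and the `ε`-coins up to
time `t`. The quenched probability of the path is then a product over sites, and the factor of a
site reads its state only at proper visits, since a step with `ε`-coin `true` is made by `q`.
Suppose that after its last proper visit each site has tossed a `κ`-coin `true`. At that toss its
state is redrawn from `π`, and from then on no weight reads it. As `π` is invariant both for
redrawing from `π` and for `K̃` (`lintegral_refresh_stationary`), the state stays `π`-distributed
whatever the later coins show. So the history of the site from time `t` on is a fresh stationary
copy, independent of the path weight and of the coins (`lintegral_siteLaw_factor`). Taking the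
product over sites and adding the `ε`-coins gives `lintegral_coinLaw_factor`; with the quenched
Markov property `quenched_cylinder_inter` it becomes `annealed_regen`: on `Regen t`, the sample
restarted at time `t` is independent of the past. Summing over the values of `τ₁`, which is
determined by the past, gives `annealed_restart_τ₁`.

The restarted sample forgets the coins of its time `0`: they belong to the past, and a fresh sample
carries only dummies there. The reference law is therefore always that of `restart 0 σ`, on which
everything relevant agrees with `σ` almost surely.

Finiteness of `τ₁` comes from counting, on `{τ₁ > t}`, the proper visits not yet refreshed. A
pending visit survives one more time step with probability `1 - κ`, and a new one appears with
probability `1 - ε`. If no regeneration has occurred, at least one visit is pending, so the expected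
count shrinks by the factor `(1 - κ) + (1 - ε) < 1` at each step (`pendingMass_succ_le`).

Part (i) is the independence of the restarted sample from the stopped data, and part (ii) follows by
induction: the increment with index `n + 1` is the increment with index `n` of the sample restarted
at `τ₁` (`increment_succ_eq`). -/

noncomputable section

namespace DynRWRE

/-! ### Markov chains: uniqueness in law, first-step decomposition, images -/

section MarkovChain

variable {E : Type*}

/-- The sequence `x, z 0, z 1, …`. -/
def consSeq (x : E) (z : ℕ → E) : ℕ → E
  | 0 => x
  | n + 1 => z n

@[simp] lemma consSeq_zero (x : E) (z : ℕ → E) : consSeq x z 0 = x := rfl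

@[simp] lemma consSeq_succ (x : E) (z : ℕ → E) (n : ℕ) : consSeq x z (n + 1) = z n := rfl

variable [MeasurableSpace E]

lemma measurable_consSeq : Measurable fun p : E × (ℕ → E) => consSeq p.1 p.2 := by
  refine measurable_pi_iff.2 fun n => ?_
  cases n with
  | zero => exact measurable_fst
  | succ n => exact (measurable_pi_apply n).comp measurable_snd

lemma measurable_consSeq_right (x : E) : Measurable (consSeq x) :=
  measurable_consSeq.comp (by fun_prop : Measurable fun z : ℕ → E => (x, z))

variable (P : ℕ → Kernel E E) [∀ n, IsMarkovKernel (P n)]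

lemma map_markovChain_frestrictLe_compProd (x : E) (n : ℕ) :
    (markovChain P x).map (fun z => (Preorder.frestrictLe n z, z (n + 1))) =
      ((markovChain P x).map (Preorder.frestrictLe n)) ⊗ₘ
        ((P n).comap (fun h : (Finset.Iic n → E) => h ⟨n, by simp⟩) (by fun_prop)) := by
  simp only [markovChain, Kernel.comap_apply]
  rw [← Kernel.partialTraj_compProd_eq_map_traj (Nat.zero_le n), Kernel.traj_map_frestrictLe_apply]

/-- The Markov property in integrated form. The transition identities needed later are checked
against such test weights, without conditional expectations. -/
lemma lintegral_markovChain_last (x : E) (n : ℕ) {g : (Finset.Iic n → E) → ℝ≥0∞}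
    (hg : Measurable g) {B : Set E} (hB : MeasurableSet B) :
    ∫⁻ z, g (Preorder.frestrictLe n z) * B.indicator 1 (z (n + 1)) ∂markovChain P x =
      ∫⁻ z, g (Preorder.frestrictLe n z) * P n (z n) B ∂markovChain P x := by
  have h1 := congrArg (fun ν => ∫⁻ p, g p.1 * B.indicator 1 p.2 ∂ν)
    (map_markovChain_frestrictLe_compProd P x n)
  have hm : Measurable fun p : (Finset.Iic n → E) × E => g p.1 * B.indicator (1 : E → ℝ≥0∞) p.2 :=
    (hg.comp measurable_fst).mul ((measurable_one.indicator hB).comp measurable_snd)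
  have hm2 : Measurable fun p : (Finset.Iic n → E) => g p * P n (p ⟨n, by simp⟩) B :=
    hg.mul (((P n).measurable_coe hB).comp (measurable_pi_apply _))
  rw [lintegral_map hm (by fun_prop), Measure.lintegral_compProd hm] at h1
  rw [h1]
  have : ∀ a : (Finset.Iic n → E), ∫⁻ b, g a * B.indicator 1 b
      ∂((P n).comap (fun h : (Finset.Iic n → E) => h ⟨n, by simp⟩) (by fun_prop)) a =
      g a * P n (a ⟨n, by simp⟩) B := by
    intro a
    rw [lintegral_const_mul _ (measurable_one.indicator hB), lintegral_indicator_one hB,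
      Kernel.comap_apply]
  simp_rw [this]
  rw [lintegral_map hm2 (by fun_prop)]
  rfl

lemma markovChain_map_zero (x : E) :
    (markovChain P x).map (fun z => z 0) = Measure.dirac x := by
  simp only [markovChain, Kernel.comap_apply]
  have h := Kernel.traj_map_frestrictLe_apply (X := fun _ : ℕ => E)
    (κ := fun n => (P n).comap (fun h : (Finset.Iic n → E) => h ⟨n, by simp⟩) (by fun_prop))
    0 0 (fun _ => x)
  rw [Kernel.partialTraj_self, Kernel.id_apply] at h
  have h2 := congrArg (fun ν => ν.map (fun p : (Finset.Iic 0 → E) => p ⟨0, by simp⟩)) h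
  rw [Measure.map_map (by fun_prop) (by fun_prop), Measure.map_dirac' (by fun_prop)] at h2
  exact h2

/-- A probability measure on paths with the right initial value and one-step transitions is the law
of the Markov chain. -/
lemma eq_markovChain {x : E} {ν : Measure (ℕ → E)} [IsProbabilityMeasure ν]
    (h0 : ν.map (fun z => z 0) = Measure.dirac x)
    (hs : ∀ (n : ℕ) (g : (Finset.Iic n → E) → ℝ≥0∞), Measurable g → ∀ B : Set E, MeasurableSet B →
      ∫⁻ z, g (Preorder.frestrictLe n z) * B.indicator 1 (z (n + 1)) ∂ν =
        ∫⁻ z, g (Preorder.frestrictLe n z) * P n (z n) B ∂ν) :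
    ν = markovChain P x := by
  have key : ∀ n, ν.map (Preorder.frestrictLe (π := fun _ : ℕ => E) n) =
      (markovChain P x).map (Preorder.frestrictLe n) := by
    intro n
    induction n with
    | zero =>
      have e : (Preorder.frestrictLe 0 : (ℕ → E) → _) =
          (fun (y : E) (_ : Finset.Iic 0) => y) ∘ fun z => z 0 := by
        funext z i
        have : (i : ℕ) = 0 := Nat.le_zero.1 (Finset.mem_Iic.1 i.2)
        simp [this]
      rw [e, ← Measure.map_map (by fun_prop) (by fun_prop), ← Measure.map_map (by fun_prop)
        (by fun_prop), h0, markovChain_map_zero]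
    | succ n ih =>
      have hpair : ν.map (fun z => (Preorder.frestrictLe (π := fun _ : ℕ => E) n z, z (n + 1))) =
          (markovChain P x).map (fun z => (Preorder.frestrictLe n z, z (n + 1))) := by
        have : IsProbabilityMeasure (ν.map (fun z => (Preorder.frestrictLe (π := fun _ : ℕ => E) n z,
          z (n + 1)))) := Measure.isProbabilityMeasure_map (by fun_prop)
        refine Measure.ext_prod fun {A B} hA hB => ?_
        rw [Measure.map_apply (by fun_prop) (hA.prod hB),
          Measure.map_apply (by fun_prop) (hA.prod hB)]
        have hg : Measurable (A.indicator (1 : (Finset.Iic n → E) → ℝ≥0∞)) :=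
          measurable_one.indicator hA
        have e : ∀ μ : Measure (ℕ → E),
            μ ((fun z => (Preorder.frestrictLe (π := fun _ : ℕ => E) n z, z (n + 1))) ⁻¹' A ×ˢ B) =
            ∫⁻ z, A.indicator 1 (Preorder.frestrictLe n z) * B.indicator 1 (z (n + 1)) ∂μ := by
          intro μ
          rw [← lintegral_indicator_one ((by fun_prop : Measurable (fun z : ℕ → E =>
            (Preorder.frestrictLe (π := fun _ : ℕ => E) n z, z (n + 1)))) (hA.prod hB))]
          refine lintegral_congr fun z => ?_
          by_cases h1 : Preorder.frestrictLe (π := fun _ : ℕ => E) n z ∈ A <;>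
            by_cases h2 : z (n + 1) ∈ B <;> simp [Set.indicator, h1, h2]
        rw [e, e, hs n _ hg B hB, lintegral_markovChain_last P x n hg hB]
        have hm2 : Measurable fun p : (Finset.Iic n → E) =>
            A.indicator 1 p * P n (p ⟨n, by simp⟩) B :=
          hg.mul (((P n).measurable_coe hB).comp (measurable_pi_apply _))
        have h2 := congrArg (fun ν => ∫⁻ p, A.indicator 1 p * P n (p ⟨n, by simp⟩) B ∂ν) ih
        simp only at h2
        rw [lintegral_map hm2 (by fun_prop), lintegral_map hm2 (by fun_prop)] at h2
        exact h2
      have e : (Preorder.frestrictLe (n + 1) : (ℕ → E) → _) =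
          (fun (p : (Finset.Iic n → E) × E) (i : Finset.Iic (n + 1)) =>
            if h : (i : ℕ) ≤ n then p.1 ⟨i, by simpa using h⟩ else p.2) ∘
            fun z => (Preorder.frestrictLe n z, z (n + 1)) := by
        funext z i
        have hi : (i : ℕ) ≤ n + 1 := Finset.mem_Iic.1 i.2
        by_cases h : (i : ℕ) ≤ n
        · simp [h]
        · have : (i : ℕ) = n + 1 := by omega
          simp [this]
      have hme : Measurable (fun (p : (Finset.Iic n → E) × E) (i : Finset.Iic (n + 1)) =>
            if h : (i : ℕ) ≤ n then p.1 ⟨i, by simpa using h⟩ else p.2) := by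
        refine measurable_pi_iff.2 fun i => ?_
        by_cases h : (i : ℕ) ≤ n
        · simp only [h, dite_true]; fun_prop
        · simp only [h, dite_false]; fun_prop
      rw [e, ← Measure.map_map hme (by fun_prop), ← Measure.map_map hme (by fun_prop), hpair]
  -- Every finite index set lies in some `Finset.Iic n`, so agreement on initial segments makes both
  -- measures projective limits of one finite family, and these are unique.
  have hlim : ∀ ν' : Measure (ℕ → E), IsProbabilityMeasure ν' →
      (∀ n, ν'.map (Preorder.frestrictLe (π := fun _ : ℕ => E) n) =
        (markovChain P x).map (Preorder.frestrictLe n)) →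
      IsProjectiveLimit ν' fun I : Finset ℕ => (markovChain P x).map I.restrict := by
    intro ν' _ h I
    obtain ⟨n, hn⟩ : ∃ n, I ⊆ Finset.Iic n :=
      ⟨I.sup id, fun i hi => Finset.mem_Iic.2 (Finset.le_sup (f := id) hi)⟩
    have h2 : Measurable (Finset.restrict₂ (π := fun _ : ℕ => E) hn) :=
      Finset.measurable_restrict₂ hn
    have h3 : Measurable (Preorder.frestrictLe (π := fun _ : ℕ => E) n) := by fun_prop
    have := congrArg (Measure.map (Finset.restrict₂ (π := fun _ : ℕ => E) hn)) (h n)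
    rw [Measure.map_map h2 h3, Measure.map_map h2 h3] at this
    exact this
  have : ∀ I : Finset ℕ, IsFiniteMeasure ((markovChain P x).map I.restrict) := fun I => by
    infer_instance
  exact (hlim ν inferInstance key).unique (hlim _ inferInstance fun _ => rfl)

/-- Decomposition of a Markov chain at its first step. -/
lemma markovChain_eq_bind (x : E) :
    markovChain P x =
      (P 0 x).bind fun y => (markovChain (fun n => P (n + 1)) y).map (consSeq x) := by
  have hc := measurable_consSeq_right x
  have hk : Measurable fun y => (markovChain (fun n => P (n + 1)) y).map (consSeq x) :=
    (Measure.measurable_map _ hc).comp (Kernel.measurable _)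
  symm
  have hint : ∀ f : (ℕ → E) → ℝ≥0∞, Measurable f →
      ∫⁻ z, f z ∂((P 0 x).bind fun y => (markovChain (fun n => P (n + 1)) y).map (consSeq x)) =
      ∫⁻ y, ∫⁻ z, f (consSeq x z) ∂markovChain (fun n => P (n + 1)) y ∂P 0 x := by
    intro f hf
    rw [Measure.lintegral_bind hk.aemeasurable hf.aemeasurable]
    exact lintegral_congr fun y => lintegral_map hf hc
  have : IsProbabilityMeasure
      ((P 0 x).bind fun y => (markovChain (fun n => P (n + 1)) y).map (consSeq x)) := by
    constructor
    have := hint 1 measurable_one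
    simpa using this
  -- The mixture over the first step starts at `x` and has the transitions of `P`: the first by the
  -- choice of `y`, the later ones by those of the shifted chain.
  refine eq_markovChain P ?_ fun n g hg B hB => ?_
  · refine Measure.ext fun A hA => ?_
    rw [Measure.map_apply (by fun_prop) hA, ← lintegral_indicator_one
      ((by fun_prop : Measurable fun z : ℕ → E => z 0) hA),
      hint _ (measurable_one.indicator ((by fun_prop : Measurable fun z : ℕ → E => z 0) hA))]
    rw [Measure.dirac_apply' _ hA]
    by_cases h : x ∈ A <;> simp [Set.indicator, h]
  · have hgm : Measurable fun z : ℕ → E => g (Preorder.frestrictLe n z) :=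
      hg.comp (by fun_prop)
    have hBm : ∀ k, Measurable fun z : ℕ → E => B.indicator (1 : E → ℝ≥0∞) (z k) :=
      fun k => (measurable_one.indicator hB).comp (measurable_pi_apply k)
    have hPm : ∀ k, Measurable fun z : ℕ → E => P k (z k) B :=
      fun k => ((P k).measurable_coe hB).comp (measurable_pi_apply k)
    rw [hint _ (hgm.fun_mul (hBm (n + 1))), hint _ (hgm.fun_mul (hPm n))]
    cases n with
    | zero =>
      have e : ∀ z, Preorder.frestrictLe 0 (consSeq x z) = fun _ : Finset.Iic 0 => x := by
        intro z; funext i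
        have : (i : ℕ) = 0 := Nat.le_zero.1 (Finset.mem_Iic.1 i.2)
        simp [this]
      simp only [e, consSeq_succ, consSeq_zero]
      have h1 : ∀ y, ∫⁻ z, g (fun _ => x) * B.indicator 1 (z 0)
          ∂markovChain (fun n => P (n + 1)) y = g (fun _ => x) * B.indicator 1 y := by
        intro y
        rw [lintegral_const_mul _ (hBm 0)]
        congr 1
        have := markovChain_map_zero (fun n => P (n + 1)) y
        rw [← lintegral_map (f := B.indicator 1) (g := fun z : ℕ → E => z 0)
          (measurable_one.indicator hB) (by fun_prop), this, lintegral_dirac'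
          _ (measurable_one.indicator hB)]
      simp only [h1]
      rw [lintegral_const_mul _ (measurable_one.indicator hB), lintegral_indicator_one hB]
      simp
    | succ m =>
      refine lintegral_congr fun y => ?_
      -- The weight on the first `m + 2` coordinates, read as a weight on the shifted chain, with
      -- the known value `x` filled in at time `0`.
      have hg' : Measurable fun p : Finset.Iic m → E => g (fun i : Finset.Iic (m + 1) =>
          if h : (i : ℕ) = 0 then x else p ⟨i - 1, by
            have := i.2; simp only [Finset.mem_Iic] at this ⊢; omega⟩) := by
        refine hg.comp (measurable_pi_iff.2 fun i => ?_)
        by_cases h : (i : ℕ) = 0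
        · simp only [h, dite_true]; fun_prop
        · simp only [h, dite_false]; fun_prop
      have := lintegral_markovChain_last (fun n => P (n + 1)) y m hg' hB
      have e : ∀ z : ℕ → E, Preorder.frestrictLe (m + 1) (consSeq x z) =
          fun i : Finset.Iic (m + 1) => if h : (i : ℕ) = 0 then x else
            Preorder.frestrictLe m z ⟨i - 1, by
              have := i.2; simp only [Finset.mem_Iic] at this ⊢; omega⟩ := by
        intro z; funext i
        obtain ⟨i, hi⟩ := i
        cases i <;> simp
      simp only [e, consSeq_succ]
      exact this

lemma lintegral_markovChain_first (x : E) {f : (ℕ → E) → ℝ≥0∞} (hf : Measurable f) :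
    ∫⁻ z, f z ∂markovChain P x =
      ∫⁻ y, ∫⁻ z, f (consSeq x z) ∂markovChain (fun n => P (n + 1)) y ∂P 0 x := by
  have hc := measurable_consSeq_right x
  have hk : Measurable fun y => (markovChain (fun n => P (n + 1)) y).map (consSeq x) :=
    (Measure.measurable_map _ hc).comp (Kernel.measurable _)
  rw [markovChain_eq_bind, Measure.lintegral_bind hk.aemeasurable hf.aemeasurable]
  exact lintegral_congr fun y => lintegral_map hf hc

/-- The image of a Markov chain under a map that intertwines the transition kernels. -/
lemma markovChain_map {E' : Type*} [MeasurableSpace E'] (P' : ℕ → Kernel E' E')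
    [∀ n, IsMarkovKernel (P' n)] {φ : E → E'} (hφ : Measurable φ)
    (h : ∀ n x, P' n (φ x) = (P n x).map φ) (x : E) :
    markovChain P' (φ x) = (markovChain P x).map fun z n => φ (z n) := by
  have hm : Measurable fun (z : ℕ → E) n => φ (z n) := by fun_prop
  symm
  have : IsProbabilityMeasure ((markovChain P x).map fun z n => φ (z n)) :=
    Measure.isProbabilityMeasure_map hm.aemeasurable
  refine eq_markovChain P' ?_ fun n g hg B hB => ?_
  · rw [Measure.map_map (by fun_prop) hm]
    have : (fun z : ℕ → E' => z 0) ∘ (fun (z : ℕ → E) n => φ (z n)) = φ ∘ fun z => z 0 := rfl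
    rw [this, ← Measure.map_map hφ (by fun_prop), markovChain_map_zero, Measure.map_dirac' hφ]
  · have hgm : Measurable fun z : ℕ → E' => g (Preorder.frestrictLe n z) :=
      hg.comp (by fun_prop)
    have hBm : Measurable fun z : ℕ → E' => B.indicator (1 : E' → ℝ≥0∞) (z (n + 1)) :=
      (measurable_one.indicator hB).comp (measurable_pi_apply _)
    have hPm : Measurable fun z : ℕ → E' => P' n (z n) B :=
      ((P' n).measurable_coe hB).comp (measurable_pi_apply _)
    rw [lintegral_map (hgm.fun_mul hBm) hm, lintegral_map (hgm.fun_mul hPm) hm]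
    have hg' : Measurable fun p : Finset.Iic n → E => g fun i => φ (p i) := by fun_prop
    have := lintegral_markovChain_last P x n hg' (hφ hB)
    simp only [h, Measure.map_apply hφ hB]
    exact this

end MarkovChain

/-! ### Restarting the sample at a fixed time -/

section Restart

variable {d : ℕ} {S : Type*}

/-- The history of a site from time `t` on, with the coin of time `t` forgotten. -/
def siteFrom (t : ℕ) (z : ℕ → S × Bool) : ℕ → S × Bool :=
  fun n => ((z (t + n)).1, if n = 0 then false else (z (t + n)).2)

/-- The `ε`-coins after time `t`. -/
def coinsFrom (t : ℕ) (e : ℕ → Bool) : ℕ → Bool := fun n => if n = 0 then false else e (t + n)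

/-- The environment and the coins seen from `y` after time `t`. -/
def envFrom (t : ℕ) (y : Site d) (η : (Site d → ℕ → S × Bool) × (ℕ → Bool)) :
    (Site d → ℕ → S × Bool) × (ℕ → Bool) :=
  (fun x => siteFrom t (η.1 (y + x)), coinsFrom t η.2)

/-- The sample seen from the walk at time `t`. -/
def restart (t : ℕ) (σ : Sample d S) : Sample d S := (envFrom t (X σ t) σ.1, walkAfter t σ)

lemma siteFrom_siteFrom (t u : ℕ) (z : ℕ → S × Bool) :
    siteFrom u (siteFrom t z) = siteFrom (t + u) z := by
  funext n
  by_cases h : n = 0 <;> simp [siteFrom, h, add_assoc]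

lemma siteFrom_succ_consSeq (t : ℕ) (a : S × Bool) (z : ℕ → S × Bool) :
    siteFrom (t + 1) (consSeq a z) = siteFrom t z := by
  funext n
  have h : t + 1 + n = (t + n) + 1 := by omega
  simp [siteFrom, h]

lemma coinsFrom_coinsFrom (t u : ℕ) (e : ℕ → Bool) :
    coinsFrom u (coinsFrom t e) = coinsFrom (t + u) e := by
  funext n
  by_cases h : n = 0 <;> simp [coinsFrom, h, add_assoc]

lemma envFrom_envFrom (t u : ℕ) (x y : Site d) (η : (Site d → ℕ → S × Bool) × (ℕ → Bool)) :
    envFrom u y (envFrom t x η) = envFrom (t + u) (x + y) η := by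
  simp [envFrom, siteFrom_siteFrom, coinsFrom_coinsFrom, add_assoc]

/-- The erased coins do no harm: at time `n` the walk reads a state and the coin of time `n + 1`,
never a coin of time `0`. -/
lemma look_envFrom (t n : ℕ) (x y : Site d) (η : (Site d → ℕ → S × Bool) × (ℕ → Bool)) :
    RWDRE.look n (envFrom t x η, y) = RWDRE.look (t + n) (η, x + y) := by
  simp [RWDRE.look, envFrom, siteFrom, coinsFrom, add_assoc]

variable [MeasurableSpace S]

lemma measurable_siteFrom (t : ℕ) : Measurable (siteFrom (S := S) t) := by
  refine measurable_pi_iff.2 fun n => ?_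
  unfold siteFrom
  by_cases h : n = 0
  · simp only [h, if_true]; fun_prop
  · simp only [h, if_false]; fun_prop

lemma measurable_coinsFrom (t : ℕ) : Measurable (coinsFrom t) := by
  refine measurable_pi_iff.2 fun n => ?_
  unfold coinsFrom
  by_cases h : n = 0
  · simp only [h, if_true]; fun_prop
  · simp only [h, if_false]; fun_prop

lemma measurable_envFrom (t : ℕ) (y : Site d) : Measurable (envFrom (S := S) t y) :=
  (measurable_pi_iff.2 fun x => (measurable_siteFrom t).comp (by fun_prop)).prodMk
    ((measurable_coinsFrom t).comp measurable_snd)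

end Restart

/-! ### The quenched Markov property -/

namespace RWDRE

variable {d : ℕ} {S : Type*} [MeasurableSpace S] (M : RWDRE d S)

lemma walkStep_apply (n : ℕ) (η : (Site d → ℕ → S × Bool) × (ℕ → Bool)) (x : Site d) :
    M.walkStep n (η, x) = (M.jumpKernel (look n (η, x))).map fun e => (η, x + e) := by
  rw [walkStep, Kernel.map_apply _ (by fun_prop), Kernel.prod_apply, Kernel.id_apply,
    Kernel.comap_apply, Measure.dirac_prod, Measure.map_map (by fun_prop) (by fun_prop)]
  rfl

/-- After a first jump `e`, the walk seen from `e` is again a quenched walk, in the environment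
shifted by one time unit and recentred at `e`. -/
lemma lintegral_quenched_first (η : (Site d → ℕ → S × Bool) × (ℕ → Bool))
    {f : (ℕ → Site d) → ℝ≥0∞} (hf : Measurable f) :
    ∫⁻ z, f z ∂M.quenched η = ∫⁻ e, ∫⁻ z, f (consSeq 0 fun n => e + z n)
      ∂M.quenched (envFrom 1 e η) ∂M.jumpKernel (look 0 (η, 0)) := by
  have hsnd : Measurable fun (z : ℕ → ((Site d → ℕ → S × Bool) × (ℕ → Bool)) × Site d) n =>
    (z n).2 := by fun_prop
  rw [quenched, Kernel.map_apply _ hsnd, Kernel.comap_apply, lintegral_map hf hsnd,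
    lintegral_markovChain_first M.walkStep _ (f := fun z => f fun n => (z n).2) (hf.comp hsnd),
    walkStep_apply, lintegral_map]
  · refine lintegral_congr fun e => ?_
    simp only [zero_add]
    rw [Kernel.map_apply _ hsnd, Kernel.comap_apply]
    have hφ : Measurable fun p : ((Site d → ℕ → S × Bool) × (ℕ → Bool)) × Site d =>
        (envFrom 1 e p.1, p.2 - e) :=
      ((measurable_envFrom 1 e).comp measurable_fst).prodMk (by fun_prop)
    -- By `look_envFrom`, time shift and recentring intertwine `walkStep (n + 1)` with `walkStep n`.
    have hI := markovChain_map (fun n => M.walkStep (n + 1)) M.walkStep hφ (fun n p => by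
      obtain ⟨η, x⟩ := p
      simp only
      rw [walkStep_apply, walkStep_apply, Measure.map_map hφ (by fun_prop), look_envFrom]
      have h1 : e + (x - e) = x := by abel
      have h2 : (1 + n) = n + 1 := by omega
      rw [h1, h2]
      congr 1
      funext y
      simp only [Function.comp, Prod.mk.injEq, true_and]
      abel) (η, e)
    simp only [sub_self] at hI
    have hm : Measurable fun (z : ℕ → ((Site d → ℕ → S × Bool) × (ℕ → Bool)) × Site d) n =>
        (envFrom 1 e (z n).1, (z n).2 - e) :=
      measurable_pi_iff.2 fun n => hφ.comp (measurable_pi_apply n)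
    have hm2 : Measurable fun z : ℕ → Site d => f (consSeq 0 fun n => e + z n) :=
      hf.comp ((measurable_consSeq_right 0).comp (by fun_prop))
    rw [hI, lintegral_map hm2 hsnd, lintegral_map (f := fun z :
      ℕ → ((Site d → ℕ → S × Bool) × (ℕ → Bool)) × Site d => f (consSeq 0 fun n => e + (z n).2))
      (hm2.comp hsnd) hm]
    refine lintegral_congr fun z => ?_
    congr 1
    funext n
    cases n <;> simp
  · exact Measurable.lintegral_kernel (κ := markovChain fun n => M.walkStep (n + 1))
      ((hf.comp hsnd).comp (measurable_consSeq_right _))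
  · fun_prop

/-- Both sides have the same first jump law and the same environment after the jump, so a single
first-step decomposition suffices. -/
lemma quenched_envFrom_zero (η : (Site d → ℕ → S × Bool) × (ℕ → Bool)) :
    M.quenched (envFrom 0 0 η) = M.quenched η := by
  refine Measure.ext_of_lintegral _ fun f hf => ?_
  rw [lintegral_quenched_first M _ hf, lintegral_quenched_first M _ hf]
  simp [envFrom_envFrom, look_envFrom]

lemma quenched_ae_zero (η : (Site d → ℕ → S × Bool) × (ℕ → Bool)) :
    ∀ᵐ z ∂M.quenched η, z 0 = 0 := by
  have hm : MeasurableSet {z : ℕ → Site d | z 0 = 0} :=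
    measurable_pi_apply 0 (measurableSet_singleton _)
  rw [ae_iff]
  have : {z : ℕ → Site d | ¬ z 0 = 0} = {z : ℕ → Site d | z 0 = 0}ᶜ := rfl
  rw [this, ← lintegral_indicator_one hm.compl, lintegral_quenched_first M _
    (measurable_one.indicator hm.compl)]
  simp

/-- The quenched Markov property. -/
lemma quenched_cylinder_inter (t : ℕ) (η : (Site d → ℕ → S × Bool) × (ℕ → Bool))
    (x : ℕ → Site d) (hx : x 0 = 0) {F : Set (ℕ → Site d)} (hF : MeasurableSet F) :
    M.quenched η {z | (∀ s ≤ t, z s = x s) ∧ (fun n => z (t + n) - z t) ∈ F} =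
      (∏ s ∈ Finset.range t, M.jumpKernel (look s (η, x s)) {x (s + 1) - x s}) *
        M.quenched (envFrom t (x t) η) F := by
  have hms : ∀ (t : ℕ) (x : ℕ → Site d),
      MeasurableSet {z : ℕ → Site d | (∀ s ≤ t, z s = x s) ∧ (fun n => z (t + n) - z t) ∈ F} := by
    intro t x
    have : {z : ℕ → Site d | (∀ s ≤ t, z s = x s) ∧ (fun n => z (t + n) - z t) ∈ F} =
        (⋂ s ≤ t, (fun z => z s) ⁻¹' {x s}) ∩ (fun z n => z (t + n) - z t) ⁻¹' F := by
      ext; simp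
    rw [this]
    exact (MeasurableSet.iInter fun s => MeasurableSet.iInter fun _ =>
      measurable_pi_apply s (measurableSet_singleton _)).inter ((by fun_prop :
        Measurable fun (z : ℕ → Site d) n => z (t + n) - z t) hF)
  induction t generalizing η x with
  | zero =>
    simp only [Finset.range_zero, Finset.prod_empty, one_mul, hx, quenched_envFrom_zero]
    refine measure_congr ?_
    filter_upwards [M.quenched_ae_zero η] with z hz
    refine propext ?_
    change ((∀ s ≤ 0, z s = x s) ∧ (fun n => z (0 + n) - z 0) ∈ F) ↔ z ∈ F
    simp [hz, hx]
  | succ t ih =>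
    rw [← lintegral_indicator_one (hms _ _), lintegral_quenched_first M _
      (measurable_one.indicator (hms _ _))]
    have key : ∀ e, ∫⁻ z, ({z | (∀ s ≤ t + 1, z s = x s) ∧ (fun n => z (t + 1 + n) - z (t + 1)) ∈ F} :
        Set (ℕ → Site d)).indicator 1 (consSeq 0 fun n => e + z n) ∂M.quenched (envFrom 1 e η) =
        ({x 1} : Set (Site d)).indicator (fun _ => (∏ s ∈ Finset.range t,
          M.jumpKernel (look (s + 1) (η, x (s + 1))) {x (s + 2) - x (s + 1)}) *
          M.quenched (envFrom (t + 1) (x (t + 1)) η) F) e := by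
      intro e
      by_cases he : e = x 1
      · subst he
        rw [Set.indicator_of_mem (Set.mem_singleton _)]
        -- The path after its first step, recentred at `x 1` so that it starts at `0` again.
        have := ih (envFrom 1 (x 1) η) (fun s => x (s + 1) - x 1) (by simp)
        simp only [envFrom_envFrom] at this
        rw [← lintegral_indicator_one (hms _ _)] at this
        convert this using 2
        · funext z
          have h1 : ∀ n, t + 1 + n = (t + n) + 1 := fun n => by omega
          have hiff : ((consSeq 0 fun n => x 1 + z n) ∈ {z : ℕ → Site d | (∀ s ≤ t + 1, z s = x s) ∧
              (fun n => z (t + 1 + n) - z (t + 1)) ∈ F}) ↔ z ∈ {z : ℕ → Site d |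
              (∀ s ≤ t, z s = x (s + 1) - x 1) ∧ (fun n => z (t + n) - z t) ∈ F} := by
            change ((∀ s ≤ t + 1, consSeq 0 (fun n => x 1 + z n) s = x s) ∧ _) ↔ (_ ∧ _)
            simp only [consSeq_succ, h1, add_sub_add_left_eq_sub]
            refine and_congr_left fun _ => ⟨fun h s hs => ?_, fun h s hs => ?_⟩
            · rw [← h (s + 1) (by omega), consSeq_succ]; abel
            · cases s with
              | zero => simp [hx]
              | succ s => rw [consSeq_succ, h s (by omega)]; abel
          classical
          rw [Set.indicator_apply, Set.indicator_apply]
          exact if_congr hiff rfl rfl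
        · refine Finset.prod_congr rfl fun s _ => ?_
          have h1 : x 1 + (x (s + 1) - x 1) = x (s + 1) := by abel
          have h2 : x (s + 1 + 1) - x 1 - (x (s + 1) - x 1) = x (s + 2) - x (s + 1) := by abel
          rw [look_envFrom, h1, h2, add_comm 1 s]
        · have h1 : x 1 + (x (t + 1) - x 1) = x (t + 1) := by abel
          rw [h1, add_comm 1 t]
      · rw [Set.indicator_of_notMem (by simpa using he)]
        -- A walk that starts with the jump `e` is at `e` at time `1`, so no other jump than `x 1`
        -- contributes.
        refine lintegral_eq_zero_of_ae_eq_zero ?_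
        filter_upwards [M.quenched_ae_zero (envFrom 1 e η)] with z hz
        refine Set.indicator_of_notMem (fun h => he ?_) _
        have := h.1 1 (by omega)
        rw [← this]
        change e = e + z 0
        simp [hz]
    simp only [key]
    rw [lintegral_indicator (measurableSet_singleton _), setLIntegral_const,
      Finset.prod_range_succ', hx, sub_zero]
    ring

end RWDRE

/-! ### Refreshment at a single site -/

namespace RWDRE

variable {d : ℕ} {S : Type*} [MeasurableSpace S] (M : RWDRE d S)

lemma refresh_true (w : S) : M.refresh (w, true) = M.π := by
  change (if true = true then M.π else M.tailKernel w) = M.π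
  simp

lemma refresh_false (w : S) : M.refresh (w, false) = M.tailKernel w := by
  change (if false = true then M.π else M.tailKernel w) = M.tailKernel w
  simp

lemma lintegral_siteStep (a : S × Bool) {F : S × Bool → ℝ≥0∞} (hF : Measurable F) :
    ∫⁻ y, F y ∂M.siteStep a = ∫⁻ b, ∫⁻ w, F (w, b) ∂M.refresh (a.1, b) ∂coin M.κ := by
  rw [siteStep, Kernel.map_apply _ measurable_swap, lintegral_map hF measurable_swap,
    Kernel.lintegral_compProd _ _ _ (hF.fun_comp measurable_swap), Kernel.const_apply]
  rfl

lemma measurable_lintegral_refresh {F : S × Bool → ℝ≥0∞} (hF : Measurable F) (b : Bool) :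
    Measurable fun w => ∫⁻ w', F (w', b) ∂M.refresh (w, b) := by
  have : Measurable fun z : S × Bool => ∫⁻ w', F (w', b) ∂M.refresh z :=
    Measurable.lintegral_kernel (hF.comp (by fun_prop : Measurable fun w : S => (w, b)))
  exact this.comp (by fun_prop : Measurable fun w : S => (w, b))

/-- The stationary distribution is invariant under a step with a given coin. -/
lemma lintegral_refresh_stationary (b : Bool) {F : S → ℝ≥0∞} (hF : Measurable F) :
    ∫⁻ w, ∫⁻ w', F w' ∂M.refresh (w, b) ∂M.π = ∫⁻ w, F w ∂M.π := by
  cases b with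
  | true =>
    simp [refresh_true]
  | false =>
    simp only [refresh_false]
    have hκ : 0 < 1 - M.κ := by linarith [M.κ_lt_one]
    -- `π K = π` and `K = κ π + (1 - κ) K̃` force `π K̃ = π`.
    have hb : M.π.bind M.tailKernel = M.π := by
      refine Measure.ext fun A hA => ?_
      rw [Measure.bind_apply hA M.tailKernel.measurable.aemeasurable]
      have e : ∀ w, M.tailKernel w A =
          (ENNReal.ofReal (1 - M.κ))⁻¹ * (M.K w A - ENNReal.ofReal M.κ * M.π A) := by
        intro w
        change ((ENNReal.ofReal (1 - M.κ))⁻¹ • (M.K w - ENNReal.ofReal M.κ • M.π)) A = _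
        simp [Measure.sub_apply hA (M.smul_π_le _)]
      simp only [e]
      have hK : ∫⁻ w, M.K w A ∂M.π = M.π A := by
        have := congrArg (fun ν => ν A) M.stationary
        simpa [Measure.bind_apply hA M.K.measurable.aemeasurable] using this
      rw [lintegral_const_mul _ ((M.K.measurable_coe hA).sub_const _),
        lintegral_sub measurable_const (by simp [ENNReal.mul_eq_top])
          (Filter.Eventually.of_forall fun w => M.mixing w A hA), hK]
      simp only [lintegral_const, measure_univ, mul_one]
      have h1 : M.π A - ENNReal.ofReal M.κ * M.π A = ENNReal.ofReal (1 - M.κ) * M.π A := by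
        rw [ENNReal.ofReal_sub _ M.κ_pos.le, ENNReal.ofReal_one,
          ENNReal.sub_mul (fun _ _ => measure_ne_top _ _), one_mul]
      rw [h1, ← mul_assoc, ENNReal.inv_mul_cancel (ENNReal.ofReal_pos.2 hκ).ne'
        ENNReal.ofReal_ne_top, one_mul]
    conv_rhs => rw [← hb]
    rw [Measure.lintegral_bind M.tailKernel.measurable.aemeasurable hF.aemeasurable]

/-- The chain at one site, started from `a`, tested against a weight on the states before time `t`,
a weight on the coins up to time `t`, and a function of the history from time `t` on. -/
def siteInt (t : ℕ) (f : ℕ → S → ℝ≥0∞) (c : (Fin t → Bool) → ℝ≥0∞)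
    (h : (ℕ → S × Bool) → ℝ≥0∞) (a : S × Bool) : ℝ≥0∞ :=
  ∫⁻ z, (∏ s ∈ Finset.range t, f s (z s).1) * c (fun i => (z (i + 1)).2) * h (siteFrom t z)
    ∂markovChain (fun _ => M.siteStep) a

lemma measurable_siteInt_integrand (t : ℕ) {f : ℕ → S → ℝ≥0∞} (hf : ∀ s, Measurable (f s))
    (c : (Fin t → Bool) → ℝ≥0∞) {h : (ℕ → S × Bool) → ℝ≥0∞} (hh : Measurable h) :
    Measurable fun z : ℕ → S × Bool => (∏ s ∈ Finset.range t, f s (z s).1) *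
      c (fun i => (z (i + 1)).2) * h (siteFrom t z) := by
  refine ((Finset.measurable_prod _ fun s _ => (hf s).comp (by fun_prop)).mul ?_).mul
    (hh.comp (measurable_siteFrom t))
  exact (measurable_of_finite c).comp (by fun_prop)

lemma measurable_siteInt (t : ℕ) {f : ℕ → S → ℝ≥0∞} (hf : ∀ s, Measurable (f s))
    (c : (Fin t → Bool) → ℝ≥0∞) {h : (ℕ → S × Bool) → ℝ≥0∞} (hh : Measurable h) :
    Measurable (M.siteInt t f c h) :=
  Measurable.lintegral_kernel (measurable_siteInt_integrand t hf c hh)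

/-- First-step decomposition. The first coin `b` is frozen into the weight on the coins, and the
other weights move one time unit back. -/
lemma siteInt_succ (t : ℕ) {f : ℕ → S → ℝ≥0∞} (hf : ∀ s, Measurable (f s))
    (c : (Fin (t + 1) → Bool) → ℝ≥0∞) {h : (ℕ → S × Bool) → ℝ≥0∞} (hh : Measurable h)
    (a : S × Bool) :
    M.siteInt (t + 1) f c h a = f 0 a.1 * ∫⁻ b, ∫⁻ w,
      M.siteInt t (fun s => f (s + 1)) (fun k => c (Fin.cons b k)) h (w, b)
        ∂M.refresh (a.1, b) ∂coin M.κ := by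
  have e : ∀ y : S × Bool, ∫⁻ z, (∏ s ∈ Finset.range (t + 1), f s (consSeq a z s).1) *
      c (fun i => (consSeq a z (i + 1)).2) * h (siteFrom (t + 1) (consSeq a z))
        ∂markovChain (fun _ => M.siteStep) y = f 0 a.1 *
      M.siteInt t (fun s => f (s + 1)) (fun k => c (Fin.cons y.2 k)) h y := by
    intro y
    rw [siteInt, ← lintegral_const_mul _ (measurable_siteInt_integrand t (fun s => hf (s + 1))
      (fun k => c (Fin.cons y.2 k)) hh)]
    refine lintegral_congr_ae ?_
    -- The coin of time `1` is carried by the starting point `y` of the shifted chain, an identity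
    -- that holds only almost surely.
    have h0 : ∀ᵐ z ∂markovChain (fun _ => M.siteStep) y, (z 0).2 = y.2 := by
      have hm := markovChain_map_zero (fun _ => M.siteStep) y
      have hs : MeasurableSet {p : S × Bool | p.2 = y.2} := measurable_snd (measurableSet_singleton _)
      have h1 : ∀ᵐ p ∂(markovChain (fun _ => M.siteStep) y).map (fun z => z 0), p.2 = y.2 := by
        rw [hm, ae_dirac_iff hs]
      exact ae_of_ae_map (measurable_pi_apply 0).aemeasurable h1
    filter_upwards [h0] with z hz
    rw [Finset.prod_range_succ', siteFrom_succ_consSeq]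
    have : (fun i : Fin (t + 1) => (consSeq a z (i + 1)).2) =
        Fin.cons y.2 fun i : Fin t => (z (i + 1)).2 := by
      funext i
      refine Fin.cases ?_ (fun j => ?_) i
      · simpa using hz
      · simp
    rw [this]
    simp only [consSeq_succ, consSeq_zero]
    ring
  have hme : Measurable fun y : S × Bool =>
      M.siteInt t (fun s => f (s + 1)) (fun k => c (Fin.cons y.2 k)) h y :=
    measurable_from_prod_countable_left fun b =>
      (M.measurable_siteInt t (fun s => hf (s + 1)) (fun k => c (Fin.cons b k)) hh).comp
        (by fun_prop : Measurable fun w : S => (w, b))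
  rw [siteInt, lintegral_markovChain_first _ _ (measurable_siteInt_integrand (t + 1) hf c hh)]
  simp only [e]
  rw [lintegral_const_mul _ hme, lintegral_siteStep M a hme]

lemma siteInt_zero (f : ℕ → S → ℝ≥0∞) (c : (Fin 0 → Bool) → ℝ≥0∞) {h : (ℕ → S × Bool) → ℝ≥0∞}
    (hh : Measurable h) (a : S × Bool) :
    M.siteInt 0 f c h a =
      c default * ∫⁻ z, h (siteFrom 0 z) ∂markovChain (fun _ => M.siteStep) a := by
  rw [siteInt, ← lintegral_const_mul _ (hh.fun_comp (measurable_siteFrom 0))]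
  refine lintegral_congr fun z => ?_
  rw [Subsingleton.elim (fun i : Fin 0 => (z (i + 1)).2) default]
  simp

/-- The coin attached to the starting state is never read: the coin weights begin at time `1`,
`siteFrom` erases the coin at which it restarts, and `siteStep` tosses a new one. Any starting coin
can thus be replaced by the dummy of `siteLaw`. -/
lemma siteInt_coin (t : ℕ) {f : ℕ → S → ℝ≥0∞} (hf : ∀ s, Measurable (f s))
    (c : (Fin t → Bool) → ℝ≥0∞) {h : (ℕ → S × Bool) → ℝ≥0∞} (hh : Measurable h)
    (w : S) (b b' : Bool) : M.siteInt t f c h (w, b) = M.siteInt t f c h (w, b') := by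
  cases t with
  | zero =>
    rw [siteInt_zero M f c hh, siteInt_zero M f c hh]
    have hm : Measurable fun z : ℕ → S × Bool => h (siteFrom 0 z) :=
      hh.comp (measurable_siteFrom 0)
    rw [lintegral_markovChain_first _ _ hm, lintegral_markovChain_first _ _ hm]
    have e : ∀ z, siteFrom 0 (consSeq (w, b) z) = siteFrom 0 (consSeq (w, b') z) := by
      intro z; funext n
      cases n <;> simp [siteFrom]
    simp only [e]
    have hs : M.siteStep (w, b) = M.siteStep (w, b') := by
      refine Measure.ext_of_lintegral _ fun F hF => ?_
      rw [lintegral_siteStep M _ hF, lintegral_siteStep M _ hF]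
    rw [hs]
  | succ t => rw [siteInt_succ M t hf c hh, siteInt_succ M t hf c hh]

lemma lintegral_siteLaw {F : (ℕ → S × Bool) → ℝ≥0∞} (hF : Measurable F) :
    ∫⁻ z, F z ∂M.siteLaw =
      ∫⁻ w, ∫⁻ z, F z ∂markovChain (fun _ => M.siteStep) (w, false) ∂M.π := by
  rw [siteLaw, Measure.lintegral_bind (Kernel.measurable _).aemeasurable hF.aemeasurable,
    Measure.prod_dirac, lintegral_map (Measurable.lintegral_kernel hF) (by fun_prop)]

/-- Started from `π`, the state has law `π` after any prescribed sequence of coins. If the weights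
read no states, the past up to time `t` reduces to coins, and these carry no information about the
state at time `t`. -/
lemma lintegral_siteInt_of_const (t : ℕ) {f : ℕ → S → ℝ≥0∞} (hf : ∀ s, Measurable (f s))
    (hconst : ∀ s < t, ∀ w w', f s w = f s w') (c : (Fin t → Bool) → ℝ≥0∞)
    {h : (ℕ → S × Bool) → ℝ≥0∞} (hh : Measurable h) :
    ∫⁻ w, M.siteInt t f c h (w, false) ∂M.π =
      (∫⁻ w, M.siteInt t f c 1 (w, false) ∂M.π) * ∫⁻ z, h (siteFrom 0 z) ∂M.siteLaw := by
  induction t generalizing f with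
  | zero =>
    simp only [siteInt_zero M f c hh, siteInt_zero M f c measurable_one]
    rw [lintegral_siteLaw M (hh.fun_comp (measurable_siteFrom 0)), lintegral_const_mul _
      ((Measurable.lintegral_kernel (hh.fun_comp (measurable_siteFrom 0))).fun_comp
        (by fun_prop : Measurable fun w : S => (w, false)))]
    simp
  | succ t ih =>
    obtain ⟨w₀⟩ : Nonempty S := by
      by_contra hne
      rw [not_nonempty_iff] at hne
      have := measure_univ (μ := M.π)
      rw [Set.univ_eq_empty_iff.2 hne] at this
      simp at this
    have hf0 : ∀ w, f 0 w = f 0 w₀ := fun w => hconst 0 (by omega) _ _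
    have step : ∀ {h : (ℕ → S × Bool) → ℝ≥0∞}, Measurable h →
        ∫⁻ w, M.siteInt (t + 1) f c h (w, false) ∂M.π = f 0 w₀ * ∫⁻ b, ∫⁻ w,
          M.siteInt t (fun s => f (s + 1)) (fun k => c (Fin.cons b k)) h (w, false)
            ∂M.π ∂coin M.κ := by
      intro h hh
      have hm : ∀ b, Measurable
          (M.siteInt t (fun s => f (s + 1)) (fun k => c (Fin.cons b k)) h) := fun b =>
        M.measurable_siteInt t (fun s => hf (s + 1)) _ hh
      have hm2 : ∀ b, Measurable fun w => ∫⁻ w', M.siteInt t (fun s => f (s + 1))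
          (fun k => c (Fin.cons b k)) h (w', b) ∂M.refresh (w, b) := fun b =>
        M.measurable_lintegral_refresh (hm b) b
      have hm3 : Measurable fun p : S × Bool => ∫⁻ w', M.siteInt t (fun s => f (s + 1))
          (fun k => c (Fin.cons p.2 k)) h (w', p.2) ∂M.refresh (p.1, p.2) :=
        measurable_from_prod_countable_left hm2
      simp only [siteInt_succ M t hf c hh, hf0]
      rw [lintegral_const_mul _ hm3.lintegral_prod_right, lintegral_lintegral_swap hm3.aemeasurable]
      congr 1
      refine lintegral_congr fun b => ?_
      -- For a fixed coin `b` the new state again has law `π`, so the induction continues from the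
      -- same initial law.
      rw [M.lintegral_refresh_stationary b (F := fun w' => M.siteInt t (fun s => f (s + 1))
        (fun k => c (Fin.cons b k)) h (w', b)) ((hm b).comp (by fun_prop))]
      exact lintegral_congr fun w => M.siteInt_coin t (fun s => hf (s + 1)) _ hh _ _ _
    rw [step hh, step measurable_one]
    have : ∀ b, _ := fun b => ih (fun s => hf (s + 1)) (fun s hs => hconst (s + 1) (by omega))
      (fun k => c (Fin.cons b k))
    simp only [this]
    rw [lintegral_mul_const _ (measurable_of_finite _), mul_assoc]

/-- Holds for every initial state, by waiting for the refreshment. The entry `v` of `k` is the coin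
of time `v + 1`, so `hc` says that some coin shows `true` and that no weight reads the state from
that time on. -/
lemma siteInt_of_refreshed (t : ℕ) {f : ℕ → S → ℝ≥0∞} (hf : ∀ s, Measurable (f s))
    (c : (Fin t → Bool) → ℝ≥0∞)
    (hc : ∀ k, c k ≠ 0 → ∃ v : Fin t, k v = true ∧ ∀ s < t, (v : ℕ) < s → ∀ w w', f s w = f s w')
    {h : (ℕ → S × Bool) → ℝ≥0∞} (hh : Measurable h) (a : S × Bool) :
    M.siteInt t f c h a = M.siteInt t f c 1 a * ∫⁻ z, h (siteFrom 0 z) ∂M.siteLaw := by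
  induction t generalizing f a with
  | zero =>
    have : c default = 0 := by
      by_contra h0
      obtain ⟨v, _⟩ := hc _ h0
      exact v.elim0
    rw [siteInt_zero M f c hh, siteInt_zero M f c measurable_one, this]
    simp
  | succ t ih =>
    rw [siteInt_succ M t hf c hh, siteInt_succ M t hf c measurable_one, mul_assoc]
    congr 1
    rw [← lintegral_mul_const _ (measurable_of_finite _)]
    refine lintegral_congr fun b => ?_
    -- Either the first coin is itself such a refreshment, and the remaining problem starts from `π`
    -- with constant weights, or each refreshment given by `hc` has a positive index and the
    -- induction hypothesis applies.
    by_cases hb : b = true ∧ ∀ s < t + 1, 0 < s → ∀ w w', f s w = f s w'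
    · obtain ⟨rfl, hconst⟩ := hb
      rw [refresh_true]
      have := M.lintegral_siteInt_of_const t (fun s => hf (s + 1))
        (fun s hs => hconst (s + 1) (by omega) (by omega)) (fun k => c (Fin.cons true k)) hh
      rw [lintegral_congr fun w => M.siteInt_coin t (fun s => hf (s + 1)) _ hh w true false, this]
      congr 1
      exact lintegral_congr fun w =>
        M.siteInt_coin t (fun s => hf (s + 1)) _ measurable_one w false true
    · have := ih (fun s => hf (s + 1)) (fun k => c (Fin.cons b k)) (fun k hk => by
        obtain ⟨v, hv, hs⟩ := hc _ hk
        induction v using Fin.cases with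
        | zero =>
          refine absurd ⟨by simpa using hv, fun s h1 h2 => hs s h1 (by simpa using h2)⟩ hb
        | succ v =>
          refine ⟨v, by simpa using hv, fun s h1 h2 => hs (s + 1) (by omega) ?_⟩
          simpa using h2)
      simp only [this]
      rw [lintegral_mul_const _ ((M.measurable_siteInt t (fun s => hf (s + 1)) _
        measurable_one).fun_comp (by fun_prop : Measurable fun w : S => (w, b)))]

/-- If no weight depends on the state of the site after its last refreshment, then the history from
time `t` on is a fresh copy, independent of the past. -/
lemma lintegral_siteLaw_factor (t : ℕ) {f : ℕ → S → ℝ≥0∞} (hf : ∀ s, Measurable (f s))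
    (c : (Fin t → Bool) → ℝ≥0∞)
    (hc : (∀ s < t, ∀ w w', f s w = f s w') ∨ ∀ k, c k ≠ 0 →
      ∃ v : Fin t, k v = true ∧ ∀ s < t, (v : ℕ) < s → ∀ w w', f s w = f s w')
    {h : (ℕ → S × Bool) → ℝ≥0∞} (hh : Measurable h) :
    ∫⁻ z, (∏ s ∈ Finset.range t, f s (z s).1) * c (fun i => (z (i + 1)).2) * h (siteFrom t z)
        ∂M.siteLaw =
      (∫⁻ z, (∏ s ∈ Finset.range t, f s (z s).1) * c (fun i => (z (i + 1)).2) ∂M.siteLaw) *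
        ∫⁻ z, h (siteFrom 0 z) ∂M.siteLaw := by
  have h1 := measurable_siteInt_integrand t hf c (h := 1) measurable_one
  simp only [Pi.one_apply, mul_one] at h1
  rw [lintegral_siteLaw M (measurable_siteInt_integrand t hf c hh), lintegral_siteLaw M h1]
  have e : ∫⁻ w, ∫⁻ z, (∏ s ∈ Finset.range t, f s (z s).1) * c (fun i => (z (i + 1)).2)
      ∂markovChain (fun _ => M.siteStep) (w, false) ∂M.π =
      ∫⁻ w, M.siteInt t f c 1 (w, false) ∂M.π := by simp [siteInt]
  rw [e]
  rcases hc with hc | hc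
  · exact M.lintegral_siteInt_of_const t hf hc c hh
  · rw [← lintegral_mul_const _ ((M.measurable_siteInt t hf c measurable_one).fun_comp
      (by fun_prop : Measurable fun w : S => (w, false)))]
    exact lintegral_congr fun w => M.siteInt_of_refreshed t hf c hc hh _

end RWDRE

/-! ### Factorisation over independent sites -/

section Product

variable {ι : Type*}

lemma indicator_one_le {X : Type*} (D : Set X) (a : X) : D.indicator (1 : X → ℝ≥0∞) a ≤ 1 :=
  Set.indicator_apply_le' (fun _ => le_rfl) fun _ => zero_le_one

/-- Two finite measures on a product space that agree on boxes are equal. -/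
lemma ext_of_boxes {B : Type*} [MeasurableSpace B] {ν ν' : Measure (ι → B)} [IsFiniteMeasure ν]
    (h : ∀ (s : Finset ι) (t : ι → Set B), (∀ i, MeasurableSet (t i)) →
      ν ((s : Set ι).pi t) = ν' ((s : Set ι).pi t)) : ν = ν' := by
  refine ext_of_generate_finite _ generateFrom_squareCylinders.symm
    (isPiSystem_squareCylinders (fun _ => MeasurableSpace.isPiSystem_measurableSet) (by simp)) ?_ ?_
  · rintro _ ⟨s, t, ht, rfl⟩
    exact h s t fun i => ht i (Set.mem_univ i)
  · simpa using h ∅ (fun _ => Set.univ) (by simp)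

lemma lintegral_infinitePi_prod {E : Type*} [MeasurableSpace E] (μ : Measure E)
    [IsProbabilityMeasure μ] (s : Finset ι) {φ : ι → E → ℝ≥0∞} (hφ : ∀ i, Measurable (φ i)) :
    ∫⁻ z, ∏ i ∈ s, φ i (z i) ∂Measure.infinitePi (fun _ : ι => μ) = ∏ i ∈ s, ∫⁻ x, φ i x ∂μ := by
  have hi := iIndepFun_infinitePi (P := fun _ : ι => μ) (X := φ) hφ
  rw [lintegral_prod_eq_prod_lintegral_of_indepFun s (fun i (z : ι → E) => φ i (z i)) hi
    fun i => (hφ i).comp (measurable_pi_apply i)]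
  refine Finset.prod_congr rfl fun i _ => ?_
  conv_rhs => rw [← Measure.infinitePi_map_eval (fun _ : ι => μ) i]
  rw [lintegral_map (hφ i) (by fun_prop)]

/-- Writing box indicators as products over a common larger set `T`, with factor `1` outside `s`,
lets two boxes and the weights be multiplied site by site. -/
lemma indicator_pi_eq_prod {A : Type*} (s T : Finset ι) (hs : s ⊆ T) (D : ι → Set A) (a : ι → A) :
    ((s : Set ι).pi D).indicator (1 : (ι → A) → ℝ≥0∞) a =
      ∏ i ∈ T, {x : A | i ∈ s → x ∈ D i}.indicator 1 (a i) := by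
  by_cases h : a ∈ (s : Set ι).pi D
  · rw [Set.indicator_of_mem h]
    refine (Finset.prod_eq_one fun i _ => ?_).symm
    have : a i ∈ {x : A | i ∈ s → x ∈ D i} := fun hi => h i hi
    exact Set.indicator_of_mem this _
  · rw [Set.indicator_of_notMem h]
    simp only [Set.mem_pi, not_forall] at h
    obtain ⟨i, hi, hn⟩ := h
    have : a i ∉ {x : A | i ∈ s → x ∈ D i} := fun h => hn (h hi)
    exact (Finset.prod_eq_zero (hs hi) (Set.indicator_of_notMem this _)).symm

variable {E A B : Type*} [MeasurableSpace E] [MeasurableSpace A] [MeasurableSpace B]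

/-- If at every site the function `V` is independent of `U` and of the weight `g i`, then this also
holds for the product over the sites. -/
lemma lintegral_infinitePi_factor (μ : Measure E) [IsProbabilityMeasure μ] (ρ : Measure B)
    [IsProbabilityMeasure ρ] {U : E → A} {V : E → B} (hU : Measurable U) (hV : Measurable V)
    (Λ : Finset ι) {g : ι → E → ℝ≥0∞} (hg : ∀ i, Measurable (g i)) (hg1 : ∀ i z, g i z ≤ 1)
    (hΛ : ∀ i ∉ Λ, g i = 1)
    (hfac : ∀ i (D : Set A) (F : Set B), MeasurableSet D → MeasurableSet F →
      ∫⁻ z, g i z * D.indicator 1 (U z) * F.indicator 1 (V z) ∂μ =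
        (∫⁻ z, g i z * D.indicator 1 (U z) ∂μ) * ρ F)
    {D : Set (ι → A)} (hD : MeasurableSet D) {h : (ι → B) → ℝ≥0∞} (hh : Measurable h) :
    ∫⁻ z, (∏ i ∈ Λ, g i (z i)) * D.indicator 1 (fun i => U (z i)) * h (fun i => V (z i))
        ∂Measure.infinitePi (fun _ : ι => μ) =
      (∫⁻ z, (∏ i ∈ Λ, g i (z i)) * D.indicator 1 (fun i => U (z i))
        ∂Measure.infinitePi (fun _ : ι => μ)) *
        ∫⁻ b, h b ∂Measure.infinitePi (fun _ : ι => ρ) := by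
  classical
  set P := Measure.infinitePi (fun _ : ι => μ)
  set R := Measure.infinitePi (fun _ : ι => ρ)
  have hUU : Measurable fun (z : ι → E) i => U (z i) := by fun_prop
  have hVV : Measurable fun (z : ι → E) i => V (z i) := by fun_prop
  have hW : Measurable fun z : ι → E => ∏ i ∈ Λ, g i (z i) :=
    Finset.measurable_prod _ fun i _ => (hg i).comp (measurable_pi_apply i)
  have hW1 : ∀ z : ι → E, ∏ i ∈ Λ, g i (z i) ≤ 1 := fun z => Finset.prod_le_one' fun i _ => hg1 i _
  -- For boxes everything is a finite product over sites and `hfac` applies to each factor. The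
  -- extension to general sets fixes one of the two sets at a time, and compares finite measures in
  -- the other.
  have box : ∀ (s s' : Finset ι) (D : ι → Set A) (F : ι → Set B), (∀ i, MeasurableSet (D i)) →
      (∀ i, MeasurableSet (F i)) →
      ∫⁻ z, (∏ i ∈ Λ, g i (z i)) * ((s : Set ι).pi D).indicator 1 (fun i => U (z i)) *
        ((s' : Set ι).pi F).indicator 1 (fun i => V (z i)) ∂P =
      (∫⁻ z, (∏ i ∈ Λ, g i (z i)) * ((s : Set ι).pi D).indicator 1 (fun i => U (z i)) ∂P) *
        R ((s' : Set ι).pi F) := by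
    intro s s' D F hD hF
    set T := Λ ∪ s ∪ s'
    have hΛT : ∀ z : ι → E, ∏ i ∈ Λ, g i (z i) = ∏ i ∈ T, g i (z i) := fun z =>
      Finset.prod_subset (by intro i hi; simp [T, hi]) fun i _ hi => by rw [hΛ i hi]; rfl
    have hsT : s ⊆ T := by intro i hi; simp [T, hi]
    have hsT' : s' ⊆ T := by intro i hi; simp [T, hi]
    have hD' : ∀ i, MeasurableSet {x : A | i ∈ s → x ∈ D i} := by
      intro i
      by_cases hi : i ∈ s
      · simpa [hi] using hD i
      · simp [hi]
    have hF' : ∀ i, MeasurableSet {x : B | i ∈ s' → x ∈ F i} := by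
      intro i
      by_cases hi : i ∈ s'
      · simpa [hi] using hF i
      · simp [hi]
    have hm1 : ∀ i, Measurable fun x => {x : A | i ∈ s → x ∈ D i}.indicator
        (1 : A → ℝ≥0∞) (U x) := fun i => (measurable_one.indicator (hD' i)).comp hU
    have hm2 : ∀ i, Measurable fun x => {x : B | i ∈ s' → x ∈ F i}.indicator
        (1 : B → ℝ≥0∞) (V x) := fun i => (measurable_one.indicator (hF' i)).comp hV
    simp only [hΛT, indicator_pi_eq_prod s T hsT, indicator_pi_eq_prod s' T hsT',
      ← Finset.prod_mul_distrib]
    rw [lintegral_infinitePi_prod μ T (φ := fun i x => g i x *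
        {x : A | i ∈ s → x ∈ D i}.indicator 1 (U x) *
        {x : B | i ∈ s' → x ∈ F i}.indicator 1 (V x))
        (fun i => ((hg i).mul (hm1 i)).mul (hm2 i)),
      lintegral_infinitePi_prod μ T (φ := fun i x => g i x *
        {x : A | i ∈ s → x ∈ D i}.indicator 1 (U x))
        (fun i => (hg i).mul (hm1 i))]
    have hR : R ((s' : Set ι).pi F) =
        ∏ i ∈ T, ρ {x : B | i ∈ s' → x ∈ F i} := by
      rw [Measure.infinitePi_pi _ fun i _ => hF i, ← Finset.prod_subset hsT' fun i _ hi => by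
        simp [hi]]
      exact Finset.prod_congr rfl fun i hi => by simp [hi]
    rw [hR, ← Finset.prod_mul_distrib]
    exact Finset.prod_congr rfl fun i _ => hfac i _ _ (hD' i) (hF' i)
  have hsets : ∀ {D : Set (ι → A)} {F : Set (ι → B)}, MeasurableSet D → MeasurableSet F →
      ∫⁻ z, (∏ i ∈ Λ, g i (z i)) * D.indicator 1 (fun i => U (z i)) *
        F.indicator 1 (fun i => V (z i)) ∂P =
      (∫⁻ z, (∏ i ∈ Λ, g i (z i)) * D.indicator 1 (fun i => U (z i)) ∂P) * R F := by
    have mkD : ∀ {D : Set (ι → A)}, MeasurableSet D →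
        Measurable fun z : ι → E => D.indicator (1 : (ι → A) → ℝ≥0∞) fun i => U (z i) :=
      fun hD => (measurable_one.indicator hD).comp hUU
    have mkF : ∀ {F : Set (ι → B)}, MeasurableSet F →
        Measurable fun z : ι → E => F.indicator (1 : (ι → B) → ℝ≥0∞) fun i => V (z i) :=
      fun hF => (measurable_one.indicator hF).comp hVV
    -- With the box for `U` fixed, both sides are finite measures in the set for `V`.
    have step1 : ∀ (s : Finset ι) (D : ι → Set A), (∀ i, MeasurableSet (D i)) →
        ∀ F : Set (ι → B), MeasurableSet F →
        ∫⁻ z, (∏ i ∈ Λ, g i (z i)) * ((s : Set ι).pi D).indicator 1 (fun i => U (z i)) *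
          F.indicator 1 (fun i => V (z i)) ∂P =
        (∫⁻ z, (∏ i ∈ Λ, g i (z i)) * ((s : Set ι).pi D).indicator 1 (fun i => U (z i)) ∂P) *
          R F := by
      intro s D hD
      have hDm : MeasurableSet ((s : Set ι).pi D) :=
        MeasurableSet.pi s.countable_toSet fun i _ => hD i
      have hw : Measurable fun z : ι → E => (∏ i ∈ Λ, g i (z i)) *
          ((s : Set ι).pi D).indicator 1 (fun i => U (z i)) := hW.mul (mkD hDm)
      have e : ∀ F : Set (ι → B), MeasurableSet F →
          ∫⁻ z, (∏ i ∈ Λ, g i (z i)) * ((s : Set ι).pi D).indicator 1 (fun i => U (z i)) *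
            F.indicator 1 (fun i => V (z i)) ∂P =
          ((P.withDensity fun z => (∏ i ∈ Λ, g i (z i)) *
            ((s : Set ι).pi D).indicator 1 (fun i => U (z i))).map fun z i => V (z i)) F := by
        intro F hF
        rw [Measure.map_apply hVV hF, ← lintegral_indicator_one (hVV hF),
          lintegral_withDensity_eq_lintegral_mul _ hw (measurable_one.indicator (hVV hF))]
        rfl
      have hfin : IsFiniteMeasure ((P.withDensity fun z => (∏ i ∈ Λ, g i (z i)) *
            ((s : Set ι).pi D).indicator 1 (fun i => U (z i))).map fun z i => V (z i)) := by
        have : IsFiniteMeasure (P.withDensity fun z => (∏ i ∈ Λ, g i (z i)) *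
            ((s : Set ι).pi D).indicator 1 (fun i => U (z i))) := by
          refine isFiniteMeasure_withDensity (ne_top_of_le_ne_top (b := 1) (by simp) ?_)
          calc _ ≤ ∫⁻ _, 1 ∂P := lintegral_mono fun z => mul_le_one' (hW1 z) (indicator_one_le _ _)
            _ = 1 := by simp
        infer_instance
      have heq : ((P.withDensity fun z => (∏ i ∈ Λ, g i (z i)) *
            ((s : Set ι).pi D).indicator 1 (fun i => U (z i))).map fun z i => V (z i)) =
          (∫⁻ z, (∏ i ∈ Λ, g i (z i)) * ((s : Set ι).pi D).indicator 1 (fun i => U (z i)) ∂P) •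
            R := by
        refine ext_of_boxes fun s' F hF => ?_
        rw [← e _ (MeasurableSet.pi s'.countable_toSet fun i _ => hF i), box s s' D F hD hF]
        rfl
      intro F hF
      rw [e F hF, heq]
      rfl
    intro D F hD hF
    have hw : Measurable fun z : ι → E => (∏ i ∈ Λ, g i (z i)) *
        F.indicator 1 (fun i => V (z i)) := hW.mul (mkF hF)
    -- Now the set for `V` is fixed and arbitrary, and both sides are finite measures in the set for
    -- `U`.
    have e1 : ∀ D : Set (ι → A), MeasurableSet D →
        ∫⁻ z, (∏ i ∈ Λ, g i (z i)) * D.indicator 1 (fun i => U (z i)) *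
          F.indicator 1 (fun i => V (z i)) ∂P =
        ((P.withDensity fun z => (∏ i ∈ Λ, g i (z i)) *
          F.indicator 1 (fun i => V (z i))).map fun z i => U (z i)) D := by
      intro D hD
      rw [Measure.map_apply hUU hD, ← lintegral_indicator_one (hUU hD),
        lintegral_withDensity_eq_lintegral_mul _ hw (measurable_one.indicator (hUU hD))]
      refine lintegral_congr fun z => ?_
      simp only [Pi.mul_apply]
      rw [mul_right_comm]
      rfl
    have e2 : ∀ D : Set (ι → A), MeasurableSet D →
        (∫⁻ z, (∏ i ∈ Λ, g i (z i)) * D.indicator 1 (fun i => U (z i)) ∂P) * R F =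
        (R F • (P.withDensity fun z => ∏ i ∈ Λ, g i (z i)).map fun z i => U (z i)) D := by
      intro D hD
      rw [Measure.smul_apply, Measure.map_apply hUU hD, ← lintegral_indicator_one (hUU hD),
        lintegral_withDensity_eq_lintegral_mul _ hW (measurable_one.indicator (hUU hD)), mul_comm]
      rfl
    have hfin : IsFiniteMeasure ((P.withDensity fun z => (∏ i ∈ Λ, g i (z i)) *
          F.indicator 1 (fun i => V (z i))).map fun z i => U (z i)) := by
      have : IsFiniteMeasure (P.withDensity fun z => (∏ i ∈ Λ, g i (z i)) *
          F.indicator 1 (fun i => V (z i))) := by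
        refine isFiniteMeasure_withDensity (ne_top_of_le_ne_top (b := 1) (by simp) ?_)
        calc _ ≤ ∫⁻ _, 1 ∂P := lintegral_mono fun z => mul_le_one' (hW1 z) (indicator_one_le _ _)
          _ = 1 := by simp
      infer_instance
    rw [e1 D hD, e2 D hD]
    congr 1
    refine ext_of_boxes fun s D hD => ?_
    have hDm := MeasurableSet.pi s.countable_toSet fun i _ => hD i
    rw [← e1 _ hDm, ← e2 _ hDm, step1 s D hD F hF]
  have hw : Measurable fun z : ι → E => (∏ i ∈ Λ, g i (z i)) *
      D.indicator 1 (fun i => U (z i)) := hW.mul ((measurable_one.indicator hD).comp hUU)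
  have heq : ((P.withDensity fun z => (∏ i ∈ Λ, g i (z i)) *
        D.indicator 1 (fun i => U (z i))).map fun z i => V (z i)) =
      (∫⁻ z, (∏ i ∈ Λ, g i (z i)) * D.indicator 1 (fun i => U (z i)) ∂P) • R := by
    refine Measure.ext fun F hF => ?_
    rw [Measure.map_apply hVV hF, ← lintegral_indicator_one (hVV hF),
      lintegral_withDensity_eq_lintegral_mul _ hw (measurable_one.indicator (hVV hF))]
    exact hsets hD hF
  have := congrArg (fun ν => ∫⁻ b, h b ∂ν) heq
  simp only [lintegral_smul_measure, smul_eq_mul] at this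
  rw [lintegral_map hh hVV, lintegral_withDensity_eq_lintegral_mul _ hw (hh.fun_comp hVV)] at this
  exact this

lemma comap_coords_le {κ : Type*} {I : Set ι} {i : κ → ι} (hi : ∀ k, i k ∈ I) :
    MeasurableSpace.comap (fun (z : ι → E) k => z (i k)) MeasurableSpace.pi ≤
      ⨆ i ∈ I, MeasurableSpace.comap (fun z : ι → E => z i) inferInstance := by
  rw [← measurable_iff_comap_le]
  refine @measurable_pi_lambda _ _ _ (_) _ _ fun k => ?_
  rw [measurable_iff_comap_le]
  exact le_biSup (fun i => MeasurableSpace.comap (fun z : ι → E => z i) inferInstance) (hi k)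

/-- Disjoint groups of coordinates are independent under a product measure. -/
lemma indepFun_infinitePi_of_disjoint (μ : Measure E) [IsProbabilityMeasure μ] {I J : Set ι}
    (hIJ : Disjoint I J) {κ κ' : Type*} {i : κ → ι} {j : κ' → ι} (hi : ∀ k, i k ∈ I)
    (hj : ∀ k, j k ∈ J) :
    IndepFun (fun (z : ι → E) k => z (i k)) (fun (z : ι → E) k => z (j k))
      (Measure.infinitePi fun _ : ι => μ) := by
  have h := iIndepFun_infinitePi (P := fun _ : ι => μ) (X := fun _ x => x) (by fun_prop)
  rw [iIndepFun_iff_iIndep] at h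
  have h2 := indep_iSup_of_disjoint (fun i => (measurable_pi_apply i).comap_le) h hIJ
  rw [IndepFun_iff_Indep]
  exact indep_of_indep_of_le_left (indep_of_indep_of_le_right h2 (comap_coords_le hj)) (comap_coords_le hi)

end Product

/-! ### Measurability of the coordinates and of the restart -/

section Measurability

variable {d : ℕ} {S : Type*} [MeasurableSpace S]

lemma measurable_X (t : ℕ) : Measurable fun σ : Sample d S => X σ t :=
  (measurable_pi_apply t).comp measurable_snd

lemma measurable_ecoin (t : ℕ) : Measurable fun σ : Sample d S => ecoin σ t :=
  (measurable_pi_apply t).comp (measurable_snd.comp measurable_fst)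

lemma measurable_site (x : Site d) (t : ℕ) : Measurable fun σ : Sample d S => σ.1.1 x t :=
  (measurable_pi_apply t).comp ((measurable_pi_apply x).comp (measurable_fst.comp measurable_fst))

lemma measurable_kcoin (t : ℕ) (x : Site d) : Measurable fun σ : Sample d S => kcoin σ t x :=
  measurable_snd.comp (measurable_site x t)

lemma measurable_env (t : ℕ) (x : Site d) : Measurable fun σ : Sample d S => env σ t x :=
  measurable_fst.comp (measurable_site x t)

lemma measurable_restart (t : ℕ) : Measurable (restart (d := d) (S := S) t) := by
  have h1 : Measurable fun p : ((Site d → ℕ → S × Bool) × (ℕ → Bool)) × Site d =>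
      envFrom t p.2 p.1 := measurable_from_prod_countable_left fun x => measurable_envFrom t x
  have h2 : Measurable (walkAfter (d := d) (S := S) t) :=
    measurable_pi_iff.2 fun n => (measurable_X (t + n)).sub (measurable_X t)
  exact (h1.comp (measurable_fst.prodMk (measurable_X t))).prodMk h2

end Measurability

/-! ### The future environment given a path and its coins -/

namespace RWDRE

variable {d : ℕ} {S : Type*} [MeasurableSpace S] (M : RWDRE d S)

/-- The law of the environment and of all the coins. -/
def coinLaw : Measure ((Site d → ℕ → S × Bool) × (ℕ → Bool)) :=
  (Measure.infinitePi fun _ : Site d => M.siteLaw).prod (Measure.infinitePi fun _ : ℕ => coin M.ε)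

instance : IsProbabilityMeasure M.coinLaw := by unfold coinLaw; infer_instance

lemma annealed_eq : M.annealed = M.coinLaw ⊗ₘ M.quenched := rfl

/-- The probability, given the environment and the coins, that the walk follows the path `x` up to
time `t`. -/
def pathProb (t : ℕ) (x : ℕ → Site d) (η : (Site d → ℕ → S × Bool) × (ℕ → Bool)) : ℝ≥0∞ :=
  ∏ s ∈ Finset.range t, M.jumpKernel (look s (η, x s)) {x (s + 1) - x s}

/-- Prescribing the path makes the recentring in `restart` deterministic, so that the quenched
Markov property applies for each environment. -/
lemma annealed_path (t : ℕ) {x : ℕ → Site d} (hx : x 0 = 0)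
    {G : Set ((Site d → ℕ → S × Bool) × (ℕ → Bool))} (hG : MeasurableSet G)
    {F : Set (Sample d S)} (hF : MeasurableSet F) :
    M.annealed {σ | (∀ s ≤ t, X σ s = x s) ∧ σ.1 ∈ G ∧ restart t σ ∈ F} =
      ∫⁻ η, G.indicator 1 η * (M.pathProb t x η *
        M.quenched (envFrom t (x t) η) (Prod.mk (envFrom t (x t) η) ⁻¹' F)) ∂M.coinLaw := by
  have hm : MeasurableSet {σ : Sample d S | (∀ s ≤ t, X σ s = x s) ∧ σ.1 ∈ G ∧ restart t σ ∈ F} := by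
    have : {σ : Sample d S | (∀ s ≤ t, X σ s = x s) ∧ σ.1 ∈ G ∧ restart t σ ∈ F} =
        (⋂ s ≤ t, (fun σ => X σ s) ⁻¹' {x s}) ∩ (Prod.fst ⁻¹' G ∩ restart t ⁻¹' F) := by
      ext; simp
    rw [this]
    exact (MeasurableSet.iInter fun s => MeasurableSet.iInter fun _ =>
      measurable_X s (measurableSet_singleton _)).inter
        ((measurable_fst hG).inter (measurable_restart t hF))
  rw [annealed_eq, Measure.compProd_apply hm]
  refine lintegral_congr fun η => ?_
  by_cases hη : η ∈ G
  · rw [Set.indicator_of_mem hη, Pi.one_apply, one_mul, pathProb,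
      ← M.quenched_cylinder_inter t η x hx (measurable_prodMk_left hF)]
    congr 1
    ext z
    change ((∀ s ≤ t, z s = x s) ∧ η ∈ G ∧ (envFrom t (z t) η, fun n => z (t + n) - z t) ∈ F) ↔
      (∀ s ≤ t, z s = x s) ∧ (envFrom t (x t) η, fun n => z (t + n) - z t) ∈ F
    constructor
    · rintro ⟨h1, -, h2⟩
      rw [h1 t le_rfl] at h2 ⊢
      exact ⟨h1, h2⟩
    · rintro ⟨h1, h2⟩
      rw [h1 t le_rfl] at h2 ⊢
      exact ⟨h1, hη, h2⟩
  · rw [Set.indicator_of_notMem hη, zero_mul]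
    convert measure_empty (μ := M.quenched η)
    ext z
    simp only [Set.mem_empty_iff_false, iff_false]
    exact fun h => hη h.2.1

lemma infinitePi_siteLaw_map :
    (Measure.infinitePi fun _ : Site d => M.siteLaw).map (fun ζ x => siteFrom 0 (ζ x)) =
      Measure.infinitePi fun _ : Site d => M.siteLaw.map (siteFrom 0) :=
  Measure.infinitePi_map_pi _ fun _ => measurable_siteFrom 0

/-- The event involves the coins of times `1` to `t`, and `coinsFrom t` only those after `t`. -/
lemma lintegral_coins_factor (t : ℕ) (e : ℕ → Bool) {k : (ℕ → Bool) → ℝ≥0∞} (hk : Measurable k) :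
    ∫⁻ ε, {ε : ℕ → Bool | ∀ i < t, ε (i + 1) = e i}.indicator 1 ε * k (coinsFrom t ε)
        ∂Measure.infinitePi (fun _ : ℕ => coin M.ε) =
      (∫⁻ ε, {ε : ℕ → Bool | ∀ i < t, ε (i + 1) = e i}.indicator 1 ε
        ∂Measure.infinitePi (fun _ : ℕ => coin M.ε)) *
        ∫⁻ ε, k (coinsFrom 0 ε) ∂Measure.infinitePi (fun _ : ℕ => coin M.ε) := by
  have hind := indepFun_infinitePi_of_disjoint (coin M.ε) (I := Set.Iic t) (J := Set.Ioi t)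
    (Set.disjoint_left.2 fun i hi hj => by simp at hi hj; omega)
    (i := fun i : Fin t => (i : ℕ) + 1) (j := fun n : ℕ => t + 1 + n)
    (fun k => by simp only [Set.mem_Iic]; omega) (fun k => by simp only [Set.mem_Ioi]; omega)
  have hφ : Measurable fun (u : ℕ → Bool) (n : ℕ) => if n = 0 then false else u (n - 1) := by
    refine measurable_pi_iff.2 fun n => ?_
    by_cases h : n = 0
    · simp only [h, if_true]; fun_prop
    · simp only [h, if_false]; fun_prop
  have hψ : Measurable ({a : Fin t → Bool | ∀ i, a i = e i}.indicator (1 : (Fin t → Bool) → ℝ≥0∞)) :=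
    measurable_of_finite _
  have h2 := hind.comp hψ (hk.comp hφ)
  have e1 : ({a : Fin t → Bool | ∀ i, a i = e i}.indicator (1 : (Fin t → Bool) → ℝ≥0∞)) ∘
      (fun (z : ℕ → Bool) (k : Fin t) => z ((k : ℕ) + 1)) =
      {ε : ℕ → Bool | ∀ i < t, ε (i + 1) = e i}.indicator 1 := by
    classical
    funext ε
    simp only [Function.comp, Set.indicator_apply, Pi.one_apply]
    refine if_congr ⟨fun h i hi => h ⟨i, hi⟩, fun h i => h i i.2⟩ rfl rfl
  have e2 : (k ∘ fun (u : ℕ → Bool) (n : ℕ) => if n = 0 then false else u (n - 1)) ∘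
      (fun (z : ℕ → Bool) (n : ℕ) => z (t + 1 + n)) = fun ε => k (coinsFrom t ε) := by
    funext ε
    simp only [Function.comp]
    congr 1
    funext n
    by_cases h : n = 0
    · simp [coinsFrom, h]
    · have : t + 1 + (n - 1) = t + n := by omega
      simp [coinsFrom, h, this]
  rw [e1, e2] at h2
  have hm1 : Measurable ({ε : ℕ → Bool | ∀ i < t, ε (i + 1) = e i}.indicator
      (1 : (ℕ → Bool) → ℝ≥0∞)) := by
    rw [← e1]; exact hψ.comp (by fun_prop)
  rw [lintegral_mul_eq_lintegral_mul_lintegral_of_indepFun'' hm1.aemeasurable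
    (hk.fun_comp (measurable_coinsFrom t)).aemeasurable h2]
  congr 1
  -- `coinsFrom t` is `coinsFrom 0` of the shifted coins, and an i.i.d. sequence is shift invariant
  -- in law.
  have hshift := Measure.map_infinitePi_infinitePi_of_inj (P := fun _ : ℕ => coin M.ε)
    (f := fun n : ℕ => t + n) (fun a b h => by simpa using h)
  conv_rhs => rw [← hshift]
  rw [lintegral_map (hk.fun_comp (measurable_coinsFrom 0)) (by fun_prop)]
  refine lintegral_congr fun ε => ?_
  congr 1
  funext n
  simp [coinsFrom]

/-- The probability of the step of the walk at time `s` as seen from the site `y`. -/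
def stepWeight (x : ℕ → Site d) (e : ℕ → Bool) (y : Site d) (s : ℕ) (w : S) : ℝ≥0∞ :=
  open Classical in
  if x s = y then M.jumpKernel (w, e s) {x (s + 1) - x s} else 1

lemma measurable_stepWeight (x : ℕ → Site d) (e : ℕ → Bool) (y : Site d) (s : ℕ) :
    Measurable (M.stepWeight x e y s) := by
  unfold stepWeight
  split_ifs
  · exact (M.jumpKernel.measurable_coe (measurableSet_singleton _)).comp (by fun_prop)
  · exact measurable_const

lemma stepWeight_le_one (x : ℕ → Site d) (e : ℕ → Bool) (y : Site d) (s : ℕ) (w : S) :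
    M.stepWeight x e y s w ≤ 1 := by
  unfold stepWeight
  split_ifs
  · exact prob_le_one
  · exact le_rfl

/-- When the `ε`-coin shows `true` the jump law is `q`, whatever the state; a step from another site
has weight `1` at `y`. -/
lemma stepWeight_const {x : ℕ → Site d} {e : ℕ → Bool} {y : Site d} {s : ℕ}
    (h : x s = y → e s = true) (w w' : S) :
    M.stepWeight x e y s w = M.stepWeight x e y s w' := by
  unfold stepWeight
  split_ifs with hy
  · rw [h hy]
    have : M.jumpKernel (w, true) = M.jumpKernel (w', true) := by
      change (∑ e ∈ nbrs d, ENNReal.ofReal (M.jumpProb w true e) • Measure.dirac e :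
        Measure (Site d)) = ∑ e ∈ nbrs d, ENNReal.ofReal (M.jumpProb w' true e) • Measure.dirac e
      simp [jumpProb]
    rw [this]
  · rfl

/-- The coins at `y` show `true` at some time after the last proper visit to `y`. -/
def refreshedAt (t : ℕ) (x : ℕ → Site d) (e : ℕ → Bool) (y : Site d) : Set (Fin t → Bool) :=
  {k | ∀ s < t, x s = y → e s = false → ∃ v : Fin t, s ≤ v ∧ k v = true}

/-- This is the alternative that `lintegral_siteLaw_factor` asks for. Either `y` is never properly
visited, or a `true` coin follows the last proper visit, and every later step from `y` uses `q`. -/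
lemma refreshedAt_spec (t : ℕ) (x : ℕ → Site d) (e : ℕ → Bool) (y : Site d) :
    (∀ s < t, ∀ w w', M.stepWeight x e y s w = M.stepWeight x e y s w') ∨
      ∀ k ∈ refreshedAt t x e y, ∃ v : Fin t, k v = true ∧
        ∀ s < t, (v : ℕ) < s → ∀ w w', M.stepWeight x e y s w = M.stepWeight x e y s w' := by
  classical
  by_cases h : ∃ s < t, x s = y ∧ e s = false
  · right
    obtain ⟨u, hu, hmax⟩ := ((Finset.range t).filter fun s => x s = y ∧ e s = false).exists_max_image id
      (by obtain ⟨s, hs, h⟩ := h; exact ⟨s, by simp [hs, h]⟩)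
    simp only [Finset.mem_filter, Finset.mem_range, id] at hu hmax
    intro k hk
    obtain ⟨v, huv, hv⟩ := hk u hu.1 hu.2.1 hu.2.2
    refine ⟨v, hv, fun s hs hvs => M.stepWeight_const fun hy => ?_⟩
    by_contra he
    have := hmax s ⟨hs, hy, by simpa using he⟩
    omega
  · left
    push Not at h
    exact fun s hs => M.stepWeight_const fun hy => by simpa using h s hs hy

/-- The environment seen from time `t` on is fresh, once every properly visited site has been
refreshed. -/
lemma lintegral_coinLaw_factor (t : ℕ) (x : ℕ → Site d) (e : ℕ → Bool)
    {D : Set (Site d → Fin t → Bool)} (hD : MeasurableSet D)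
    (hreg : ∀ a ∈ D, ∀ s < t, e s = false → ∃ v : Fin t, s ≤ v ∧ a (x s) v = true)
    {h : (Site d → ℕ → S × Bool) × (ℕ → Bool) → ℝ≥0∞} (hh : Measurable h) :
    ∫⁻ η, {η : (Site d → ℕ → S × Bool) × (ℕ → Bool) | (∀ i < t, η.2 (i + 1) = e i) ∧
        (fun y (i : Fin t) => (η.1 y (i + 1)).2) ∈ D}.indicator 1 η *
        (M.pathProb t x η * h (envFrom t (x t) η)) ∂M.coinLaw =
      (∫⁻ η, {η : (Site d → ℕ → S × Bool) × (ℕ → Bool) | (∀ i < t, η.2 (i + 1) = e i) ∧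
        (fun y (i : Fin t) => (η.1 y (i + 1)).2) ∈ D}.indicator 1 η *
        M.pathProb t x η ∂M.coinLaw) * ∫⁻ η, h (envFrom 0 0 η) ∂M.coinLaw := by
  classical
  set μ := Measure.infinitePi fun _ : Site d => M.siteLaw
  set ν := Measure.infinitePi fun _ : ℕ => coin M.ε
  set ρ := M.siteLaw.map (siteFrom 0)
  have hρ : IsProbabilityMeasure ρ :=
    Measure.isProbabilityMeasure_map (measurable_siteFrom 0).aemeasurable
  set U : (ℕ → S × Bool) → Fin t → Bool := fun z i => (z (i + 1)).2
  have hU : Measurable U := by fun_prop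
  -- `D` need not be a product over sites, so each site weight carries its own refreshment
  -- indicator; `hreg` makes these indicators equal to `1` on `D`.
  set g : Site d → (ℕ → S × Bool) → ℝ≥0∞ := fun y z =>
    (∏ s ∈ Finset.range t, M.stepWeight x e y s (z s).1) * (refreshedAt t x e y).indicator 1 (U z)
  have hg : ∀ y, Measurable (g y) := fun y =>
    (Finset.measurable_prod _ fun s _ => (M.measurable_stepWeight x e y s).comp (by fun_prop)).mul
      ((measurable_of_finite ((refreshedAt t x e y).indicator (1 : (Fin t → Bool) → ℝ≥0∞))).comp hU)
  have hg1 : ∀ y z, g y z ≤ 1 := fun y z =>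
    mul_le_one' (Finset.prod_le_one' fun s _ => M.stepWeight_le_one x e y s _) (indicator_one_le _ _)
  set Λ : Finset (Site d) := (Finset.range t).image x
  have hΛ : ∀ y ∉ Λ, g y = 1 := by
    intro y hy
    have hy' : ∀ s < t, x s ≠ y := by simpa [Λ] using hy
    funext z
    have h1 : U z ∈ refreshedAt t x e y := fun s hs hxy => absurd hxy (hy' s hs)
    simp only [g]
    rw [Set.indicator_of_mem h1, Finset.prod_eq_one]
    · simp
    · intro s hs
      simp [stepWeight, hy' s (Finset.mem_range.1 hs)]
  have hfac : ∀ y (D : Set (Fin t → Bool)) (F : Set (ℕ → S × Bool)), MeasurableSet D →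
      MeasurableSet F →
      ∫⁻ z, g y z * D.indicator 1 (U z) * F.indicator 1 (siteFrom t z) ∂M.siteLaw =
        (∫⁻ z, g y z * D.indicator 1 (U z) ∂M.siteLaw) * ρ F := by
    intro y D F _ hF
    have := M.lintegral_siteLaw_factor t (M.measurable_stepWeight x e y)
      (fun k => (refreshedAt t x e y).indicator 1 k * D.indicator 1 k)
      ((M.refreshedAt_spec t x e y).imp id fun hc k hk => hc k (by
        by_contra hn
        simp [Set.indicator_of_notMem hn] at hk))
      (h := F.indicator 1) (measurable_one.indicator hF)
    have hρF : ∫⁻ z, F.indicator 1 (siteFrom 0 z) ∂M.siteLaw = ρ F := by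
      rw [← lintegral_map (f := F.indicator 1) (measurable_one.indicator hF) (measurable_siteFrom 0),
        lintegral_indicator_one hF]
    rw [hρF] at this
    simp only [← mul_assoc] at this
    exact this
  have hpath : ∀ (ζ : Site d → ℕ → S × Bool) (ε : ℕ → Bool),
      {η : (Site d → ℕ → S × Bool) × (ℕ → Bool) | (∀ i < t, η.2 (i + 1) = e i) ∧
        (fun y (i : Fin t) => (η.1 y (i + 1)).2) ∈ D}.indicator
        (1 : (Site d → ℕ → S × Bool) × (ℕ → Bool) → ℝ≥0∞) (ζ, ε) *
        M.pathProb t x (ζ, ε) =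
      {ε : ℕ → Bool | ∀ i < t, ε (i + 1) = e i}.indicator 1 ε *
        ((∏ y ∈ Λ, g y (ζ y)) * D.indicator 1 fun y => U (ζ y)) := by
    intro ζ ε
    by_cases h1 : ε ∈ {ε : ℕ → Bool | ∀ i < t, ε (i + 1) = e i}
    · by_cases h2 : (fun y => U (ζ y)) ∈ D
      · have h3 : (ζ, ε) ∈ {η : (Site d → ℕ → S × Bool) × (ℕ → Bool) |
            (∀ i < t, η.2 (i + 1) = e i) ∧ (fun y (i : Fin t) => (η.1 y (i + 1)).2) ∈ D} := ⟨h1, h2⟩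
        rw [Set.indicator_of_mem h1, Set.indicator_of_mem h2, Set.indicator_of_mem h3]
        simp only [Pi.one_apply, one_mul, mul_one, g, pathProb]
        have h4 : ∀ y, (refreshedAt t x e y).indicator (1 : (Fin t → Bool) → ℝ≥0∞) (U (ζ y)) = 1 := by
          intro y
          refine Set.indicator_of_mem (f := (1 : (Fin t → Bool) → ℝ≥0∞)) ?_
          intro s hs hxy hes
          have := hreg _ h2 s hs hes
          rwa [hxy] at this
        simp only [h4, mul_one]
        -- For each time `s`, only the site `x s` contributes a factor other than `1`.
        rw [Finset.prod_comm]
        refine Finset.prod_congr rfl fun s hs => ?_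
        have hs' := Finset.mem_range.1 hs
        unfold stepWeight
        rw [Finset.prod_ite_eq, if_pos (Finset.mem_image_of_mem x hs)]
        have : look s ((ζ, ε), x s) = ((ζ (x s) s).1, e s) := by
          simp only [look, h1 s hs']
        rw [this]
      · have h3 : (ζ, ε) ∉ {η : (Site d → ℕ → S × Bool) × (ℕ → Bool) |
            (∀ i < t, η.2 (i + 1) = e i) ∧ (fun y (i : Fin t) => (η.1 y (i + 1)).2) ∈ D} :=
          fun h => h2 h.2
        rw [Set.indicator_of_notMem h2, Set.indicator_of_notMem h3]
        simp
    · have h3 : (ζ, ε) ∉ {η : (Site d → ℕ → S × Bool) × (ℕ → Bool) |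
            (∀ i < t, η.2 (i + 1) = e i) ∧ (fun y (i : Fin t) => (η.1 y (i + 1)).2) ∈ D} :=
          fun h => h1 h.1
      rw [Set.indicator_of_notMem h1, Set.indicator_of_notMem h3]
      simp
  have hA : MeasurableSet {ε : ℕ → Bool | ∀ i < t, ε (i + 1) = e i} := by
    have : {ε : ℕ → Bool | ∀ i < t, ε (i + 1) = e i} = ⋂ i < t, (fun ε => ε (i + 1)) ⁻¹' {e i} := by
      ext; simp
    rw [this]
    exact MeasurableSet.iInter fun i => MeasurableSet.iInter fun _ =>
      measurable_pi_apply _ (measurableSet_singleton _)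
  have hDm : Measurable fun ζ : Site d → ℕ → S × Bool => D.indicator
      (1 : (Site d → Fin t → Bool) → ℝ≥0∞)
      fun y => U (ζ y) := (measurable_one.indicator hD).comp (by fun_prop)
  have hWm : Measurable fun ζ : Site d → ℕ → S × Bool => ∏ y ∈ Λ, g y (ζ y) :=
    Finset.measurable_prod _ fun y _ => (hg y).comp (measurable_pi_apply y)
  have hWD := hWm.fun_mul hDm
  set C := ∫⁻ ζ, (∏ y ∈ Λ, g y (ζ y)) * D.indicator 1 (fun y => U (ζ y)) ∂μ
  set θ := Measure.infinitePi fun _ : Site d => ρ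
  have hR : μ.map (fun ζ x => siteFrom 0 (ζ x)) = θ := M.infinitePi_siteLaw_map
  have hsite0 : Measurable fun (ζ : Site d → ℕ → S × Bool) x => siteFrom 0 (ζ x) :=
    measurable_pi_iff.2 fun x => (measurable_siteFrom 0).comp (measurable_pi_apply x)
  -- The sites are i.i.d., so recentring at `x t` does not change the law.
  have hRshift : θ.map (fun b z => b (x t + z)) = θ :=
    Measure.map_infinitePi_infinitePi_of_inj (P := fun _ : Site d => ρ)
      (f := fun z => x t + z) (add_right_injective _)
  set k : (ℕ → Bool) → ℝ≥0∞ := fun ε => ∫⁻ b, h (b, ε) ∂θ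
  have hk : Measurable k := hh.lintegral_prod_left'
  have hrhs : ∫⁻ η, h (envFrom 0 0 η) ∂M.coinLaw = ∫⁻ ε, k (coinsFrom 0 ε) ∂ν := by
    rw [coinLaw, lintegral_prod_symm _ (hh.fun_comp (measurable_envFrom 0 0)).aemeasurable]
    refine lintegral_congr fun ε => ?_
    simp only [k]
    rw [← hR, lintegral_map (hh.fun_comp measurable_prodMk_right) hsite0]
    refine lintegral_congr fun ζ => ?_
    simp [envFrom]
  have hlhs1 : ∫⁻ η, {η : (Site d → ℕ → S × Bool) × (ℕ → Bool) | (∀ i < t, η.2 (i + 1) = e i) ∧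
        (fun y (i : Fin t) => (η.1 y (i + 1)).2) ∈ D}.indicator 1 η *
        (M.pathProb t x η * h (envFrom t (x t) η)) ∂M.coinLaw =
      ∫⁻ ε, {ε : ℕ → Bool | ∀ i < t, ε (i + 1) = e i}.indicator 1 ε *
        (C * k (coinsFrom t ε)) ∂ν := by
    have : ∀ η : (Site d → ℕ → S × Bool) × (ℕ → Bool),
        {η : (Site d → ℕ → S × Bool) × (ℕ → Bool) | (∀ i < t, η.2 (i + 1) = e i) ∧
        (fun y (i : Fin t) => (η.1 y (i + 1)).2) ∈ D}.indicator 1 η *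
        (M.pathProb t x η * h (envFrom t (x t) η)) =
        {ε : ℕ → Bool | ∀ i < t, ε (i + 1) = e i}.indicator 1 η.2 *
        ((∏ y ∈ Λ, g y (η.1 y)) * D.indicator 1 (fun y => U (η.1 y)) * h (envFrom t (x t) η)) := by
      rintro ⟨ζ, ε⟩
      rw [← mul_assoc, hpath, mul_assoc]
    simp only [this]
    rw [coinLaw, lintegral_prod_symm]
    · refine lintegral_congr fun ε => ?_
      simp only
      rw [lintegral_const_mul]
      · congr 1
        have hm : Measurable fun b : Site d → ℕ → S × Bool =>
            h (fun z => b (x t + z), coinsFrom t ε) := hh.fun_comp (by fun_prop)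
        have := lintegral_infinitePi_factor M.siteLaw ρ hU (measurable_siteFrom t) Λ hg hg1 hΛ hfac
          hD hm
        refine this.trans ?_
        congr 1
        simp only [k]
        conv_rhs => rw [← hRshift]
        rw [lintegral_map (hh.fun_comp measurable_prodMk_right) (by fun_prop)]
      · exact hWD.mul ((hh.fun_comp (measurable_envFrom t (x t))).comp measurable_prodMk_right)
    · exact (((measurable_one.indicator hA).comp measurable_snd).mul
        ((hWD.comp measurable_fst).mul (hh.fun_comp (measurable_envFrom t (x t))))).aemeasurable
  have hlhs2 : ∫⁻ η, {η : (Site d → ℕ → S × Bool) × (ℕ → Bool) | (∀ i < t, η.2 (i + 1) = e i) ∧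
        (fun y (i : Fin t) => (η.1 y (i + 1)).2) ∈ D}.indicator 1 η *
        M.pathProb t x η ∂M.coinLaw =
      ∫⁻ ε, {ε : ℕ → Bool | ∀ i < t, ε (i + 1) = e i}.indicator 1 ε * C ∂ν := by
    have : ∀ η : (Site d → ℕ → S × Bool) × (ℕ → Bool),
        {η : (Site d → ℕ → S × Bool) × (ℕ → Bool) | (∀ i < t, η.2 (i + 1) = e i) ∧
        (fun y (i : Fin t) => (η.1 y (i + 1)).2) ∈ D}.indicator 1 η * M.pathProb t x η =
        {ε : ℕ → Bool | ∀ i < t, ε (i + 1) = e i}.indicator 1 η.2 *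
        ((∏ y ∈ Λ, g y (η.1 y)) * D.indicator 1 (fun y => U (η.1 y))) := fun η => hpath η.1 η.2
    simp only [this]
    rw [coinLaw, lintegral_prod_symm]
    · refine lintegral_congr fun ε => ?_
      simp only
      rw [lintegral_const_mul _ hWD]
    · exact (((measurable_one.indicator hA).comp measurable_snd).mul
        (hWD.comp measurable_fst)).aemeasurable
  rw [hlhs1, hlhs2, hrhs]
  have hkm : Measurable fun ε => {ε : ℕ → Bool | ∀ i < t, ε (i + 1) = e i}.indicator 1 ε *
      k (coinsFrom t ε) := (measurable_one.indicator hA).mul (hk.comp (measurable_coinsFrom t))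
  simp only [mul_left_comm _ C]
  rw [lintegral_const_mul _ hkm, lintegral_mul_const _ (measurable_one.indicator hA),
    M.lintegral_coins_factor t e hk]
  ring

end RWDRE

lemma measure_eq_tsum_fiber {Ω Y : Type*} [MeasurableSpace Ω] [MeasurableSpace Y] [Countable Y]
    [MeasurableSingletonClass Y] (μ : Measure Ω) {f : Ω → Y} (hf : Measurable f) {A : Set Ω}
    (hA : MeasurableSet A) : μ A = ∑' y, μ (A ∩ f ⁻¹' {y}) := by
  rw [← measure_iUnion]
  · congr 1
    ext ω
    simp
  · intro y y' h
    refine Set.disjoint_left.2 ?_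
    rintro ω ⟨-, h1⟩ ⟨-, h2⟩
    exact h (h1.symm.trans h2)
  · exact fun y => hA.inter (hf (measurableSet_singleton y))

/-! ### The regeneration event and the first regeneration time -/

section Regeneration

variable {d : ℕ} {S : Type*}

/-- After every proper visit before time `t`, a `κ`-coin of the visited site has shown `true`
before time `t`. -/
def Regen (t : ℕ) (σ : Sample d S) : Prop :=
  ∀ s < t, ecoin σ (s + 1) = false → ∃ v, s < v ∧ v < t ∧ kcoin σ v (X σ s) = true

/-- A coin that shows `true` after the last proper visit to a site also comes after the earlier
ones, so only last visits matter. At a site without proper visits the condition reads `0 < t`. -/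
lemma regen_iff {t : ℕ} (ht : 0 < t) (σ : Sample d S) :
    (∀ x : Site d, (lastVisit σ t x : ℕ∞) + refreshDelay σ t x < t) ↔ Regen t σ := by
  have key : ∀ (x : Site d) (n : ℕ),
      (n : ℕ∞) + sInf ((↑) '' {s : ℕ | 1 ≤ s ∧ kcoin σ (n + s) x = true}) < t ↔
        ∃ v, n < v ∧ v < t ∧ kcoin σ v x = true := by
    intro x n
    constructor
    · intro h
      by_cases he : {s : ℕ | 1 ≤ s ∧ kcoin σ (n + s) x = true}.Nonempty
      · have hmem := csInf_mem (he.image ((↑) : ℕ → ℕ∞))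
        obtain ⟨s, ⟨hs1, hs2⟩, hs3⟩ := hmem
        rw [← hs3] at h
        exact ⟨n + s, by omega, by exact_mod_cast h, hs2⟩
      -- If no coin ever shows `true`, the delay is `⊤`.
      · rw [Set.not_nonempty_iff_eq_empty.1 he] at h
        simp at h
    · rintro ⟨v, hv1, hv2, hv3⟩
      have hle : sInf (((↑) : ℕ → ℕ∞) '' {s : ℕ | 1 ≤ s ∧ kcoin σ (n + s) x = true}) ≤
          ((v - n : ℕ) : ℕ∞) :=
        sInf_le ⟨v - n, ⟨by omega, by rwa [Nat.add_sub_cancel' hv1.le]⟩, rfl⟩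
      refine lt_of_le_of_lt (by gcongr) (b := (n : ℕ∞) + ((v - n : ℕ) : ℕ∞)) ?_
      · rw [← Nat.cast_add, Nat.add_sub_cancel' hv1.le]
        exact_mod_cast hv2
  have hmem : ∀ s x, s ∈ properVisits σ t x ↔ s < t ∧ X σ s = x ∧ ecoin σ (s + 1) = false := by
    intro s x
    simp [properVisits]
  constructor
  · intro h s hs he
    have hs' : s ∈ properVisits σ t (X σ s) := (hmem _ _).2 ⟨hs, rfl, he⟩
    have h1 := h (X σ s)
    rw [refreshDelay, if_neg (Finset.ne_empty_of_mem hs'), key] at h1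
    obtain ⟨v, hv1, hv2⟩ := h1
    exact ⟨v, lt_of_le_of_lt (Finset.le_sup (f := id) hs') hv1, hv2⟩
  · intro h x
    by_cases he : properVisits σ t x = ∅
    · rw [refreshDelay, if_pos he, lastVisit, he]
      simpa using ht
    · rw [refreshDelay, if_neg he, key]
      obtain ⟨s, hs, hse⟩ := Finset.exists_mem_eq_sup _ (Finset.nonempty_iff_ne_empty.2 he) id
      have hs' := (hmem _ _).1 hs
      obtain ⟨v, hv⟩ := h s hs'.1 hs'.2.2
      rw [hs'.2.1] at hv
      rw [lastVisit, hse]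
      exact ⟨v, hv⟩

lemma τ₁_eq (σ : Sample d S) : τ₁ σ = sInf ((↑) '' {t : ℕ | 0 < t ∧ Regen t σ}) := by
  unfold τ₁
  congr 2
  ext t
  exact and_congr_right fun ht => regen_iff ht σ

lemma τ₁_eq_coe_iff (σ : Sample d S) (t : ℕ) :
    τ₁ σ = t ↔ 0 < t ∧ Regen t σ ∧ ∀ r < t, 0 < r → ¬ Regen r σ := by
  rw [τ₁_eq]
  constructor
  · intro h
    have hne : {t : ℕ | 0 < t ∧ Regen t σ}.Nonempty := by
      by_contra hn
      rw [Set.not_nonempty_iff_eq_empty.1 hn] at h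
      simp at h
    obtain ⟨s, hs, hst⟩ := csInf_mem (hne.image ((↑) : ℕ → ℕ∞))
    rw [h] at hst
    have hst' : s = t := by exact_mod_cast hst
    subst hst'
    refine ⟨hs.1, hs.2, fun r hr hr0 hreg => ?_⟩
    have : ((s : ℕ) : ℕ∞) ≤ r := h ▸ sInf_le ⟨r, ⟨hr0, hreg⟩, rfl⟩
    have : s ≤ r := by exact_mod_cast this
    omega
  · rintro ⟨h0, hreg, hmin⟩
    refine le_antisymm (sInf_le ⟨t, ⟨h0, hreg⟩, rfl⟩) (le_sInf ?_)
    rintro _ ⟨r, ⟨hr0, hr⟩, rfl⟩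
    by_contra hlt
    exact hmin r (by simpa using hlt) hr0 hr

lemma τ₁_pos (σ : Sample d S) : τ₁ σ ≠ 0 := by
  intro h
  exact ((τ₁_eq_coe_iff σ 0).1 h).1.ne rfl

lemma lt_τ₁_iff (σ : Sample d S) (t : ℕ) :
    (t : ℕ∞) < τ₁ σ ↔ ∀ r ≤ t, 0 < r → ¬ Regen r σ := by
  rw [τ₁_eq]
  constructor
  · intro h r hr hr0 hreg
    have : sInf (((↑) : ℕ → ℕ∞) '' {t : ℕ | 0 < t ∧ Regen t σ}) ≤ r :=
      sInf_le ⟨r, ⟨hr0, hreg⟩, rfl⟩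
    have h2 := h.trans_le this
    have : t < r := by exact_mod_cast h2
    omega
  · intro h
    refine lt_of_lt_of_le (b := ((t + 1 : ℕ) : ℕ∞)) (by exact_mod_cast Nat.lt_succ_self t)
      (le_sInf ?_)
    rintro _ ⟨r, ⟨hr0, hr⟩, rfl⟩
    by_contra hlt
    have hlt' : (r : ℕ∞) < ((t + 1 : ℕ) : ℕ∞) := not_le.1 hlt
    have : r < t + 1 := by exact_mod_cast hlt'
    exact h r (by omega) hr0 hr

/-- The `σ`-algebra on `Ω` is left open, and only the coordinates that `Regen t` reads are required
to be measurable. The lemma thus also serves the `σ`-algebras generated by `past t` and by `hist t`.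
-/
lemma measurableSet_regen {Ω : Type*} [MeasurableSpace Ω] (f : Ω → Sample d S) (t : ℕ)
    (hX : ∀ s < t, Measurable fun ω => X (f ω) s)
    (he : ∀ s < t, Measurable fun ω => ecoin (f ω) (s + 1))
    (hk : ∀ v, 0 < v → v < t → ∀ y, Measurable fun ω => kcoin (f ω) v y) :
    MeasurableSet {ω | Regen t (f ω)} := by
  have : {ω | Regen t (f ω)} = ⋂ s, ⋂ (_ : s < t), ({ω | ecoin (f ω) (s + 1) = false}ᶜ ∪
      ⋃ v, ⋃ (_ : s < v ∧ v < t), ⋃ y, ({ω | X (f ω) s = y} ∩ {ω | kcoin (f ω) v y = true})) := by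
    ext ω
    simp only [Regen, Set.mem_ofPred_eq, Set.mem_iInter, Set.mem_union, Set.mem_compl_iff,
      Set.mem_iUnion, Set.mem_inter_iff, exists_prop, exists_eq_left']
    refine forall_congr' fun s => forall_congr' fun _ => ?_
    rw [imp_iff_not_or]
    simp only [and_assoc]
  rw [this]
  refine MeasurableSet.iInter fun s => MeasurableSet.iInter fun hs =>
    ((he s hs) (measurableSet_singleton false)).compl.union ?_
  exact MeasurableSet.iUnion fun v => MeasurableSet.iUnion fun hv => MeasurableSet.iUnion fun y =>
    ((hX s hs) (measurableSet_singleton y)).inter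
      ((hk v (by omega) hv.2 y) (measurableSet_singleton true))

/-- The walk, the `ε`-coins and the `κ`-coins up to time `t`. -/
def past (t : ℕ) (σ : Sample d S) : (Fin (t + 1) → Site d) × (Fin t → Bool) × (Site d → Fin t → Bool) :=
  (fun i => X σ i, fun i => ecoin σ (i + 1), fun y i => kcoin σ (i + 1) y)

variable [MeasurableSpace S]

lemma measurable_past (t : ℕ) : Measurable (past (d := d) (S := S) t) :=
  (measurable_pi_iff.2 fun i : Fin (t + 1) => measurable_X (i : ℕ)).prodMk
    ((measurable_pi_iff.2 fun i : Fin t => measurable_ecoin ((i : ℕ) + 1)).prodMk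
      (measurable_pi_iff.2 fun y => measurable_pi_iff.2 fun i : Fin t =>
        measurable_kcoin ((i : ℕ) + 1) y))

lemma measurableSet_regen_sample (t : ℕ) : MeasurableSet {σ : Sample d S | Regen t σ} :=
  measurableSet_regen id t (fun s _ => measurable_X s) (fun s _ => measurable_ecoin (s + 1))
    fun v _ _ y => measurable_kcoin v y

lemma measurable_τ₁ : Measurable (τ₁ : Sample d S → ℕ∞) := by
  refine measurable_to_countable' fun n => ?_
  induction n using ENat.recTopCoe with
  | top =>
    have : (τ₁ : Sample d S → ℕ∞) ⁻¹' {⊤} = ⋂ t : ℕ, ⋂ (_ : 0 < t), {σ | Regen t σ}ᶜ := by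
      ext σ
      simp only [Set.mem_preimage, Set.mem_singleton_iff, Set.mem_iInter, Set.mem_compl_iff,
        Set.mem_ofPred_eq]
      constructor
      · intro h t ht
        exact (lt_τ₁_iff σ t).1 (by rw [h]; exact ENat.natCast_lt_top t) t le_rfl ht
      · intro h
        refine ENat.eq_top_iff_forall_gt.2 fun t => (lt_τ₁_iff σ t).2 fun r _ hr => h r hr
    rw [this]
    exact MeasurableSet.iInter fun t => MeasurableSet.iInter fun _ =>
      (measurableSet_regen_sample t).compl
  | coe t =>
    have : (τ₁ : Sample d S → ℕ∞) ⁻¹' {(t : ℕ∞)} = {_σ | 0 < t} ∩ ({σ | Regen t σ} ∩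
        ⋂ r, ⋂ (_ : r < t), ⋂ (_ : 0 < r), {σ | Regen r σ}ᶜ) := by
      ext σ
      simp only [Set.mem_preimage, Set.mem_singleton_iff, τ₁_eq_coe_iff, Set.mem_inter_iff,
        Set.mem_iInter, Set.mem_compl_iff, Set.mem_ofPred_eq]
    rw [this]
    exact (MeasurableSet.const _).inter ((measurableSet_regen_sample t).inter
      (MeasurableSet.iInter fun r => MeasurableSet.iInter fun _ => MeasurableSet.iInter fun _ =>
        (measurableSet_regen_sample r).compl))

end Regeneration

/-! ### Independence of past and future at a fixed regeneration time -/

namespace RWDRE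

variable {d : ℕ} {S : Type*} [MeasurableSpace S] (M : RWDRE d S)

lemma annealed_ae_zero : ∀ᵐ σ ∂M.annealed, X σ 0 = 0 := by
  rw [annealed_eq]
  refine (Measure.ae_compProd_iff ((measurable_X 0) (measurableSet_singleton 0))).2 ?_
  exact Filter.Eventually.of_forall fun η => M.quenched_ae_zero η

/-- The reference law is that of `restart 0 σ`: the coin `ε 0` is random under the annealed law,
while a restart resets it to `false`. -/
lemma annealed_restart_zero {F : Set (Sample d S)} (hF : MeasurableSet F) :
    M.annealed {σ | restart 0 σ ∈ F} =
      ∫⁻ η, M.quenched (envFrom 0 0 η) (Prod.mk (envFrom 0 0 η) ⁻¹' F) ∂M.coinLaw := by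
  have h := M.annealed_path 0 (x := 0) rfl MeasurableSet.univ hF
  simp only [pathProb, Finset.range_zero, Finset.prod_empty, one_mul, Set.indicator_univ,
    Pi.one_apply, Pi.zero_apply] at h
  rw [← h]
  refine measure_congr ?_
  filter_upwards [M.annealed_ae_zero] with σ hσ
  refine propext ?_
  change restart 0 σ ∈ F ↔ (∀ s ≤ 0, X σ s = 0) ∧ σ.1 ∈ Set.univ ∧ restart 0 σ ∈ F
  simp [hσ]

lemma annealed_path_factor (t : ℕ) {x : ℕ → Site d} (hx : x 0 = 0) (e : ℕ → Bool)
    {D : Set (Site d → Fin t → Bool)} (hD : MeasurableSet D)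
    (hreg : ∀ a ∈ D, ∀ s < t, e s = false → ∃ v : Fin t, s ≤ v ∧ a (x s) v = true)
    {F : Set (Sample d S)} (hF : MeasurableSet F) :
    M.annealed {σ | (∀ s ≤ t, X σ s = x s) ∧ ((∀ i < t, ecoin σ (i + 1) = e i) ∧
        (fun y (i : Fin t) => kcoin σ (i + 1) y) ∈ D) ∧ restart t σ ∈ F} =
      M.annealed {σ | (∀ s ≤ t, X σ s = x s) ∧ ((∀ i < t, ecoin σ (i + 1) = e i) ∧
        (fun y (i : Fin t) => kcoin σ (i + 1) y) ∈ D)} * M.annealed {σ | restart 0 σ ∈ F} := by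
  set G : Set ((Site d → ℕ → S × Bool) × (ℕ → Bool)) := {η | (∀ i < t, η.2 (i + 1) = e i) ∧
        (fun y (i : Fin t) => (η.1 y (i + 1)).2) ∈ D}
  have hG : MeasurableSet G := by
    have : G = (⋂ i < t, (fun η => η.2 (i + 1)) ⁻¹' {e i}) ∩
        (fun η y (i : Fin t) => (η.1 y (i + 1)).2) ⁻¹' D := by ext; simp [G]
    rw [this]
    exact (MeasurableSet.iInter fun i => MeasurableSet.iInter fun _ =>
      (by fun_prop : Measurable fun η : (Site d → ℕ → S × Bool) × (ℕ → Bool) => η.2 (i + 1))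
        (measurableSet_singleton _)).inter ((by fun_prop : Measurable fun (η :
          (Site d → ℕ → S × Bool) × (ℕ → Bool)) y (i : Fin t) => (η.1 y (i + 1)).2) hD)
  have h1 := M.annealed_path t hx hG hF
  have h2 := M.annealed_path t hx hG MeasurableSet.univ
  simp only [Set.preimage_univ, measure_univ, mul_one, Set.mem_univ, and_true] at h2
  have h3 := M.lintegral_coinLaw_factor t x e hD hreg
    (h := fun η => M.quenched η (Prod.mk η ⁻¹' F)) (Kernel.measurable_kernel_prodMk_left hF)
  rw [M.annealed_restart_zero hF]
  exact h1.trans (h3.trans (congrArg (· * _) h2.symm))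

/-- At a time at which every properly visited site has been refreshed, the future seen from the walk
is a fresh copy of the sample, independent of the past. -/
lemma annealed_regen (t : ℕ)
    {D : Set ((Fin (t + 1) → Site d) × (Fin t → Bool) × (Site d → Fin t → Bool))}
    (hD : MeasurableSet D) {F : Set (Sample d S)} (hF : MeasurableSet F) :
    M.annealed {σ | past t σ ∈ D ∧ Regen t σ ∧ restart t σ ∈ F} =
      M.annealed {σ | past t σ ∈ D ∧ Regen t σ} * M.annealed {σ | restart 0 σ ∈ F} := by
  have hDm : MeasurableSet {σ : Sample d S | past t σ ∈ D ∧ Regen t σ} :=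
    (measurable_past t hD).inter (measurableSet_regen_sample t)
  have hDm2 : MeasurableSet {σ : Sample d S | past t σ ∈ D ∧ Regen t σ ∧ restart t σ ∈ F} :=
    (measurable_past t hD).inter ((measurableSet_regen_sample t).inter (measurable_restart t hF))
  have hf : Measurable fun σ : Sample d S => ((past t σ).1, (past t σ).2.1) := by
    have := measurable_past (d := d) (S := S) t
    exact this.fst.prodMk this.snd.fst
  -- The path and the `ε`-coins up to time `t` take countably many values and are summed over. The
  -- `κ`-coins of all sites do not, so they remain as a measurable set.
  rw [measure_eq_tsum_fiber M.annealed hf hDm, measure_eq_tsum_fiber M.annealed hf hDm2,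
    ← ENNReal.tsum_mul_right]
  refine tsum_congr ?_
  rintro ⟨a, b⟩
  by_cases ha : a 0 = 0
  -- The path is frozen after time `t`; its later values play no role.
  · set x : ℕ → Site d := fun s => a ⟨min s t, by omega⟩
    set e : ℕ → Bool := fun s => if h : s < t then b ⟨s, h⟩ else false
    -- The entry `v` is the coin of time `v + 1`, so the strict bound in `Regen` becomes `v + 1 <
    -- t`.
    set D' : Set (Site d → Fin t → Bool) := {c | (a, b, c) ∈ D ∧ ∀ s < t, e s = false →
      ∃ v : Fin t, s ≤ v ∧ (v : ℕ) + 1 < t ∧ c (x s) v = true}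
    have hD' : MeasurableSet D' := by
      have : D' = (fun c => (a, b, c)) ⁻¹' D ∩ ⋂ s, ⋂ (_ : s < t), ⋂ (_ : e s = false),
          ⋃ v : Fin t, ⋃ (_ : s ≤ v ∧ (v : ℕ) + 1 < t), (fun c => c (x s) v) ⁻¹' {true} := by
        ext c; simp [D', and_assoc]
      rw [this]
      exact ((by fun_prop : Measurable fun c : Site d → Fin t → Bool => (a, b, c)) hD).inter
        (MeasurableSet.iInter fun s => MeasurableSet.iInter fun _ => MeasurableSet.iInter fun _ =>
          MeasurableSet.iUnion fun v => MeasurableSet.iUnion fun _ =>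
            (by fun_prop : Measurable fun c : Site d → Fin t → Bool => c (x s) v)
              (measurableSet_singleton _))
    have h := M.annealed_path_factor t (x := x) (by simpa [x] using ha) e hD'
      (fun c hc s hs hes => by
        obtain ⟨v, h1, -, h2⟩ := hc.2 s hs hes
        exact ⟨v, h1, h2⟩) hF
    have hpast : ∀ σ : Sample d S, ((past t σ).1, (past t σ).2.1) = (a, b) ↔
        (∀ s ≤ t, X σ s = x s) ∧ ∀ i < t, ecoin σ (i + 1) = e i := by
      intro σ
      rw [Prod.mk.injEq]
      refine and_congr ⟨fun h s hs => ?_, fun h => ?_⟩ ⟨fun h i hi => ?_, fun h => ?_⟩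
      · have := congrFun h ⟨s, by omega⟩
        simpa [past, x, hs] using this
      · funext i
        have := h i (by omega)
        have hi : min (i : ℕ) t = i := by omega
        simpa [past, x, hi] using this
      · have := congrFun h ⟨i, hi⟩
        simpa [past, e, hi] using this
      · funext i
        have := h i i.2
        simpa [past, e] using this
    have hmem : ∀ σ : Sample d S, ((past t σ).1, (past t σ).2.1) = (a, b) →
        ((past t σ ∈ D ∧ Regen t σ) ↔ (fun y (i : Fin t) => kcoin σ (i + 1) y) ∈ D') := by
      intro σ hσ
      have h1 := (hpast σ).1 hσ
      rw [Prod.mk.injEq] at hσ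
      have hp : past t σ = (a, b, fun y (i : Fin t) => kcoin σ (i + 1) y) := by
        rw [← hσ.1, ← hσ.2]; rfl
      rw [hp]
      refine and_congr_right fun _ => forall_congr' fun s => forall_congr' fun hs => ?_
      rw [h1.2 s hs, h1.1 s hs.le]
      refine forall_congr' fun _ => ⟨?_, ?_⟩
      · rintro ⟨v, hv1, hv2, hv3⟩
        refine ⟨⟨v - 1, by omega⟩, by simp only; omega, by simp only; omega, ?_⟩
        simp only
        rwa [Nat.sub_add_cancel (by omega)]
      · rintro ⟨v, hv1, hv2, hv3⟩
        exact ⟨v + 1, by omega, hv2, hv3⟩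
    convert h using 2
    · ext σ
      change ((past t σ ∈ D ∧ Regen t σ ∧ restart t σ ∈ F) ∧ _ = (a, b)) ↔
        ((∀ s ≤ t, X σ s = x s) ∧ ((∀ i < t, ecoin σ (i + 1) = e i) ∧ _ ∈ D') ∧ restart t σ ∈ F)
      constructor
      · rintro ⟨⟨h1, h2, h3⟩, h4⟩
        exact ⟨((hpast σ).1 h4).1, ⟨((hpast σ).1 h4).2, (hmem σ h4).1 ⟨h1, h2⟩⟩, h3⟩
      · rintro ⟨h1, ⟨h2, h3⟩, h4⟩
        have h5 := (hpast σ).2 ⟨h1, h2⟩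
        have h6 := (hmem σ h5).2 h3
        exact ⟨⟨h6.1, h6.2, h4⟩, h5⟩
    · congr 1
      ext σ
      change ((past t σ ∈ D ∧ Regen t σ) ∧ _ = (a, b)) ↔
        ((∀ s ≤ t, X σ s = x s) ∧ ((∀ i < t, ecoin σ (i + 1) = e i) ∧ _ ∈ D'))
      constructor
      · rintro ⟨⟨h1, h2⟩, h4⟩
        exact ⟨((hpast σ).1 h4).1, ⟨((hpast σ).1 h4).2, (hmem σ h4).1 ⟨h1, h2⟩⟩⟩
      · rintro ⟨h1, ⟨h2, h3⟩⟩
        have h5 := (hpast σ).2 ⟨h1, h2⟩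
        exact ⟨(hmem σ h5).2 h3, h5⟩
  · have h0 : ∀ A : Set (Sample d S),
        M.annealed (A ∩ (fun σ => ((past t σ).1, (past t σ).2.1)) ⁻¹' {(a, b)}) = 0 := by
      intro A
      refine measure_mono_null ?_ M.annealed_ae_zero
      rintro σ ⟨-, hσ⟩ h0
      refine ha ?_
      have h1 : (past t σ).1 = a := congrArg Prod.fst hσ
      rw [← h1]
      exact h0
    rw [h0, h0, zero_mul]

end RWDRE

/-! ### Independence of the coins that the walk has not used yet -/

lemma indepFun_prod_snd {Ω Ω' A B C : Type*} [MeasurableSpace Ω] [MeasurableSpace Ω']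
    [MeasurableSpace A] [MeasurableSpace B] [MeasurableSpace C] (μ : Measure Ω)
    [IsProbabilityMeasure μ] (ν : Measure Ω') [IsProbabilityMeasure ν] {f₁ : Ω → A} {f₂ : Ω' → B}
    {g : Ω' → C} (hf₁ : Measurable f₁) (hf₂ : Measurable f₂) (hg : Measurable g)
    (h : IndepFun f₂ g ν) :
    IndepFun (fun η : Ω × Ω' => (f₁ η.1, f₂ η.2)) (fun η => g η.2) (μ.prod ν) := by
  rw [indepFun_iff_measure_inter_preimage_eq_mul] at h ⊢
  intro D E hD hE
  have hF : Measurable fun η : Ω × Ω' => (f₁ η.1, f₂ η.2) := by fun_prop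
  have hG : Measurable fun η : Ω × Ω' => g η.2 := by fun_prop
  rw [Measure.prod_apply ((hF hD).inter (hG hE)), Measure.prod_apply (hF hD),
    Measure.prod_apply (hG hE)]
  have e1 : ∀ ω, Prod.mk ω ⁻¹' ((fun η : Ω × Ω' => g η.2) ⁻¹' E) = g ⁻¹' E := fun ω => rfl
  have e2 : ∀ ω, Prod.mk ω ⁻¹' ((fun η : Ω × Ω' => (f₁ η.1, f₂ η.2)) ⁻¹' D ∩
      (fun η : Ω × Ω' => g η.2) ⁻¹' E) = f₂ ⁻¹' (Prod.mk (f₁ ω) ⁻¹' D) ∩ g ⁻¹' E := fun ω => rfl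
  have e3 : ∀ ω, Prod.mk ω ⁻¹' ((fun η : Ω × Ω' => (f₁ η.1, f₂ η.2)) ⁻¹' D) =
      f₂ ⁻¹' (Prod.mk (f₁ ω) ⁻¹' D) := fun ω => rfl
  have e4 : ∀ ω, ν (f₂ ⁻¹' (Prod.mk (f₁ ω) ⁻¹' D) ∩ g ⁻¹' E) =
      ν (f₂ ⁻¹' (Prod.mk (f₁ ω) ⁻¹' D)) * ν (g ⁻¹' E) := fun ω =>
    h _ _ (measurable_prodMk_left hD) hE
  simp only [e1, e2, e3, e4, lintegral_const, measure_univ, mul_one]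
  rw [lintegral_mul_const]
  exact measurable_measure_prodMk_left (hF hD)

lemma indepFun_prod_fst {Ω Ω' A B C : Type*} [MeasurableSpace Ω] [MeasurableSpace Ω']
    [MeasurableSpace A] [MeasurableSpace B] [MeasurableSpace C] (μ : Measure Ω)
    [IsProbabilityMeasure μ] (ν : Measure Ω') [IsProbabilityMeasure ν] {f₁ : Ω → A} {f₂ : Ω' → B}
    {g : Ω → C} (hf₁ : Measurable f₁) (hf₂ : Measurable f₂) (hg : Measurable g)
    (h : IndepFun f₁ g μ) :
    IndepFun (fun η : Ω × Ω' => (f₁ η.1, f₂ η.2)) (fun η => g η.1) (μ.prod ν) := by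
  have h1 := indepFun_prod_snd ν μ hf₂ hf₁ hg h
  rw [← Measure.prod_swap, indepFun_iff_measure_inter_preimage_eq_mul] at h1
  rw [indepFun_iff_measure_inter_preimage_eq_mul]
  intro D E hD hE
  have h2 := h1 (Prod.swap ⁻¹' D) E (measurable_swap hD) hE
  have hF' : Measurable fun η : Ω' × Ω => (f₂ η.1, f₁ η.2) := by fun_prop
  have hG' : Measurable fun η : Ω' × Ω => g η.2 := by fun_prop
  rw [Measure.map_apply measurable_swap ((hF' (measurable_swap hD)).inter (hG' hE)),
    Measure.map_apply measurable_swap (hF' (measurable_swap hD)),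
    Measure.map_apply measurable_swap (hG' hE)] at h2
  exact h2

/-- The states and `κ`-coins before time `t`, and the `ε`-coins up to time `t`. -/
def coinHist {d : ℕ} {S : Type*} (t : ℕ) (η : (Site d → ℕ → S × Bool) × (ℕ → Bool)) :
    (Site d → Fin t → S × Bool) × (Fin (t + 1) → Bool) :=
  (fun y i => η.1 y i, fun i => η.2 i)

/-- The history of the sample before the `κ`-coins of time `t` and the `ε`-coin of time `t + 1`. -/
def hist {d : ℕ} {S : Type*} (t : ℕ) (σ : Sample d S) :
    (Fin (t + 1) → Site d) × ((Site d → Fin t → S × Bool) × (Fin (t + 1) → Bool)) :=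
  (fun i => X σ i, coinHist t σ.1)

namespace RWDRE

variable {d : ℕ} {S : Type*} [MeasurableSpace S] (M : RWDRE d S)

lemma measurable_coinHist (t : ℕ) : Measurable (coinHist (d := d) (S := S) t) := by
  unfold coinHist; fun_prop

lemma measurable_hist (t : ℕ) : Measurable (hist (d := d) (S := S) t) :=
  (measurable_pi_iff.2 fun i : Fin (t + 1) => measurable_X (i : ℕ)).prodMk
    ((measurable_coinHist t).comp measurable_fst)

/-- Steps up to time `t` read only states before `t` and `ε`-coins up to `t`. The weight of a path
is thus a function of `coinHist t`, and independence from `coinHist t` under the coin law passes to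
`hist t` under the annealed law. -/
lemma annealed_hist_inter (t : ℕ) {g : (Site d → ℕ → S × Bool) × (ℕ → Bool) → Bool}
    (hg : Measurable g) (hind : IndepFun (coinHist t) g M.coinLaw) (b : Bool) {A : Set (Sample d S)}
    (hA : MeasurableSet[MeasurableSpace.comap (hist t) inferInstance] A) :
    M.annealed (A ∩ {σ | g σ.1 = b}) = M.annealed A * M.coinLaw {η | g η = b} := by
  obtain ⟨D, hD, rfl⟩ := hA
  have hDm := measurable_hist t hD
  have hgm : MeasurableSet {σ : Sample d S | g σ.1 = b} :=
    (hg.comp measurable_fst) (measurableSet_singleton b)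
  have hf : Measurable fun σ : Sample d S => (hist t σ).1 := (measurable_hist t).fst
  rw [measure_eq_tsum_fiber M.annealed hf hDm,
    measure_eq_tsum_fiber M.annealed hf (hDm.inter hgm), ← ENNReal.tsum_mul_right]
  refine tsum_congr fun a => ?_
  by_cases ha : a 0 = 0
  · set x : ℕ → Site d := fun s => a ⟨min s t, by omega⟩
    have hx : ∀ σ : Sample d S, (hist t σ).1 = a ↔ ∀ s ≤ t, X σ s = x s := by
      intro σ
      constructor
      · intro h s hs
        have := congrFun h ⟨s, by omega⟩
        simpa [hist, x, hs] using this
      · intro h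
        funext i
        have := h i (by omega)
        have hi : min (i : ℕ) t = i := by omega
        simpa [hist, x, hi] using this
    set G : Set ((Site d → ℕ → S × Bool) × (ℕ → Bool)) := {η | (a, coinHist t η) ∈ D}
    have hG : MeasurableSet G := (measurable_const.prodMk (measurable_coinHist t)) hD
    have hgm' : MeasurableSet {η | g η = b} := hg (measurableSet_singleton b)
    have hx0 : x 0 = 0 := by simpa [x] using ha
    have h1 := M.annealed_path t hx0 hG MeasurableSet.univ
    have h2 := M.annealed_path t hx0 (hG.inter hgm') MeasurableSet.univ
    simp only [Set.preimage_univ, measure_univ, mul_one, Set.mem_univ, and_true] at h1 h2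
    have e1 : hist t ⁻¹' D ∩ (fun σ => (hist t σ).1) ⁻¹' {a} =
        {σ | (∀ s ≤ t, X σ s = x s) ∧ σ.1 ∈ G} := by
      ext σ
      change (hist t σ ∈ D ∧ (hist t σ).1 = a) ↔ (∀ s ≤ t, X σ s = x s) ∧ (a, coinHist t σ.1) ∈ D
      rw [← hx, and_comm]
      refine and_congr_right fun h => ?_
      rw [← h]
      rfl
    have e2 : (hist t ⁻¹' D ∩ {σ | g σ.1 = b}) ∩ (fun σ => (hist t σ).1) ⁻¹' {a} =
        {σ | (∀ s ≤ t, X σ s = x s) ∧ σ.1 ∈ G ∩ {η | g η = b}} := by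
      rw [Set.inter_right_comm, e1]
      ext σ
      exact and_assoc
    rw [e1, e2, h1, h2]
    set p : (Site d → Fin t → S × Bool) × (Fin (t + 1) → Bool) → ℝ≥0∞ := fun u =>
      ∏ s : Fin t, M.jumpKernel ((u.1 (x s) s).1, u.2 s.succ) {x ((s : ℕ) + 1) - x s}
    have hp : Measurable p := Finset.measurable_prod _ fun s _ =>
      (M.jumpKernel.measurable_coe (measurableSet_singleton _)).comp (by fun_prop)
    have hpp : ∀ η, M.pathProb t x η = p (coinHist t η) := by
      intro η
      rw [pathProb, Finset.prod_range]
      rfl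
    have hq : Measurable fun u => {u | (a, u) ∈ D}.indicator (1 : _ × _ → ℝ≥0∞) u * p u :=
      (measurable_one.indicator (measurable_prodMk_left hD)).mul hp
    have hb : Measurable (({b} : Set Bool).indicator (1 : Bool → ℝ≥0∞)) := measurable_of_finite _
    have h3 := lintegral_mul_eq_lintegral_mul_lintegral_of_indepFun''
      (hq.comp (measurable_coinHist t)).aemeasurable (hb.comp hg).aemeasurable (hind.comp hq hb)
    have hgb : ∫⁻ η, ({b} : Set Bool).indicator 1 (g η) ∂M.coinLaw = M.coinLaw {η | g η = b} := by
      rw [← lintegral_indicator_one hgm']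
      rfl
    simp only [Function.comp] at h3
    rw [hgb] at h3
    refine Eq.trans (lintegral_congr fun η => ?_) (h3.trans (congrArg (· * _)
      (lintegral_congr fun η => ?_)))
    · rw [hpp, Set.inter_indicator_one, Pi.mul_apply, mul_right_comm]
      rfl
    · rw [hpp]; rfl
  · have h0 : ∀ A : Set (Sample d S), M.annealed (A ∩ (fun σ => (hist t σ).1) ⁻¹' {a}) = 0 := by
      intro A
      refine measure_mono_null ?_ M.annealed_ae_zero
      rintro σ ⟨-, hσ⟩ h0
      refine ha ?_
      have h1 : (hist t σ).1 = a := hσ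
      rw [← h1]
      exact h0
    rw [h0, h0, zero_mul]

lemma coin_false {r : ℝ} : coin r {false} = ENNReal.ofReal (1 - r) := by
  simp [coin]

lemma indepFun_ecoin (t : ℕ) :
    IndepFun (coinHist t) (fun η => η.2 (t + 1)) M.coinLaw := by
  have h := indepFun_infinitePi_of_disjoint (coin M.ε) (I := Set.Iic t) (J := {t + 1})
    (by simp) (i := fun i : Fin (t + 1) => (i : ℕ)) (j := fun _ : Unit => t + 1)
    (fun k => by simp only [Set.mem_Iic]; omega) (fun k => rfl)
  have h2 := h.comp measurable_id (measurable_pi_apply ())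
  exact indepFun_prod_snd (Measure.infinitePi fun _ : Site d => M.siteLaw)
    (Measure.infinitePi fun _ : ℕ => coin M.ε)
    (f₁ := fun ζ y (i : Fin t) => ζ y i) (f₂ := fun ε (i : Fin (t + 1)) => ε i)
    (g := fun ε => ε (t + 1)) (by fun_prop) (by fun_prop) (by fun_prop) h2

lemma coinLaw_ecoin (t : ℕ) :
    M.coinLaw {η | η.2 t = false} = ENNReal.ofReal (1 - M.ε) := by
  have : {η : (Site d → ℕ → S × Bool) × (ℕ → Bool) | η.2 t = false} =
      Set.univ ×ˢ ((fun ε => ε t) ⁻¹' {false}) := by ext; simp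
  rw [this, coinLaw, Measure.prod_prod, measure_univ, one_mul,
    ← Measure.map_apply (measurable_pi_apply t) (measurableSet_singleton _),
    Measure.infinitePi_map_eval, coin_false]

/-- Each step tosses its coin afresh, whatever the current state. The coin of time `0` is a dummy,
hence `0 < t`. -/
lemma lintegral_siteLaw_coin {t : ℕ} (ht : 0 < t) {D : Set (Fin t → S × Bool)}
    (hD : MeasurableSet D) (F : Set Bool) :
    ∫⁻ z, D.indicator 1 (fun i : Fin t => z i) * F.indicator 1 (z t).2 ∂M.siteLaw =
      (∫⁻ z, D.indicator 1 (fun i : Fin t => z i) ∂M.siteLaw) * coin M.κ F := by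
  obtain ⟨n, rfl⟩ : ∃ n, t = n + 1 := ⟨t - 1, by omega⟩
  have hDm : Measurable fun z : ℕ → S × Bool => D.indicator (1 : (Fin (n + 1) → S × Bool) → ℝ≥0∞)
      fun i => z i := (measurable_one.indicator hD).comp (by fun_prop)
  have hF : MeasurableSet F := MeasurableSet.of_discrete
  have hFm : Measurable fun z : ℕ → S × Bool => F.indicator (1 : Bool → ℝ≥0∞) (z (n + 1)).2 :=
    (measurable_one.indicator hF).comp (by fun_prop)
  rw [lintegral_siteLaw M (hDm.fun_mul hFm), lintegral_siteLaw M hDm,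
    ← lintegral_mul_const _ ((Measurable.lintegral_kernel hDm).fun_comp
      (by fun_prop : Measurable fun w : S => (w, false)))]
  refine lintegral_congr fun w => ?_
  have hg : Measurable fun p : Finset.Iic n → S × Bool =>
      D.indicator (1 : (Fin (n + 1) → S × Bool) → ℝ≥0∞) fun i => p ⟨i, by
        simp only [Finset.mem_Iic]; omega⟩ := (measurable_one.indicator hD).comp (by fun_prop)
  have h := lintegral_markovChain_last (fun _ => M.siteStep) (w, false) n hg
    (B := Prod.snd ⁻¹' F) (measurable_snd hF)
  have hs : ∀ a, M.siteStep a (Prod.snd ⁻¹' F) = coin M.κ F := by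
    intro a
    rw [← lintegral_indicator_one (measurable_snd hF), lintegral_siteStep M a
      (measurable_one.indicator (measurable_snd hF))]
    have : ∀ b w, (Prod.snd ⁻¹' F).indicator (1 : S × Bool → ℝ≥0∞) (w, b) = F.indicator 1 b :=
      fun b w => rfl
    simp only [this, lintegral_const, measure_univ, mul_one]
    exact lintegral_indicator_one hF
  simp only [hs] at h
  rw [← lintegral_mul_const _ hDm]
  exact h

lemma indepFun_kcoin {t : ℕ} (ht : 0 < t) (y : Site d) :
    IndepFun (coinHist t) (fun η => (η.1 y t).2) M.coinLaw ∧
      M.coinLaw {η | (η.1 y t).2 = false} = ENNReal.ofReal (1 - M.κ) := by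
  have hU : Measurable fun (z : ℕ → S × Bool) (i : Fin t) => z i := by fun_prop
  have hV : Measurable fun z : ℕ → S × Bool => (z t).2 := by fun_prop
  have key : ∀ (D : Set (Site d → Fin t → S × Bool)) (F : Set Bool), MeasurableSet D →
      Measure.infinitePi (fun _ : Site d => M.siteLaw)
        ((fun ζ y (i : Fin t) => ζ y i) ⁻¹' D ∩ (fun ζ => (ζ y t).2) ⁻¹' F) =
      Measure.infinitePi (fun _ : Site d => M.siteLaw) ((fun ζ y (i : Fin t) => ζ y i) ⁻¹' D) *
        coin M.κ F := by
    intro D F hD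
    have hF : MeasurableSet F := MeasurableSet.of_discrete
    have hb : MeasurableSet ((fun b : Site d → Bool => b y) ⁻¹' F) := measurable_pi_apply y hF
    -- The sitewise factorisation with trivial weights, where `V` is the coin of time `t`.
    have h := lintegral_infinitePi_factor (ι := Site d) M.siteLaw (coin M.κ) hU hV ∅
      (g := fun _ => 1) (fun _ => measurable_one) (fun _ _ => le_rfl) (fun _ _ => rfl)
      (fun i D F hD _ => by simpa using M.lintegral_siteLaw_coin ht hD F) hD
      (h := ((fun b : Site d → Bool => b y) ⁻¹' F).indicator 1) (measurable_one.indicator hb)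
    have hUm : Measurable fun (ζ : Site d → ℕ → S × Bool) y (i : Fin t) => ζ y i := by fun_prop
    have hVm : Measurable fun ζ : Site d → ℕ → S × Bool => (ζ y t).2 := by fun_prop
    rw [lintegral_indicator_one hb, ← Measure.map_apply (measurable_pi_apply y) hF,
      Measure.infinitePi_map_eval] at h
    simp only [Finset.prod_empty, one_mul] at h
    rw [← lintegral_indicator_one ((hUm hD).inter (hVm hF)), ← lintegral_indicator_one (hUm hD)]
    refine Eq.trans (lintegral_congr fun ζ => ?_) h
    rw [Set.inter_indicator_one]
    rfl
  have hmarg : ∀ F : Set Bool, Measure.infinitePi (fun _ : Site d => M.siteLaw)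
      ((fun ζ => (ζ y t).2) ⁻¹' F) = coin M.κ F := by
    intro F
    simpa using key Set.univ F MeasurableSet.univ
  have hind : IndepFun (fun (ζ : Site d → ℕ → S × Bool) y (i : Fin t) => ζ y i)
      (fun ζ => (ζ y t).2) (Measure.infinitePi fun _ : Site d => M.siteLaw) := by
    rw [indepFun_iff_measure_inter_preimage_eq_mul]
    intro D F hD _
    rw [key D F hD, hmarg]
  refine ⟨?_, ?_⟩
  · exact indepFun_prod_fst (Measure.infinitePi fun _ : Site d => M.siteLaw)
      (Measure.infinitePi fun _ : ℕ => coin M.ε)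
      (f₁ := fun ζ y (i : Fin t) => ζ y i) (f₂ := fun ε (i : Fin (t + 1)) => ε i)
      (g := fun ζ => (ζ y t).2) (by fun_prop) (by fun_prop) (by fun_prop) hind
  · have : {η : (Site d → ℕ → S × Bool) × (ℕ → Bool) | (η.1 y t).2 = false} =
        ((fun ζ => (ζ y t).2) ⁻¹' {false}) ×ˢ Set.univ := by ext; simp
    rw [this, coinLaw, Measure.prod_prod, measure_univ, mul_one, hmarg, coin_false]

end RWDRE

/-! ### Finiteness of the first regeneration time -/

section Pending

variable {d : ℕ} {S : Type*}

/-- Time `s` is a proper visit, and the visited site has not been refreshed before time `t`. -/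
def Pending (s t : ℕ) (σ : Sample d S) : Prop :=
  ecoin σ (s + 1) = false ∧ ∀ v, s < v → v < t → kcoin σ v (X σ s) = false

lemma exists_pending {t : ℕ} {σ : Sample d S} (h : ¬ Regen t σ) : ∃ s < t, Pending s t σ := by
  simp only [Regen, not_forall] at h
  obtain ⟨s, hs, he, hv⟩ := h
  push Not at hv
  exact ⟨s, hs, he, fun v h1 h2 => by simpa using hv v h1 h2⟩

variable [MeasurableSpace S]

lemma measurable_hist_X {s t : ℕ} (h : s ≤ t) :
    Measurable[MeasurableSpace.comap (hist t) inferInstance] fun σ : Sample d S => X σ s :=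
  (by fun_prop : Measurable fun u : (Fin (t + 1) → Site d) ×
    ((Site d → Fin t → S × Bool) × (Fin (t + 1) → Bool)) => u.1 ⟨s, Nat.lt_succ_of_le h⟩).comp
      (comap_measurable (hist t))

lemma measurable_hist_ecoin {s t : ℕ} (h : s ≤ t) :
    Measurable[MeasurableSpace.comap (hist t) inferInstance] fun σ : Sample d S => ecoin σ s :=
  (by fun_prop : Measurable fun u : (Fin (t + 1) → Site d) ×
    ((Site d → Fin t → S × Bool) × (Fin (t + 1) → Bool)) => u.2.2 ⟨s, Nat.lt_succ_of_le h⟩).comp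
      (comap_measurable (hist t))

lemma measurable_hist_kcoin {s t : ℕ} (h : s < t) (y : Site d) :
    Measurable[MeasurableSpace.comap (hist t) inferInstance] fun σ : Sample d S => kcoin σ s y :=
  (by fun_prop : Measurable fun u : (Fin (t + 1) → Site d) ×
    ((Site d → Fin t → S × Bool) × (Fin (t + 1) → Bool)) => (u.2.1 y ⟨s, h⟩).2).comp
      (comap_measurable (hist t))

/-- `Regen r` reads `κ`-coins strictly before `r`, so deciding whether `τ₁` exceeds `t` does not
reveal the coins of time `t`. -/
lemma measurableSet_hist_lt_τ₁ (t : ℕ) :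
    MeasurableSet[MeasurableSpace.comap (hist t) inferInstance]
      {σ : Sample d S | (t : ℕ∞) < τ₁ σ} := by
  have : {σ : Sample d S | (t : ℕ∞) < τ₁ σ} =
      ⋂ r, ⋂ (_ : r ≤ t), ⋂ (_ : 0 < r), {σ | Regen r σ}ᶜ := by
    ext σ
    simp [lt_τ₁_iff]
  rw [this]
  refine MeasurableSet.iInter fun r => MeasurableSet.iInter fun hr => MeasurableSet.iInter fun _ =>
    MeasurableSet.compl ?_
  exact @measurableSet_regen d S (Sample d S) (MeasurableSpace.comap (hist t) inferInstance) id r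
    (fun s hs => measurable_hist_X (by omega)) (fun s hs => measurable_hist_ecoin (by omega))
    (fun v _ hv y => measurable_hist_kcoin (by omega) y)

lemma measurableSet_hist_pending {s t : ℕ} (hst : s < t) :
    MeasurableSet[MeasurableSpace.comap (hist t) inferInstance]
      {σ : Sample d S | Pending s t σ} := by
  have : {σ : Sample d S | Pending s t σ} = {σ | ecoin σ (s + 1) = false} ∩
      ⋂ v, ⋂ (_ : s < v), ⋂ (_ : v < t), ⋃ y, ({σ | X σ s = y} ∩ {σ | kcoin σ v y = false}) := by
    ext σ
    simp [Pending]
  rw [this]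
  refine MeasurableSet.inter (measurable_hist_ecoin (by omega) (measurableSet_singleton false)) ?_
  exact MeasurableSet.iInter fun v => MeasurableSet.iInter fun _ => MeasurableSet.iInter fun hv =>
    MeasurableSet.iUnion fun y => MeasurableSet.inter
      (measurable_hist_X (by omega) (measurableSet_singleton y))
      (measurable_hist_kcoin hv y (measurableSet_singleton false))

end Pending

namespace RWDRE

variable {d : ℕ} {S : Type*} [MeasurableSpace S] (M : RWDRE d S)

/-- The expected number of pending visits before the first regeneration. -/
def pendingMass (t : ℕ) : ℝ≥0∞ :=
  ∑ s ∈ Finset.range t, M.annealed ({σ | (t : ℕ∞) < τ₁ σ} ∩ {σ | Pending s t σ})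

lemma annealed_lt_τ₁_le {t : ℕ} (ht : 0 < t) :
    M.annealed {σ | (t : ℕ∞) < τ₁ σ} ≤ M.pendingMass t := by
  refine le_trans (measure_mono fun σ hσ => ?_) (measure_biUnion_finset_le (Finset.range t) _)
  obtain ⟨s, hs, hp⟩ := exists_pending ((lt_τ₁_iff σ t).1 hσ t le_rfl ht)
  simp only [Set.mem_iUnion]
  exact ⟨s, Finset.mem_range.2 hs, hσ, hp⟩

/-- The site `X σ s` is random but part of the history, so it may be fixed by summing over its
values. -/
lemma annealed_pending_kcoin {s t : ℕ} (hst : s < t) {A : Set (Sample d S)}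
    (hA : MeasurableSet[MeasurableSpace.comap (hist t) inferInstance] A) :
    M.annealed (A ∩ {σ | kcoin σ t (X σ s) = false}) =
      M.annealed A * ENNReal.ofReal (1 - M.κ) := by
  have hle := (measurable_hist (d := d) (S := S) t).comap_le
  have hm : MeasurableSet {σ : Sample d S | kcoin σ t (X σ s) = false} := by
    have : {σ : Sample d S | kcoin σ t (X σ s) = false} =
        ⋃ y, ({σ | X σ s = y} ∩ {σ | kcoin σ t y = false}) := by ext; simp
    rw [this]
    exact MeasurableSet.iUnion fun y => (measurable_X s (measurableSet_singleton y)).inter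
      (measurable_kcoin t y (measurableSet_singleton false))
  rw [measure_eq_tsum_fiber M.annealed (measurable_X s) ((hle _ hA).inter hm),
    measure_eq_tsum_fiber M.annealed (measurable_X s) (hle _ hA), ← ENNReal.tsum_mul_right]
  refine tsum_congr fun y => ?_
  obtain ⟨h1, h2⟩ := M.indepFun_kcoin (show 0 < t by omega) y
  have h := M.annealed_hist_inter t (g := fun η => (η.1 y t).2) (by fun_prop) h1 false
    (MeasurableSet.inter hA (measurable_hist_X hst.le (measurableSet_singleton y)))
  rw [h2] at h
  rw [← h]
  congr 1
  ext σ
  change ((σ ∈ A ∧ kcoin σ t (X σ s) = false) ∧ X σ s = y) ↔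
    ((σ ∈ A ∧ X σ s = y) ∧ kcoin σ t y = false)
  constructor
  · rintro ⟨⟨h1, h2⟩, h3⟩
    exact ⟨⟨h1, h3⟩, h3 ▸ h2⟩
  · rintro ⟨⟨h1, h2⟩, h3⟩
    exact ⟨⟨h1, h2 ▸ h3⟩, h2⟩

/-- An old visit still pending at time `t + 1` needs the coin of time `t` at its site to show
`false`. The visit at time `t` is proper only if the `ε`-coin of time `t + 1` shows `false`, and its
contribution is controlled because `{τ₁ > t}` already forces a pending visit. -/
lemma pendingMass_succ_le {t : ℕ} (ht : 0 < t) :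
    M.pendingMass (t + 1) ≤
      (ENNReal.ofReal (1 - M.κ) + ENNReal.ofReal (1 - M.ε)) * M.pendingMass t := by
  have hmono : ∀ σ : Sample d S, ((t + 1 : ℕ) : ℕ∞) < τ₁ σ → (t : ℕ∞) < τ₁ σ := fun σ h =>
    lt_of_le_of_lt (by exact_mod_cast Nat.le_succ t) h
  rw [pendingMass, Finset.sum_range_succ, add_mul]
  refine add_le_add ?_ ?_
  · rw [mul_comm, pendingMass, Finset.sum_mul]
    refine Finset.sum_le_sum fun s hs => ?_
    have hs' := Finset.mem_range.1 hs
    rw [← M.annealed_pending_kcoin hs' (MeasurableSet.inter (measurableSet_hist_lt_τ₁ t)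
      (measurableSet_hist_pending hs'))]
    refine measure_mono ?_
    rintro σ ⟨h1, h2⟩
    exact ⟨⟨hmono σ h1, h2.1, fun v hv hvt => h2.2 v hv (by omega)⟩, h2.2 t hs' (by omega)⟩
  · have h := M.annealed_hist_inter t (g := fun η => η.2 (t + 1)) (by fun_prop)
      (M.indepFun_ecoin t) false (measurableSet_hist_lt_τ₁ t)
    rw [coinLaw_ecoin] at h
    calc _ ≤ M.annealed ({σ | (t : ℕ∞) < τ₁ σ} ∩ {σ | σ.1.2 (t + 1) = false}) := by
          refine measure_mono ?_
          rintro σ ⟨h1, h2⟩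
          exact ⟨hmono σ h1, h2.1⟩
      _ = ENNReal.ofReal (1 - M.ε) * M.annealed {σ | (t : ℕ∞) < τ₁ σ} := by rw [h, mul_comm]
      _ ≤ _ := by gcongr; exact M.annealed_lt_τ₁_le ht

lemma ae_τ₁_lt_top : ∀ᵐ σ ∂M.annealed, τ₁ σ < ⊤ := by
  set r := ENNReal.ofReal (1 - M.κ) + ENNReal.ofReal (1 - M.ε)
  have hr : r < 1 := by
    have h1 := M.κ_lt_one
    have h2 := M.ε_lt_one
    have h3 := M.ε_pos
    have h4 := M.tradeoff
    simp only [r]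
    rw [← ENNReal.ofReal_add (by linarith) (by linarith), ENNReal.ofReal_lt_one]
    -- `ε ^ 2 < ε` turns the trade-off into `κ + ε > 1`.
    nlinarith
  have hpow : ∀ t, M.pendingMass (t + 1) ≤ r ^ t := by
    intro t
    induction t with
    | zero => simpa [pendingMass] using prob_le_one
    | succ t ih =>
      calc _ ≤ r * M.pendingMass (t + 1) := M.pendingMass_succ_le (by omega)
        _ ≤ r * r ^ t := by gcongr
        _ = _ := (pow_succ' r t).symm
  have htop : ∀ t, M.annealed {σ | ¬ τ₁ σ < ⊤} ≤ r ^ t := fun t =>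
    le_trans (measure_mono fun σ hσ => by
      have : τ₁ σ = ⊤ := by simpa using hσ
      change ((t + 1 : ℕ) : ℕ∞) < τ₁ σ
      rw [this]
      exact ENat.natCast_lt_top _) ((M.annealed_lt_τ₁_le (Nat.succ_pos t)).trans (hpow t))
  rw [ae_iff]
  exact le_antisymm (ge_of_tendsto' (ENNReal.tendsto_pow_atTop_nhds_zero_of_lt_one hr) htop)
    (zero_le)

end RWDRE

lemma measurable_apply_countable {Ω I T : Type*} [MeasurableSpace Ω] [MeasurableSpace I]
    [Countable I] [MeasurableSingletonClass I] [MeasurableSpace T] {f : Ω → I} (hf : Measurable f)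
    {g : I → Ω → T} (hg : ∀ i, Measurable (g i)) : Measurable fun ω => g (f ω) ω :=
  (measurable_from_prod_countable_right (f := fun z : I × Ω => g z.1 z.2) hg).comp
    (hf.prodMk measurable_id)

/-! ### Regeneration times and increments of the restarted sample -/

section Path

variable {d : ℕ} {S : Type*}

/-- `Regen` only compares sites with one another and reads no coin of time `0`, so neither the
recentring nor the erased coins matter. -/
lemma regen_shift_restart (t k m : ℕ) (σ : Sample d S) :
    Regen t (shift k (restart m σ)) ↔ Regen t (shift (m + k) σ) := by
  have he : ∀ s, ecoin (shift k (restart m σ)) (s + 1) = ecoin (shift (m + k) σ) (s + 1) := by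
    intro s
    simp [ecoin, shift, restart, envFrom, coinsFrom, add_assoc]
  have hk : ∀ s v, s < v → kcoin (shift k (restart m σ)) v (X (shift k (restart m σ)) s) =
      kcoin (shift (m + k) σ) v (X (shift (m + k) σ) s) := by
    intro s v hv
    have hv0 : ¬ v = 0 := by omega
    simp [kcoin, X, shift, restart, envFrom, siteFrom, walkAfter, add_assoc, hv0]
  refine forall_congr' fun s => forall_congr' fun _ => ?_
  rw [he]
  refine forall_congr' fun _ => exists_congr fun v => and_congr_right fun hv => ?_
  rw [hk s v hv]

lemma τ₁_shift_restart (k m : ℕ) (σ : Sample d S) :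
    τ₁ (shift k (restart m σ)) = τ₁ (shift (m + k) σ) := by
  simp only [τ₁_eq, regen_shift_restart]

lemma shift_zero (σ : Sample d S) : shift 0 σ = σ := by
  simp [shift]

lemma τ_one (σ : Sample d S) : τ 1 σ = τ₁ σ := by
  simp [τ, shift_zero]

lemma τ_restart_zero (n : ℕ) (σ : Sample d S) : τ n (restart 0 σ) = τ n σ := by
  induction n with
  | zero => rfl
  | succ n ih => rw [τ, τ, ih, τ₁_shift_restart, zero_add]

lemma X_restart (m t : ℕ) (σ : Sample d S) : X (restart m σ) t = X σ (m + t) - X σ m := rfl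

lemma increment_restart_zero (n : ℕ) (σ : Sample d S) :
    increment n (restart 0 σ) = increment n σ := by
  simp [increment, τ_restart_zero, X_restart]

/-- `τ` is defined by adding a last step, while the inductions on regeneration times remove the
first. -/
lemma τ_succ_eq {m : ℕ} {σ : Sample d S} (h : τ₁ σ = m) (n : ℕ) :
    τ (n + 1) σ = m + τ n (restart m σ) := by
  induction n with
  | zero => rw [zero_add, τ_one, h, τ, add_zero]
  | succ n ih =>
    rw [τ, ih, τ, ← add_assoc]
    generalize τ n (restart m σ) = u
    induction u using ENat.recTopCoe with
    | top => simp
    | coe k => rw [← Nat.cast_add, ENat.toNat_natCast, ENat.toNat_natCast, τ₁_shift_restart]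

/-- Finiteness is needed for the subtraction in `ℕ∞` and for `toNat` to commute with adding `m`. -/
lemma increment_succ_eq {m : ℕ} {σ : Sample d S} (h : τ₁ σ = m) (n : ℕ)
    (hfin : ∀ k, τ k (restart m σ) < ⊤) :
    increment (n + 1) σ = increment n (restart m σ) := by
  unfold increment
  rw [τ_succ_eq h, τ_succ_eq h]
  obtain ⟨a, ha⟩ := ENat.ne_top_iff_exists.1 (hfin (n + 1)).ne
  obtain ⟨b, hb⟩ := ENat.ne_top_iff_exists.1 (hfin n).ne
  rw [← ha, ← hb]
  norm_cast
  simp only [ENat.toNat_natCast, X_restart]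
  rw [Nat.add_sub_add_left, sub_sub_sub_cancel_right]

lemma increment_zero_eq {m : ℕ} {σ : Sample d S} (h : τ₁ σ = m) :
    increment 0 σ = ((m : ℕ∞), X σ m - X σ 0) := by
  rw [increment, zero_add, τ_one, h, τ]
  simp

/-- The data that generate `H₁`. -/
def stopped (σ : Sample d S) : ℕ∞ × (ℕ → Site d) × (ℕ → Site d → Bool) :=
  (τ₁ σ, (fun t : ℕ => X σ (min (t : ℕ∞) (τ₁ σ)).toNat),
    (fun (t : ℕ) (x : Site d) => kcoin σ (min ((t + 1 : ℕ) : ℕ∞) (τ₁ σ)).toNat x))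

lemma stopped_eq {m : ℕ} {σ : Sample d S} (h : τ₁ σ = m) :
    stopped σ = ((m : ℕ∞), (fun t => X σ (min t m)), fun t x => kcoin σ (min (t + 1) m) x) := by
  have hmin : ∀ t : ℕ, (min (t : ℕ∞) (m : ℕ∞)).toNat = min t m := by
    intro t
    rcases le_total t m with h | h
    · rw [min_eq_left h, min_eq_left (by exact_mod_cast h), ENat.toNat_natCast]
    · rw [min_eq_right h, min_eq_right (by exact_mod_cast h), ENat.toNat_natCast]
  simp only [stopped, h, hmin]

lemma measurable_past_X {s t : ℕ} (h : s ≤ t) :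
    Measurable[MeasurableSpace.comap (past t) inferInstance] fun σ : Sample d S => X σ s :=
  (by fun_prop : Measurable fun u : (Fin (t + 1) → Site d) × (Fin t → Bool) ×
    (Site d → Fin t → Bool) => u.1 ⟨s, Nat.lt_succ_of_le h⟩).comp (comap_measurable (past t))

lemma measurable_past_ecoin {s t : ℕ} (h : s < t) :
    Measurable[MeasurableSpace.comap (past t) inferInstance]
      fun σ : Sample d S => ecoin σ (s + 1) :=
  (by fun_prop : Measurable fun u : (Fin (t + 1) → Site d) × (Fin t → Bool) ×
    (Site d → Fin t → Bool) => u.2.1 ⟨s, h⟩).comp (comap_measurable (past t))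

lemma measurable_past_kcoin {s t : ℕ} (h0 : 0 < s) (h : s ≤ t) (y : Site d) :
    Measurable[MeasurableSpace.comap (past t) inferInstance] fun σ : Sample d S => kcoin σ s y := by
  obtain ⟨s, rfl⟩ := Nat.exists_eq_succ_of_ne_zero h0.ne'
  exact (by fun_prop : Measurable fun u : (Fin (t + 1) → Site d) × (Fin t → Bool) ×
    (Site d → Fin t → Bool) => u.2.2 y ⟨s, h⟩).comp (comap_measurable (past t))

lemma measurableSet_past_regen {s t : ℕ} (h : s ≤ t) :
    MeasurableSet[MeasurableSpace.comap (past t) inferInstance] {σ : Sample d S | Regen s σ} :=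
  @measurableSet_regen d S (Sample d S) (MeasurableSpace.comap (past t) inferInstance) id s
    (fun r hr => measurable_past_X (by omega)) (fun r hr => measurable_past_ecoin (by omega))
    (fun v hv0 hv y => measurable_past_kcoin hv0 (by omega) y)

lemma measurableSet_past_τ₁ (t : ℕ) :
    MeasurableSet[MeasurableSpace.comap (past t) inferInstance] {σ : Sample d S | τ₁ σ = t} := by
  have : {σ : Sample d S | τ₁ σ = t} = {_σ | 0 < t} ∩ ({σ | Regen t σ} ∩
      ⋂ r, ⋂ (_ : r < t), ⋂ (_ : 0 < r), {σ | Regen r σ}ᶜ) := by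
    ext σ
    simp only [τ₁_eq_coe_iff, Set.mem_inter_iff, Set.mem_iInter, Set.mem_compl_iff,
      Set.mem_ofPred_eq]
  rw [this]
  exact MeasurableSet.inter (MeasurableSet.const _) (MeasurableSet.inter
    (measurableSet_past_regen le_rfl) (MeasurableSet.iInter fun r => MeasurableSet.iInter fun hr =>
      MeasurableSet.iInter fun _ => (measurableSet_past_regen hr.le).compl))

lemma measurableSet_past_increment (A : Set (ℕ∞ × Site d)) (t : ℕ) :
    MeasurableSet[MeasurableSpace.comap (past t) inferInstance]
      (increment (S := S) 0 ⁻¹' A ∩ {σ | τ₁ σ = t}) := by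
  have : increment (S := S) 0 ⁻¹' A ∩ {σ | τ₁ σ = t} =
      {σ | (X σ t, X σ 0) ∈ {z : Site d × Site d | ((t : ℕ∞), z.1 - z.2) ∈ A}} ∩
        {σ | τ₁ σ = t} := by
    ext σ
    refine and_congr_left fun h => ?_
    change increment 0 σ ∈ A ↔ _
    rw [increment_zero_eq h]
    rfl
  rw [this]
  have hX : Measurable[MeasurableSpace.comap (past t) inferInstance]
      fun σ : Sample d S => (X σ t, X σ 0) :=
    (measurable_past_X le_rfl).prodMk (measurable_past_X (Nat.zero_le t))
  exact MeasurableSet.inter (hX MeasurableSet.of_discrete) (measurableSet_past_τ₁ t)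

lemma measurableSet_past_stopped {A : Set (ℕ∞ × (ℕ → Site d) × (ℕ → Site d → Bool))}
    (hA : MeasurableSet A) (t : ℕ) :
    MeasurableSet[MeasurableSpace.comap (past t) inferInstance]
      (stopped (S := S) ⁻¹' A ∩ {σ | τ₁ σ = t}) := by
  -- At `t = 0` the stopped coins would be the dummies of time `0`, which `past` does not contain;
  -- but `τ₁` is never `0`.
  rcases Nat.eq_zero_or_pos t with rfl | ht
  · have : {σ : Sample d S | τ₁ σ = (0 : ℕ)} = ∅ :=
      Set.eq_empty_iff_forall_notMem.2 fun σ h => τ₁_pos σ h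
    rw [this, Set.inter_empty]
    exact @MeasurableSet.empty _ (MeasurableSpace.comap (past 0) inferInstance)
  have : stopped (S := S) ⁻¹' A ∩ {σ | τ₁ σ = t} =
      (fun σ : Sample d S => ((t : ℕ∞), (fun s => X σ (min s t)),
        fun s x => kcoin σ (min (s + 1) t) x)) ⁻¹' A ∩ {σ | τ₁ σ = t} := by
    ext σ
    refine and_congr_left fun h => ?_
    change stopped σ ∈ A ↔ _
    rw [stopped_eq h]
    rfl
  rw [this]
  let m : MeasurableSpace (Sample d S) := MeasurableSpace.comap (past t) inferInstance
  have hX : Measurable[m] fun (σ : Sample d S) s => X σ (min s t) :=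
    @measurable_pi_lambda _ _ _ m _ _ fun s => measurable_past_X (min_le_right s t)
  have hk : Measurable[m] fun (σ : Sample d S) s x => kcoin σ (min (s + 1) t) x :=
    @measurable_pi_lambda _ _ _ m _ _ fun s => @measurable_pi_lambda _ _ _ m _ _ fun x =>
      measurable_past_kcoin (by omega) (min_le_right _ t) x
  have hY : Measurable[m] fun σ : Sample d S => ((t : ℕ∞), (fun s => X σ (min s t)),
      fun s x => kcoin σ (min (s + 1) t) x) :=
    (@measurable_const _ _ _ m _).prodMk (hX.prodMk hk)
  exact MeasurableSet.inter (hY hA) (measurableSet_past_τ₁ t)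

variable [MeasurableSpace S]

lemma measurable_shift (m : ℕ) : Measurable (shift (d := d) (S := S) m) := by
  unfold shift
  fun_prop

lemma measurable_toNat : Measurable ENat.toNat := Measurable.of_discrete

lemma measurable_τ (n : ℕ) : Measurable (τ n : Sample d S → ℕ∞) := by
  induction n with
  | zero => exact measurable_const
  | succ n ih =>
    have h : Measurable fun σ : Sample d S => τ₁ (shift (τ n σ).toNat σ) :=
      measurable_apply_countable (measurable_toNat.comp ih)
        (g := fun (m : ℕ) (σ : Sample d S) => τ₁ (shift m σ))
        fun m => measurable_τ₁.comp (measurable_shift m)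
    exact (Measurable.of_discrete (f := fun z : ℕ∞ × ℕ∞ => z.1 + z.2)).comp (ih.prodMk h)

lemma measurable_X_of {f : Sample d S → ℕ} (hf : Measurable f) :
    Measurable fun σ : Sample d S => X σ (f σ) :=
  measurable_apply_countable hf (g := fun (m : ℕ) (σ : Sample d S) => X σ m) measurable_X

lemma measurable_increment (n : ℕ) : Measurable (increment (d := d) (S := S) n) := by
  have hX : ∀ n, Measurable fun σ : Sample d S => X σ (τ n σ).toNat := fun n =>
    measurable_X_of (measurable_toNat.comp (measurable_τ n))
  exact ((Measurable.of_discrete (f := fun z : ℕ∞ × ℕ∞ => z.1 - z.2)).comp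
    ((measurable_τ (n + 1)).prodMk (measurable_τ n))).prodMk
    ((Measurable.of_discrete (f := fun z : Site d × Site d => z.1 - z.2)).comp
      ((hX (n + 1)).prodMk (hX n)))

lemma measurable_stopped : Measurable (stopped (d := d) (S := S)) := by
  have h : ∀ t : ℕ, Measurable fun σ : Sample d S => (min (t : ℕ∞) (τ₁ σ)).toNat := fun t =>
    (Measurable.of_discrete (f := fun u : ℕ∞ => (min (t : ℕ∞) u).toNat)).comp measurable_τ₁
  refine measurable_τ₁.prodMk ((measurable_pi_iff.2 fun t => measurable_X_of (h t)).prodMk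
    (measurable_pi_iff.2 fun t => measurable_pi_iff.2 fun x => ?_))
  exact measurable_apply_countable (h (t + 1))
    (g := fun (m : ℕ) (σ : Sample d S) => kcoin σ m x) fun m => measurable_kcoin m x

lemma measurable_restart_τ₁ : Measurable fun σ : Sample d S => restart (τ₁ σ).toNat σ :=
  measurable_apply_countable (measurable_toNat.comp measurable_τ₁)
    (g := fun (m : ℕ) (σ : Sample d S) => restart m σ) measurable_restart

end Path

/-! ### The regeneration structure -/

namespace RWDRE

variable {d : ℕ} {S : Type*} [MeasurableSpace S] (M : RWDRE d S)

/-- The sample seen from the walk at time `τ₁` is a fresh copy of the sample, independent of all that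
is determined by the past of `τ₁`. -/
lemma annealed_restart_τ₁ {A : Set (Sample d S)} (hA : MeasurableSet A)
    (hpast : ∀ t : ℕ, MeasurableSet[MeasurableSpace.comap (past t) inferInstance]
      (A ∩ {σ | τ₁ σ = t})) {F : Set (Sample d S)} (hF : MeasurableSet F) :
    M.annealed (A ∩ {σ | restart (τ₁ σ).toNat σ ∈ F}) =
      M.annealed A * M.annealed {σ | restart 0 σ ∈ F} := by
  rw [measure_eq_tsum_fiber M.annealed measurable_τ₁ hA,
    measure_eq_tsum_fiber M.annealed measurable_τ₁
      (A := A ∩ {σ | restart (τ₁ σ).toNat σ ∈ F}) (hA.inter (measurable_restart_τ₁ hF)),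
    ← ENNReal.tsum_mul_right]
  refine tsum_congr fun u => ?_
  induction u using ENat.recTopCoe with
  | top =>
    have h0 : ∀ B : Set (Sample d S), M.annealed (B ∩ τ₁ ⁻¹' {⊤}) = 0 := fun B =>
      measure_mono_null (fun σ hσ (h : τ₁ σ < ⊤) => h.ne hσ.2) M.ae_τ₁_lt_top
    rw [h0, h0, zero_mul]
  | coe t =>
    obtain ⟨D, hD, hDA⟩ := hpast t
    have hmem : ∀ σ : Sample d S, past t σ ∈ D ↔ σ ∈ A ∧ τ₁ σ = t := fun σ =>
      Set.ext_iff.1 hDA σ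
    have hreg : ∀ σ : Sample d S, τ₁ σ = t → Regen t σ := fun σ h =>
      ((τ₁_eq_coe_iff σ t).1 h).2.1
    convert M.annealed_regen t hD hF using 2
    · ext σ
      change ((σ ∈ A ∧ restart (τ₁ σ).toNat σ ∈ F) ∧ τ₁ σ = t) ↔
        (past t σ ∈ D ∧ Regen t σ ∧ restart t σ ∈ F)
      rw [hmem]
      constructor
      · rintro ⟨⟨h1, h2⟩, h3⟩
        rw [h3, ENat.toNat_natCast] at h2
        exact ⟨⟨h1, h3⟩, hreg σ h3, h2⟩
      · rintro ⟨⟨h1, h3⟩, -, h2⟩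
        rw [h3, ENat.toNat_natCast]
        exact ⟨⟨h1, h2⟩, rfl⟩
    · congr 1
      ext σ
      change (σ ∈ A ∧ τ₁ σ = t) ↔ (past t σ ∈ D ∧ Regen t σ)
      rw [hmem]
      exact ⟨fun h => ⟨h, hreg σ h.2⟩, fun h => h.1⟩

lemma annealed_restart_τ₁_law {F : Set (Sample d S)} (hF : MeasurableSet F) :
    M.annealed {σ | restart (τ₁ σ).toNat σ ∈ F} = M.annealed {σ | restart 0 σ ∈ F} := by
  have h := M.annealed_restart_τ₁ MeasurableSet.univ
    (fun t => by rw [Set.univ_inter]; exact measurableSet_past_τ₁ t) hF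
  rwa [Set.univ_inter, measure_univ, one_mul] at h

lemma ae_restart_τ₁ {p : Sample d S → Prop} (hp : MeasurableSet {σ | p σ})
    (h : ∀ᵐ σ ∂M.annealed, p (restart 0 σ)) :
    ∀ᵐ σ ∂M.annealed, p (restart (τ₁ σ).toNat σ) :=
  (M.annealed_restart_τ₁_law hp.compl).trans h

/-- The sample restarted at `τ₁` has the law of `restart 0 σ`, so almost sure finiteness of `τ n`
passes to it. -/
lemma ae_τ_lt_top (n : ℕ) : ∀ᵐ σ ∂M.annealed, τ n σ < ⊤ := by
  induction n with
  | zero => exact Filter.Eventually.of_forall fun σ => ENat.natCast_lt_top 0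
  | succ n ih =>
    have h := M.ae_restart_τ₁ (p := fun σ => τ n σ < ⊤)
      (measurable_τ n (MeasurableSet.of_discrete (s := Set.Iio ⊤)))
      (by simpa only [τ_restart_zero] using ih)
    filter_upwards [h, M.ae_τ₁_lt_top] with σ h1 h2
    obtain ⟨m, hm⟩ := ENat.ne_top_iff_exists.1 h2.ne
    rw [← hm, ENat.toNat_natCast] at h1
    rw [τ_succ_eq hm.symm]
    exact WithTop.add_lt_top.2 ⟨ENat.natCast_lt_top m, h1⟩

lemma ae_increment_succ : ∀ᵐ σ ∂M.annealed, ∀ n,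
    increment (n + 1) σ = increment n (restart (τ₁ σ).toNat σ) := by
  have h : ∀ᵐ σ ∂M.annealed, ∀ k, τ k (restart (τ₁ σ).toNat σ) < ⊤ :=
    ae_all_iff.2 fun k => M.ae_restart_τ₁ (p := fun σ => τ k σ < ⊤)
      (measurable_τ k (MeasurableSet.of_discrete (s := Set.Iio ⊤)))
      (by simpa only [τ_restart_zero] using M.ae_τ_lt_top k)
  filter_upwards [h, M.ae_τ₁_lt_top] with σ h1 h2 n
  obtain ⟨m, hm⟩ := ENat.ne_top_iff_exists.1 h2.ne
  rw [← hm, ENat.toNat_natCast] at h1 ⊢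
  exact increment_succ_eq hm.symm n h1

lemma annealed_increment (n : ℕ) {A : Set (ℕ∞ × Site d)} (hA : MeasurableSet A) :
    M.annealed (increment n ⁻¹' A) = M.annealed (increment 0 ⁻¹' A) := by
  induction n with
  | zero => rfl
  | succ n ih =>
    rw [← ih]
    have h := M.annealed_restart_τ₁_law (measurable_increment n hA)
    simp only [Set.mem_preimage, increment_restart_zero] at h
    refine Eq.trans (measure_congr ?_) h
    filter_upwards [M.ae_increment_succ] with σ hσ
    refine propext ?_
    change increment (n + 1) σ ∈ A ↔ increment n (restart (τ₁ σ).toNat σ) ∈ A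
    rw [hσ n]

/-- The first increment is determined by the past of `τ₁`, and the others are the increments of the
restarted sample, so one factor splits off at each induction step. -/
lemma annealed_increments (n : ℕ) {A : ℕ → Set (ℕ∞ × Site d)} (hA : ∀ i, MeasurableSet (A i)) :
    M.annealed {σ | ∀ i < n, increment i σ ∈ A i} =
      ∏ i ∈ Finset.range n, M.annealed (increment 0 ⁻¹' A i) := by
  induction n generalizing A with
  | zero => simp
  | succ n ih =>
    have hF : MeasurableSet {σ : Sample d S | ∀ i < n, increment i σ ∈ A (i + 1)} := by
      have : {σ : Sample d S | ∀ i < n, increment i σ ∈ A (i + 1)} =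
          ⋂ i, ⋂ (_ : i < n), increment i ⁻¹' A (i + 1) := by ext; simp
      rw [this]
      exact MeasurableSet.iInter fun i => MeasurableSet.iInter fun _ =>
        measurable_increment i (hA (i + 1))
    have h := M.annealed_restart_τ₁ (measurable_increment 0 (hA 0))
      (measurableSet_past_increment (A 0)) hF
    simp only [Set.mem_ofPred_eq, increment_restart_zero] at h
    rw [Finset.prod_range_succ', mul_comm, ← ih fun i => hA (i + 1), ← h]
    refine measure_congr ?_
    filter_upwards [M.ae_increment_succ] with σ hσ
    refine propext ?_
    change (∀ i < n + 1, increment i σ ∈ A i) ↔ increment 0 σ ∈ A 0 ∧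
      ∀ i < n, increment i (restart (τ₁ σ).toNat σ) ∈ A (i + 1)
    simp only [← hσ]
    rw [Nat.forall_lt_succ_left]

lemma iIndepFun_increment : iIndepFun (fun n : ℕ => increment (d := d) (S := S) n) M.annealed := by
  classical
  rw [iIndepFun_iff_measure_inter_preimage_eq_mul]
  intro I B hB
  -- Filling the gaps with `Set.univ` reduces an arbitrary finite index set to an initial segment.
  set A : ℕ → Set (ℕ∞ × Site d) := fun i => if i ∈ I then B i else Set.univ
  have hA : ∀ i, MeasurableSet (A i) := fun i => by
    by_cases h : i ∈ I
    · simpa [A, h] using hB i h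
    · simp [A, h]
  have hI : ∀ i ∈ I, i < I.sup id + 1 := fun i hi =>
    Nat.lt_succ_of_le (Finset.le_sup (f := id) hi)
  have h := M.annealed_increments (I.sup id + 1) hA
  convert h using 1
  · congr 1
    ext σ
    simp only [Set.mem_iInter, Set.mem_preimage, Set.mem_ofPred_eq]
    refine ⟨fun h i _ => ?_, fun h i hi => by simpa [A, hi] using h i (hI i hi)⟩
    by_cases hi : i ∈ I
    · simpa [A, hi] using h i hi
    · simp [A, hi]
  · refine Eq.trans ?_ (Finset.prod_subset (fun i hi => Finset.mem_range.2 (hI i hi)) ?_)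
    · refine Finset.prod_congr rfl fun i hi => ?_
      rw [M.annealed_increment i (hB i hi)]
      simp [A, hi]
    · intro i _ hi
      simp [A, hi]

/-- `H₁` is the `σ`-algebra generated by `stopped`, so by independence the conditional probability
is constant. -/
lemma condExp_restart {F : Set (Sample d S)} (hF : MeasurableSet F) :
    M.annealed⟦{σ | restart (τ₁ σ).toNat σ ∈ F} | H₁ d S⟧ =ᵐ[M.annealed]
      fun _ => M.annealed.real {σ | restart 0 σ ∈ F} := by
  have hind : IndepFun (fun σ : Sample d S => restart (τ₁ σ).toNat σ) stopped M.annealed := by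
    rw [indepFun_iff_measure_inter_preimage_eq_mul]
    intro G D hG hD
    have h := M.annealed_restart_τ₁ (measurable_stopped hD) (measurableSet_past_stopped hD) hG
    rw [← M.annealed_restart_τ₁_law hG] at h
    rw [Set.inter_comm, mul_comm]
    exact h
  have h := condExp_indep_eq (f := {σ : Sample d S | restart (τ₁ σ).toNat σ ∈ F}.indicator
    fun _ => (1 : ℝ)) measurable_restart_τ₁.comap_le (measurable_stopped (d := d) (S := S)).comap_le
    (stronglyMeasurable_const.indicator ⟨F, hF, rfl⟩) hind
  refine h.trans (Filter.EventuallyEq.of_eq ?_)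
  funext σ
  rw [integral_indicator_const (s := {σ : Sample d S | restart (τ₁ σ).toNat σ ∈ F}) (1 : ℝ)
    (measurable_restart_τ₁ hF), smul_eq_mul, mul_one, measureReal_def, M.annealed_restart_τ₁_law hF, measureReal_def]

end RWDRE

end DynRWRE

end

open DynRWRE in
theorem lemma3p2 {d : ℕ} (hd : 1 ≤ d) {S : Type*} [TopologicalSpace S] [PolishSpace S]
    [MeasurableSpace S] [BorelSpace S] (M : RWDRE d S) :
    (∀ (A : Set (ℕ → Site d)) (B : Set (ℕ → Site d → S)) (C : Set (ℕ → Site d → Bool)),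
      MeasurableSet A → MeasurableSet B → MeasurableSet C →
      M.annealed⟦{σ | walkAfter (τ₁ σ).toNat σ ∈ A ∧ envAfter (τ₁ σ).toNat σ ∈ B ∧
          kcoinAfter (τ₁ σ).toNat σ ∈ C} | H₁ d S⟧
        =ᵐ[M.annealed] fun _ => M.annealed.real
          {σ | (fun t => X σ t) ∈ A ∧ (fun t x => env σ t x) ∈ B ∧
            (fun t x => kcoin σ (t + 1) x) ∈ C}) ∧
    (∀ n : ℕ, 1 ≤ n → ∀ᵐ σ ∂M.annealed, τ n σ < ⊤) ∧
    iIndepFun (fun n : ℕ => increment (d := d) (S := S) n) M.annealed ∧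
    ∀ n : ℕ, IdentDistrib (increment (d := d) (S := S) n) (increment 0) M.annealed M.annealed := by
  refine ⟨fun A B C hA hB hC => ?_, fun n _ => M.ae_τ_lt_top n, M.iIndepFun_increment,
    fun n => ⟨(measurable_increment n).aemeasurable, (measurable_increment 0).aemeasurable, ?_⟩⟩
  · set F : Set (Sample d S) := {σ | (fun t => X σ t) ∈ A ∧ (fun t x => env σ t x) ∈ B ∧
      (fun t x => kcoin σ (t + 1) x) ∈ C}
    have hF : MeasurableSet F :=
      (measurable_pi_iff.2 measurable_X hA).inter
        ((measurable_pi_iff.2 (fun t => measurable_pi_iff.2 fun x => measurable_env t x) hB).inter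
          (measurable_pi_iff.2 (fun t => measurable_pi_iff.2 fun x => measurable_kcoin (t + 1) x)
            hC))
    -- `F` reads the `κ`-coins from time `1` on, so the coins erased by `restart` do not enter.
    have hmem : ∀ (m : ℕ) (σ : Sample d S), restart m σ ∈ F ↔
        (walkAfter m σ ∈ A ∧ envAfter m σ ∈ B ∧ kcoinAfter m σ ∈ C) := by
      intro m σ
      have h1 : (fun t => X (restart m σ) t) = walkAfter m σ := rfl
      have h2 : (fun t x => env (restart m σ) t x) = envAfter m σ := by
        funext t x
        by_cases ht : t = 0 <;> simp [env, envAfter, restart, envFrom, siteFrom, ht]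
      have h3 : (fun t x => kcoin (restart m σ) (t + 1) x) = kcoinAfter m σ := by
        funext t x
        simp [kcoin, kcoinAfter, restart, envFrom, siteFrom]
      change (_ ∈ A ∧ _ ∈ B ∧ _ ∈ C) ↔ _
      rw [h1, h2, h3]
    -- As `X σ 0 = 0` almost surely, restarting at time `0` changes nothing that `F` reads.
    have h0 : M.annealed {σ | restart 0 σ ∈ F} = M.annealed F := by
      refine measure_congr ?_
      filter_upwards [M.annealed_ae_zero] with σ hσ
      refine propext ?_
      change restart 0 σ ∈ F ↔ _
      rw [hmem]
      have h1 : walkAfter 0 σ = fun t => X σ t := by funext t; simp [walkAfter, hσ]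
      have h2 : envAfter 0 σ = fun t x => env σ t x := by funext t x; simp [envAfter, hσ]
      have h3 : kcoinAfter 0 σ = fun t x => kcoin σ (t + 1) x := by
        funext t x; simp [kcoinAfter, hσ]
      rw [h1, h2, h3]
      rfl
    have h := M.condExp_restart hF
    simp only [hmem] at h
    simp only [← hmem 0, measureReal_def, h0] at h
    exact h
  · ext A hA
    rw [Measure.map_apply (measurable_increment n) hA, Measure.map_apply (measurable_increment 0) hA,
      M.annealed_increment n hA]
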